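/- **Model.** Let $\mathcal V=\{1,\dots,N\}$ with undirected loopless graphs $\mathcal G(k)$ on $\mathcal V$, $k\ge 0$, and sets $F(k)\subseteq\mathcal V$ of failed agents, isolated in $\mathcal G(k)$. Write $\mathcal N_i(k)$ for the neighbours of $i$ in $\mathcal G(k)$. Fix $\rho>0$, $u\in\mathbb C$ with $|u|=1$, $p_i\in(0,1)$, $\sigma_i\in\mathbb R$, $\Lambda_{ij}=\Lambda_{ji}\ge 0$ with $\Lambda_{ij}>0$ whenever $i,j$ are adjacent in some $\mathcal G(k)$, initial states $x_i(0)\ge 0$ (deterministic) and step sizes $\alpha(k)>0$. For $k\ge0$, $i,j\in\mathcal V$ let $\gamma_i(k)\in\{0,1\}$ with $\mathbb P(\gamma_i(k)=1)=p_i$, $h_{ij}(k)\sim\mathcal{CN}(0,\Lambda_{ij})$ and $n_i(k)\sim\mathcal{CN}(0,\sigma_i^2)$ (circularly symmetric complex Gaussians with the indicated total variance), all mutually independent. Put $\Gamma_{ij}(k)=\gamma_i(k)(1-\gamma_j(k))+\gamma_j(k)(1-\gamma_i(k))$, $q_{ij}=p_i(1-p_j)+p_j(1-p_i)$, and $\bar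 a_{ij}(k)=\rho q_{ij}\Lambda_{ij}$ if $j\in\mathcal N_i(k)$, $\bar a_{ij}(k)=0$ otherwise; $\bar{\mathcal L}(k)=\mathrm{diag}\big(\sum_j\bar a_{ij}(k)\big)_i-(\bar a_{ij}(k))_{i,j}$. Failed agents keep their state, $x_i(k+1)=x_i(k)$ for $i\in F(k)$; the others update by $$x_i(k+1)=\Big(1-\alpha(k)\sum_j\bar a_{ij}(k)\Big)x_i(k)+\alpha(k)\big(E_i(k)-\sigma_i^2\big),$$ where the received energy $E_i(k)$ is, in expanded form, $$E_i(k)=\sum_{j\in\mathcal N_i(k)}\rho x_j(k)\Gamma_{ij}(k)|h_{ij}(k)|^2+|n_i(k)|^2+\sum_{j\in\mathcal N_i(k)}\sum_{l\in\mathcal N_i(k)\setminus\{j\}}Y^{(1)}_{i,jl}(k)+2\sum_{j\in\mathcal N_i(k)}Y^{(2)}_{ij}(k),$$ $$Y^{(1)}_{i,jl}=\rho\sqrt{x_jx_l}\,\Gamma_{ij}\Gamma_{il}\big(\mathrm{Re}[h_{ij}u]\mathrm{Re}[h_{il}u]+\mathrm{Im}[h_{ij}u]\mathrm{Im}[h_{il}u]\big),\quad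 Y^{(2)}_{ij}=\sqrt{\rho x_j}\,\Gamma_{ij}\big(\mathrm{Re}[h_{ij}u]\mathrm{Re}[n_i]+\mathrm{Im}[h_{ij}u]\mathrm{Im}[n_i]\big)$$ (argument $k$ omitted). Here $\sqrt r:=0$ for $r<0$. As long as all states are nonnegative, $E_i(k)=|y_i(k)|^2$ with $y_i(k)=\sum_{j\in\mathcal N_i(k)}\Gamma_{ij}(k)h_{ij}(k)\sqrt{\rho x_j(k)}\,u+n_i(k)$. **Assumptions.** (1) $\sum_k\alpha(k)=\infty$, $\sum_k\alpha(k)^2<\infty$, and $1-\alpha(k)\sum_j\bar a_{ij}(k)>0$ for all $i,k$. (2) There is an integer $L>0$ such that $\mathcal G(k)\cup\cdots\cup\mathcal G(k+L-1)$ is connected for every $k\ge0$. (3) $\alpha(k+1)\le\alpha(k)$ for all $k$ and $\limsup_k\alpha(k)/\alpha(k+1)<\infty$. **Constants.** Let $\|\cdot\|$ be the (spectral) 2-norm, $\lambda_2$ the second smallest eigenvalue counted with multiplicity (read as $0$ if $N=1$). Fix $L$ as in (2) and a constant $C$ such that for some integer $m_0>0$ we have $\alpha(mL)\le C\alpha((m+1)L)$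 and $\alpha(mL)\le1$ for all $m\ge m_0$. With empty products $1$ and empty sums $0$, put $$C_L=\sup_{k}\sum_i\sum_{j\in\mathcal N_i(k)}\big(8\Lambda_{ij}^2\rho^2q_{ij}-\bar a_{ij}(k)^2\big),\qquad C_M^{(1)}=\sum_i\sum_j\sum_{l\ne j}\tfrac12\rho^2\Lambda_{ij}\Lambda_{il}q_{ij}q_{il},$$ $$C_M^{(2)}=\sum_i\Big(7\sigma_i^4+2\sum_j\tfrac12\rho\Lambda_{ij}\sigma_i^2q_{ij}\max_vx_v(0)\Big),\qquad K=C_L+C_M^{(1)},$$ $$M_L=C^2(2^{2L}-2L-1)\max\{\sup_k\|\bar{\mathcal L}(k)\|,1\}^{2L},\qquad B_1=M_L+C^2K,$$ $$\Phi_2[l,m)=\prod_{j=l}^{m-1}\Big(1-2\inf_{b\ge0}\lambda_2\Big(\sum_{i=bL}^{(b+1)L-1}\bar{\mathcal L}(i)\Big)\alpha((j+1)L)+\alpha((j+1)L)^2B_1\Big),$$ $$\Phi_3[l,k)=\prod_{j=l}^{k-1}\big(\|I_N-\alpha(j)\bar{\mathcal L}(j)\|^2+\alpha(j)^2K\big),$$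 $$\overline M_2=K\sup_{m\ge0}\bigg\{\sup_{k_0\ge0}\Phi_3[mL,k_0+mL)\Big(\Phi_2[0,m)\|\boldsymbol x(0)\|^2+\sum_{l=0}^{m-1}\Phi_2[l,m)\sum_{i=lL}^{(l+1)L-1}\alpha(i)^2C_M^{(2)}\Phi_3[i,mL)\Big)$$ $$\qquad\qquad+\sup_{k_0\ge0}\sum_{i=mL}^{k_0+mL-1}\alpha(i)^2C_M^{(2)}\Phi_3[i,k_0+mL)\bigg\}+C_M^{(2)},$$ where the first supremum over $k_0$ is taken of the factor $\Phi_3[mL,k_0+mL)$ alone. **Theorem.** Under Assumptions (1)–(3) the system achieves mean-square average consensus: all $x_i(k)$ are square integrable, and there is a square-integrable random variable $x^*$ with $\lim_{k\to\infty}\mathbb E[(x_i(k)-x^*)^2]=0$ for every $i\in\mathcal V$ and $$\mathbb E[x^*]=\frac1N\sum_{i=1}^Nx_i(0).$$ Moreover, a constant $C$ as above exists, and for every such $C$, with the resulting $\overline M_2$, $$\mathrm{Var}(x^*)\le\frac{\overline M_2}{N}\sum_{t=0}^\infty\alpha(t)^2 .$$ -/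

import Mathlib

open MeasureTheory ProbabilityTheory Filter Topology
open scoped NNReal ENNReal

noncomputable section

namespace OTA

/-- The circularly symmetric complex Gaussian law `CN(0, v)`: the real and the imaginary part are
independent real Gaussians with mean `0` and variance `v / 2`. -/
def complexGaussian (v : ℝ≥0) : Measure ℂ :=
  ((gaussianReal 0 (v / 2)).prod (gaussianReal 0 (v / 2))).map Complex.measurableEquivRealProd.symm

/-- The deterministic data of a system of `N` agents that communicate over the air on a
time-varying undirected topology. -/
structure System (N : ℕ) where
  /-- transmission coefficient -/
  rho : ℝ
  /-- carrier wave -/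
  u : ℂ
  /-- `p i` is the probability that agent `i` transmits in the first slot -/
  p : Fin N → ℝ
  /-- `Lam i j` is the variance of the fading channel from `j` to `i` -/
  Lam : Fin N → Fin N → ℝ
  /-- `(sig i) ^ 2` is the variance of the receiver noise of agent `i` -/
  sig : Fin N → ℝ
  /-- initial information states -/
  x0 : Fin N → ℝ
  /-- step sizes -/
  alpha : ℕ → ℝ
  /-- `G k` is the network topology at time `k` -/
  G : ℕ → SimpleGraph (Fin N)
  /-- the agents that suffer from node failure at time `k` -/
  failed : ℕ → Set (Fin N)
  rho_pos : 0 < rho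
  norm_u : ‖u‖ = 1
  p_pos : ∀ i, 0 < p i
  p_lt_one : ∀ i, p i < 1
  Lam_nonneg : ∀ i j, 0 ≤ Lam i j
  Lam_symm : ∀ i j, Lam i j = Lam j i
  /-- a pair that can communicate at some time has a nondegenerate channel -/
  Lam_pos : ∀ k i j, (G k).Adj i j → 0 < Lam i j
  x0_nonneg : ∀ i, 0 ≤ x0 i
  alpha_pos : ∀ k, 0 < alpha k
  failed_isolated : ∀ k i j, i ∈ failed k → ¬ (G k).Adj i j

namespace System

variable {N : ℕ} (S : System N)

open Classical in
/-- The potential neighbours of agent `i` at time `k`. -/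
def nbrs (k : ℕ) (i : Fin N) : Finset (Fin N) := Finset.univ.filter fun j => (S.G k).Adj i j

/-- The probability that agents `i ≠ j` choose different slots. -/
def q (i j : Fin N) : ℝ := S.p i * (1 - S.p j) + S.p j * (1 - S.p i)

open Classical in
/-- The mean weights of the topology at time `k`. -/
def abar (k : ℕ) (i j : Fin N) : ℝ :=
  if (S.G k).Adj i j then S.rho * S.q i j * S.Lam i j else 0

/-- The mean Laplacian at time `k`. -/
def Lbar (k : ℕ) : Matrix (Fin N) (Fin N) ℝ :=
  Matrix.diagonal (fun i => ∑ j, S.abar k i j) - Matrix.of (S.abar k)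

/-! ### One communication round, as a function of the current states `x`, the slot choices `g`,
the channels `h` and the receiver noises `n` -/

/-- The indicator that `i` and `j` choose different slots (for `0`-`1` valued `g`). -/
def Gam (g : Fin N → ℝ) (i j : Fin N) : ℝ := g i * (1 - g j) + g j * (1 - g i)

/-- The signal transmitted by an agent in state `x`. -/
def signal (x : ℝ) : ℂ := (√(S.rho * x) : ℝ) * S.u

/-- The signal received by agent `i`. -/
def received (k : ℕ) (x g : Fin N → ℝ) (h : Fin N → Fin N → ℂ) (n : Fin N → ℂ) (i : Fin N) : ℂ :=
  ∑ j ∈ S.nbrs k i, (Gam g i j : ℂ) * h i j * S.signal (x j) + n i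

/-- Distortion caused by the non-coherent superposition of the signals of `j` and `l`. -/
def Y1 (x g : Fin N → ℝ) (h : Fin N → Fin N → ℂ) (i j l : Fin N) : ℝ :=
  S.rho * √(x j * x l) * Gam g i j * Gam g i l *
    ((h i j * S.u).re * (h i l * S.u).re + (h i j * S.u).im * (h i l * S.u).im)

/-- Distortion caused by the superposition of the signal of `j` and the receiver noise. -/
def Y2 (x g : Fin N → ℝ) (h : Fin N → Fin N → ℂ) (n : Fin N → ℂ) (i j : Fin N) : ℝ :=
  √(S.rho * x j) * Gam g i j *
    ((h i j * S.u).re * (n i).re + (h i j * S.u).im * (n i).im)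

/-- The received energy of agent `i`, in expanded form. For nonnegative states it is the squared
modulus of the received signal (`energy_eq_normSq`); the expanded form, in which the mean
contribution of each neighbour is linear in its state, also makes sense when noise has driven
some state below zero (there the root of a negative number counts as `0`). -/
def energy (k : ℕ) (x g : Fin N → ℝ) (h : Fin N → Fin N → ℂ) (n : Fin N → ℂ) (i : Fin N) : ℝ :=
  ∑ j ∈ S.nbrs k i, S.rho * x j * Gam g i j * ‖h i j‖ ^ 2 + ‖n i‖ ^ 2
    + ∑ j ∈ S.nbrs k i, ∑ l ∈ (S.nbrs k i).erase j, S.Y1 x g h i j l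
    + 2 * ∑ j ∈ S.nbrs k i, S.Y2 x g h n i j

open Classical in
/-- The consensus protocol: one update of the states; failed agents do not update. -/
def step (k : ℕ) (x g : Fin N → ℝ) (h : Fin N → Fin N → ℂ) (n : Fin N → ℂ) (i : Fin N) : ℝ :=
  if i ∈ S.failed k then x i
  else (1 - S.alpha k * ∑ j, S.abar k i j) * x i
    + S.alpha k * (S.energy k x g h n i - S.sig i ^ 2)

theorem sq_sum_add {ι : Type*} [DecidableEq ι] (s : Finset ι) (a : ι → ℝ) (c : ℝ) :
    (∑ j ∈ s, a j + c) ^ 2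
      = ∑ j ∈ s, a j ^ 2 + c ^ 2 + ∑ j ∈ s, ∑ l ∈ s.erase j, a j * a l
        + 2 * ∑ j ∈ s, a j * c := by
  have h1 : (∑ j ∈ s, a j) ^ 2
      = ∑ j ∈ s, a j ^ 2 + ∑ j ∈ s, ∑ l ∈ s.erase j, a j * a l := by
    rw [sq, Finset.sum_mul_sum, ← Finset.sum_add_distrib]
    refine Finset.sum_congr rfl fun j hj => ?_
    rw [← Finset.add_sum_erase s _ hj]
    ring
  rw [← Finset.sum_mul, add_sq, h1]
  ring

theorem energy_eq_normSq (k : ℕ) (x g : Fin N → ℝ) (h : Fin N → Fin N → ℂ) (n : Fin N → ℂ)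
    (i : Fin N) (hx : ∀ j, 0 ≤ x j) (hg : ∀ j, g j = 0 ∨ g j = 1) :
    S.energy k x g h n i = ‖S.received k x g h n i‖ ^ 2 := by
  have hG : ∀ j, Gam g i j ^ 2 = Gam g i j := by
    intro j
    unfold Gam
    rcases hg i with hi | hi <;> rcases hg j with hj | hj <;> rw [hi, hj] <;> norm_num
  have hre : (S.received k x g h n i).re
      = ∑ j ∈ S.nbrs k i, √(S.rho * x j) * Gam g i j * (h i j * S.u).re + (n i).re := by
    simp only [received, signal, Complex.add_re, Complex.re_sum]
    congr 1
    refine Finset.sum_congr rfl fun j _ => ?_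
    simp only [Complex.mul_re, Complex.mul_im, Complex.ofReal_re, Complex.ofReal_im]
    ring
  have him : (S.received k x g h n i).im
      = ∑ j ∈ S.nbrs k i, √(S.rho * x j) * Gam g i j * (h i j * S.u).im + (n i).im := by
    simp only [received, signal, Complex.add_im, Complex.im_sum]
    congr 1
    refine Finset.sum_congr rfl fun j _ => ?_
    simp only [Complex.mul_re, Complex.mul_im, Complex.ofReal_re, Complex.ofReal_im]
    ring
  have hroot : ∀ j, √(S.rho * x j) ^ 2 = S.rho * x j := fun j =>
    Real.sq_sqrt (mul_nonneg S.rho_pos.le (hx j))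
  have hu : ∀ z : ℂ, (z * S.u).re ^ 2 + (z * S.u).im ^ 2 = ‖z‖ ^ 2 := by
    intro z
    have : ‖z * S.u‖ ^ 2 = ‖z‖ ^ 2 := by rw [norm_mul, S.norm_u, mul_one]
    rw [← this, Complex.sq_norm, Complex.normSq_apply]
    ring
  have hprod : ∀ j l, S.rho * √(x j * x l) = √(S.rho * x j) * √(S.rho * x l) := by
    intro j l
    rw [Real.sqrt_mul S.rho_pos.le, Real.sqrt_mul S.rho_pos.le, Real.sqrt_mul (hx j)]
    have := Real.mul_self_sqrt S.rho_pos.le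
    linear_combination (-(√(x j) * √(x l))) * this
  rw [Complex.sq_norm, Complex.normSq_apply, ← sq, ← sq, hre, him, sq_sum_add, sq_sum_add]
  have e1 : ∑ j ∈ S.nbrs k i, S.rho * x j * Gam g i j * ‖h i j‖ ^ 2
      = ∑ j ∈ S.nbrs k i, (√(S.rho * x j) * Gam g i j * (h i j * S.u).re) ^ 2
        + ∑ j ∈ S.nbrs k i, (√(S.rho * x j) * Gam g i j * (h i j * S.u).im) ^ 2 := by
    rw [← Finset.sum_add_distrib]
    refine Finset.sum_congr rfl fun j _ => ?_
    rw [← hu, mul_pow, mul_pow, mul_pow, mul_pow, hroot, hG]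
    ring
  have e2 : ∑ j ∈ S.nbrs k i, ∑ l ∈ (S.nbrs k i).erase j, S.Y1 x g h i j l
      = ∑ j ∈ S.nbrs k i, ∑ l ∈ (S.nbrs k i).erase j,
          (√(S.rho * x j) * Gam g i j * (h i j * S.u).re)
            * (√(S.rho * x l) * Gam g i l * (h i l * S.u).re)
        + ∑ j ∈ S.nbrs k i, ∑ l ∈ (S.nbrs k i).erase j,
          (√(S.rho * x j) * Gam g i j * (h i j * S.u).im)
            * (√(S.rho * x l) * Gam g i l * (h i l * S.u).im) := by
    simp only [← Finset.sum_add_distrib]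
    refine Finset.sum_congr rfl fun j _ => Finset.sum_congr rfl fun l _ => ?_
    rw [Y1, hprod]
    ring
  have e3 : ∑ j ∈ S.nbrs k i, S.Y2 x g h n i j
      = ∑ j ∈ S.nbrs k i, (√(S.rho * x j) * Gam g i j * (h i j * S.u).re) * (n i).re
        + ∑ j ∈ S.nbrs k i, (√(S.rho * x j) * Gam g i j * (h i j * S.u).im) * (n i).im := by
    rw [← Finset.sum_add_distrib]
    refine Finset.sum_congr rfl fun j _ => ?_
    rw [Y2]
    ring
  have e4 : ‖n i‖ ^ 2 = (n i).re ^ 2 + (n i).im ^ 2 := by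
    rw [Complex.sq_norm, Complex.normSq_apply]
    ring
  rw [energy, e1, e2, e3, e4]
  ring

/-! ### The random system -/

/-- The states of all agents at time `k`, driven by the slot choices `γ`, the channels `h` and the
receiver noises `n`. -/
def state {Ω : Type*} (γ : ℕ → Fin N → Ω → ℝ) (h : ℕ → Fin N → Fin N → Ω → ℂ)
    (n : ℕ → Fin N → Ω → ℂ) : ℕ → Fin N → Ω → ℝ
  | 0 => fun i _ => S.x0 i
  | k + 1 => fun i ω =>
      S.step k (fun j => state γ h n k j ω) (fun j => γ k j ω) (fun a b => h k a b ω)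
        (fun j => n k j ω) i

end System

/-- Names of the random inputs of the system. -/
inductive Input (N : ℕ) where
  | slot (k : ℕ) (i : Fin N)
  | channel (k : ℕ) (i j : Fin N)
  | noise (k : ℕ) (i : Fin N)

/-- All random inputs as one family of complex random variables. -/
def inputs {N : ℕ} {Ω : Type*} (γ : ℕ → Fin N → Ω → ℝ) (h : ℕ → Fin N → Fin N → Ω → ℂ)
    (n : ℕ → Fin N → Ω → ℂ) : Input N → Ω → ℂ
  | .slot k i => fun ω => (γ k i ω : ℂ)
  | .channel k i j => h k i j
  | .noise k i => n k i

namespace System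

variable {N : ℕ} (S : System N)

/-- The probabilistic model: Bernoulli slot choices, complex Gaussian fading and complex Gaussian
receiver noise, all of them mutually independent. -/
structure IsModel {Ω : Type*} [MeasurableSpace Ω] (P : Measure Ω) (γ : ℕ → Fin N → Ω → ℝ)
    (h : ℕ → Fin N → Fin N → Ω → ℂ) (n : ℕ → Fin N → Ω → ℂ) : Prop where
  measurable_slot : ∀ k i, Measurable (γ k i)
  measurable_channel : ∀ k i j, Measurable (h k i j)
  measurable_noise : ∀ k i, Measurable (n k i)
  slot_one : ∀ k i, P {ω | γ k i ω = 1} = ENNReal.ofReal (S.p i)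
  slot_zero : ∀ k i, P {ω | γ k i ω = 0} = ENNReal.ofReal (1 - S.p i)
  channel_law : ∀ k i j, P.map (h k i j) = complexGaussian (S.Lam i j).toNNReal
  noise_law : ∀ k i, P.map (n k i) = complexGaussian (S.sig i ^ 2).toNNReal
  indep : iIndepFun (inputs γ h n) P

/-! ### Assumptions -/

/-- Step sizes: not summable, square summable, and small against the weights. -/
structure StepSizeCondition : Prop where
  sum_infinite : Tendsto (fun K => ∑ k ∈ Finset.range K, S.alpha k) atTop atTop
  sum_sq : Summable fun k => S.alpha k ^ 2
  small : ∀ k i, 0 < 1 - S.alpha k * ∑ j, S.abar k i j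

/-- `L`-connectivity: the union of the topologies over any `L` consecutive times is connected. -/
def JointlyConnected (L : ℕ) : Prop :=
  0 < L ∧ ∀ k, (⨆ t ∈ Set.Ico k (k + L), S.G t).Connected

/-- Step sizes are nonincreasing with asymptotically bounded ratios. -/
structure StepSizeDecay : Prop where
  anti : ∀ k, S.alpha (k + 1) ≤ S.alpha k
  ratio : limsup (fun k => ((S.alpha k / S.alpha (k + 1) : ℝ) : EReal)) atTop < ⊤

/-! ### The constant in the variance bound -/

/-- The 2-norm of a real square matrix. -/
def norm2 (A : Matrix (Fin N) (Fin N) ℝ) : ℝ := ‖Matrix.toEuclideanCLM (n := Fin N) (𝕜 := ℝ) A‖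

/-- The second smallest eigenvalue (with multiplicity) of a real symmetric matrix; `0` if `N < 2`. -/
def lambda2 (A : Matrix (Fin N) (Fin N) ℝ) : ℝ := (A.charpoly.roots.sort (· ≤ ·)).getD 1 0

def CL : ℝ :=
  ⨆ k, ∑ i, ∑ j ∈ S.nbrs k i, (8 * S.Lam i j ^ 2 * S.rho ^ 2 * S.q i j - S.abar k i j ^ 2)

def M1 (i j l : Fin N) : ℝ :=
  1 / 2 * S.rho ^ 2 * S.Lam i j * S.Lam i l * S.q i j * S.q i l

def M2 (i j : Fin N) : ℝ := 1 / 2 * S.rho * S.Lam i j * S.sig i ^ 2 * S.q i j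

def CM1 : ℝ := ∑ i, ∑ j, ∑ l ∈ Finset.univ.erase j, S.M1 i j l

def CM2 : ℝ := ∑ i, (7 * S.sig i ^ 4 + 2 * ∑ j, S.M2 i j * ⨆ v, S.x0 v)

/-- `C` bounds the ratio of the step sizes `L` steps apart, from some block on, and the step sizes
at the block ends are at most `1` from there on. -/
def IsRatioBound (L : ℕ) (C : ℝ) : Prop :=
  ∃ m₀ : ℕ, 0 < m₀ ∧ ∀ m ≥ m₀,
    S.alpha (m * L) ≤ C * S.alpha ((m + 1) * L) ∧ S.alpha (m * L) ≤ 1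

def ML (L : ℕ) (C : ℝ) : ℝ :=
  C ^ 2 * (2 ^ (2 * L) - 2 * L - 1) * max (⨆ k, norm2 (S.Lbar k)) 1 ^ (2 * L)

def B1 (L : ℕ) (C : ℝ) : ℝ := S.ML L C + C ^ 2 * (S.CL + S.CM1)

/-- Product over the blocks `j` with `l ≤ j < m`. -/
def Phi2 (L : ℕ) (C : ℝ) (l m : ℕ) : ℝ :=
  ∏ j ∈ Finset.Ico l m,
    (1 - 2 * (⨅ b : ℕ, lambda2 (∑ i ∈ Finset.Ico (b * L) ((b + 1) * L), S.Lbar i))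
        * S.alpha ((j + 1) * L)
      + S.alpha ((j + 1) * L) ^ 2 * S.B1 L C)

/-- Product over the times `j` with `l ≤ j < k`. -/
def Phi3 (l k : ℕ) : ℝ :=
  ∏ j ∈ Finset.Ico l k,
    (norm2 (1 - S.alpha j • S.Lbar j) ^ 2 + S.alpha j ^ 2 * (S.CL + S.CM1))

/-- The constant in the variance bound. -/
def Mbar2 (L : ℕ) (C : ℝ) : ℝ :=
  (S.CL + S.CM1) *
    (⨆ m : ℕ,
      ((⨆ k₀ : ℕ, S.Phi3 (m * L) (k₀ + m * L)) *
          (S.Phi2 L C 0 m * ∑ i, S.x0 i ^ 2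
            + ∑ l ∈ Finset.range m, S.Phi2 L C l m *
                ∑ i ∈ Finset.Ico (l * L) ((l + 1) * L),
                  S.alpha i ^ 2 * S.CM2 * S.Phi3 i (m * L))
        + ⨆ k₀ : ℕ, ∑ i ∈ Finset.Ico (m * L) (k₀ + m * L),
            S.alpha i ^ 2 * S.CM2 * S.Phi3 i (k₀ + m * L)))
  + S.CM2

end System

end OTA

end

/-! One update reads `x(k+1) = (I - α(k) L̄(k)) x(k) + α(k) w(k)`, where `w(k)` collects the
deviations of the received energies from their conditional means. Two facts about `w` carry the
proof: given the past it has mean zero, and its conditional second moment is at most quadratic in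
the current states.

Both come from freezing. The state at time `k` depends only on inputs before `k`, so it can be held
fixed while the round at time `k` is averaged. For frozen states the law of the round is invariant
under sign changes of channels and noises. Each interference term is odd under a suitable change, so
it is centred, orthogonal to the energy terms, and orthogonal to the interference of other links
(`integral_eq_zero_of_odd`, `integral_dist_const`, `integral_dist_const_sq_le`).

The matrix `I - α L̄` is symmetric and stochastic, hence of norm at most one. The second moment of
the states is therefore multiplied by at most `1 + α² K` per step and gains at most `α² C_M^{(2)}`;
square summability keeps it bounded (`secondMoment_le`). The resulting bound on the second moment of
`w` is majorised by the entry `m = 0` of the supremum in `Mbar2`; the other entries only have to be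
bounded, so that the supremum is a genuine one (`le_Mbar2`).

The columns of `L̄` sum to zero, so the mean of the states moves only by `α` times the mean of `w`.
Its increments are orthogonal with summable second moments, so it converges in `L²`, with constant
expectation. Since `(avg w)² ≤ ‖w‖² / N`, the variance of the limit is at most `Mbar2 / N` times the
sum of the `α²` (`exists_limit_meanState`).

For consensus, the mean squared deviation from the mean drops in each step by `α` times the expected
Dirichlet form, up to `O(α²)`. Over `L` steps the union graph is connected, so a Poincaré inequality
bounds the sum of the Dirichlet forms below by the deviation at the start of the block; replacing
the running state by the initial one costs `O(α²)`. Block step sizes still have infinite sum, so the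
deviation tends to zero (`exists_deviation_block_le`, `tendsto_deviation`). -/

namespace OTA

/-! ### Moments and symmetry of real and complex Gaussians. -/

theorem integrable_pow_gaussianReal (v : ℝ≥0) (n : ℕ) :
    Integrable (fun x : ℝ => x ^ n) (gaussianReal 0 v) := by
  have h := (memLp_id_gaussianReal' (μ := 0) (v := v) n (by simp)).integrable_norm_pow'
  refine h.mono' (by fun_prop) (Eventually.of_forall fun x => ?_)
  simp

theorem gaussianReal_map_neg_zero (v : ℝ≥0) : (gaussianReal 0 v).map (fun x => -x) = gaussianReal 0 v := by
  have := gaussianReal_map_neg (μ := 0) (v := v)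
  simpa using this

theorem integral_sq_gaussianReal (v : ℝ≥0) : ∫ x, x ^ 2 ∂gaussianReal 0 v = v := by
  have h := variance_fun_id_gaussianReal (μ := 0) (v := v)
  rw [variance_of_integral_eq_zero (by fun_prop) integral_id_gaussianReal] at h
  exact h

theorem integral_odd_gaussianReal (v : ℝ≥0) (n : ℕ) (hn : Odd n) :
    ∫ x, x ^ n ∂gaussianReal 0 v = 0 := by
  have h : ∫ x, x ^ n ∂gaussianReal 0 v = ∫ x, (-x) ^ n ∂gaussianReal 0 v := by
    conv_lhs => rw [← gaussianReal_map_neg_zero v]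
    rw [integral_map (by fun_prop) (by fun_prop)]
  simp only [hn.neg_pow, integral_neg] at h
  linarith

/-- If `X` and `X'` are independent with this law, then `√2 X` and `X + X'` have the same law.
Comparing their fourth moments gives `4 m = 2 m + 6 v²`, with no integration against the density. -/
theorem integral_pow_four_gaussianReal (v : ℝ≥0) : ∫ x, x ^ 4 ∂gaussianReal 0 v = 3 * v ^ 2 := by
  set m := ∫ x, x ^ 4 ∂gaussianReal 0 v with hm
  have e1 : ∫ x, x ^ 4 ∂gaussianReal 0 (v + v) = 4 * m := by
    have : (gaussianReal 0 v).map (fun x => √2 * x) = gaussianReal 0 (v + v) := by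
      rw [gaussianReal_map_const_mul, mul_zero]
      congr 1
      ext
      simp
      ring
    rw [← this, integral_map (by fun_prop) (by fun_prop)]
    have h4 : (√2 : ℝ) ^ 4 = 4 := by
      rw [show (4 : ℕ) = 2 * 2 by norm_num, pow_mul, Real.sq_sqrt (by norm_num)]
      norm_num
    simp only [mul_pow, h4, integral_const_mul, hm]
  have hi : ∀ a b : ℕ, Integrable (fun z : ℝ × ℝ => z.1 ^ a * z.2 ^ b)
      ((gaussianReal 0 v).prod (gaussianReal 0 v)) := fun a b =>
    (integrable_pow_gaussianReal v a).mul_prod (integrable_pow_gaussianReal v b)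
  have hv : ∀ a b : ℕ, ∫ z : ℝ × ℝ, z.1 ^ a * z.2 ^ b
      ∂((gaussianReal 0 v).prod (gaussianReal 0 v))
      = (∫ x, x ^ a ∂gaussianReal 0 v) * ∫ x, x ^ b ∂gaussianReal 0 v := fun a b =>
    integral_prod_mul (fun x : ℝ => x ^ a) (fun x : ℝ => x ^ b)
  have e2 : ∫ x, x ^ 4 ∂gaussianReal 0 (v + v) = 2 * m + 6 * v ^ 2 := by
    have := gaussianReal_conv_gaussianReal (m₁ := 0) (m₂ := 0) (v₁ := v) (v₂ := v)
    rw [add_zero] at this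
    rw [← this, Measure.conv, integral_map (by fun_prop) (by fun_prop)]
    have : ∀ z : ℝ × ℝ, (z.1 + z.2) ^ 4 = z.1 ^ 4 * z.2 ^ 0 + 4 * (z.1 ^ 3 * z.2 ^ 1)
        + 6 * (z.1 ^ 2 * z.2 ^ 2) + 4 * (z.1 ^ 1 * z.2 ^ 3) + z.1 ^ 0 * z.2 ^ 4 := by
      intro z; ring
    simp only [this]
    have i0 := hi 4 0
    have i1 := (hi 3 1).const_mul 4
    have i2 := (hi 2 2).const_mul 6
    have i3 := (hi 1 3).const_mul 4
    have i4 := hi 0 4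
    rw [integral_add (((i0.fun_add i1).fun_add i2).fun_add i3) i4, integral_add ((i0.fun_add i1).fun_add i2) i3,
      integral_add (i0.fun_add i1) i2, integral_add i0 i1]
    simp only [integral_const_mul, hv]
    rw [integral_odd_gaussianReal v 1 (by decide), integral_sq_gaussianReal, ← hm]
    simp
    ring
  linarith

instance (v : ℝ≥0) : IsProbabilityMeasure (complexGaussian v) :=
  Measure.isProbabilityMeasure_map (by fun_prop)

theorem integral_complexGaussian (v : ℝ≥0) (f : ℂ → ℝ) (hf : Measurable f) :
    ∫ z, f z ∂complexGaussian v
      = ∫ p : ℝ × ℝ, f ⟨p.1, p.2⟩ ∂((gaussianReal 0 (v / 2)).prod (gaussianReal 0 (v / 2))) := by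
  rw [complexGaussian, integral_map (by fun_prop) hf.aestronglyMeasurable]
  rfl

theorem integrable_complexGaussian (v : ℝ≥0) (f : ℂ → ℝ) (hf : Measurable f)
    (h : Integrable (fun p : ℝ × ℝ => f ⟨p.1, p.2⟩)
      ((gaussianReal 0 (v / 2)).prod (gaussianReal 0 (v / 2)))) :
    Integrable f (complexGaussian v) := by
  rw [complexGaussian, integrable_map_measure hf.aestronglyMeasurable (by fun_prop)]
  exact h

/-- Apart from second and fourth moments, this symmetry is all that is used of the Gaussian law. -/
theorem complexGaussian_map_neg (v : ℝ≥0) :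
    (complexGaussian v).map (fun z => -z) = complexGaussian v := by
  have h : ((gaussianReal 0 (v / 2)).prod (gaussianReal 0 (v / 2))).map
      (Prod.map (fun x : ℝ => -x) (fun x : ℝ => -x))
      = (gaussianReal 0 (v / 2)).prod (gaussianReal 0 (v / 2)) := by
    rw [← Measure.map_prod_map _ _ (by fun_prop) (by fun_prop), gaussianReal_map_neg_zero]
  conv_rhs => rw [complexGaussian, ← h, Measure.map_map (by fun_prop) (by fun_prop)]
  rw [complexGaussian, Measure.map_map (by fun_prop) (by fun_prop)]
  rfl

theorem integrable_norm_pow_four_complexGaussian (v : ℝ≥0) :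
    Integrable (fun z : ℂ => ‖z‖ ^ 4) (complexGaussian v) := by
  refine integrable_complexGaussian v _ (by fun_prop) ?_
  have hi : ∀ a b : ℕ, Integrable (fun z : ℝ × ℝ => z.1 ^ a * z.2 ^ b)
      ((gaussianReal 0 (v / 2)).prod (gaussianReal 0 (v / 2))) := fun a b =>
    (integrable_pow_gaussianReal _ a).mul_prod (integrable_pow_gaussianReal _ b)
  refine (((hi 4 0).add ((hi 2 2).const_mul 2)).add (hi 0 4)).congr
    (Eventually.of_forall fun z => ?_)
  simp only [Pi.add_apply]
  rw [show (4 : ℕ) = 2 * 2 by norm_num, pow_mul ‖_‖, Complex.sq_norm, Complex.normSq_mk]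
  ring

theorem integral_norm_pow_four_complexGaussian (v : ℝ≥0) :
    ∫ z, ‖z‖ ^ 4 ∂complexGaussian v = 2 * (v : ℝ) ^ 2 := by
  rw [integral_complexGaussian v _ (by fun_prop)]
  have hi : ∀ a b : ℕ, Integrable (fun z : ℝ × ℝ => z.1 ^ a * z.2 ^ b)
      ((gaussianReal 0 (v / 2)).prod (gaussianReal 0 (v / 2))) := fun a b =>
    (integrable_pow_gaussianReal _ a).mul_prod (integrable_pow_gaussianReal _ b)
  have hv : ∀ a b : ℕ, ∫ z : ℝ × ℝ, z.1 ^ a * z.2 ^ b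
      ∂((gaussianReal 0 (v / 2)).prod (gaussianReal 0 (v / 2)))
      = (∫ x, x ^ a ∂gaussianReal 0 (v / 2)) * ∫ x, x ^ b ∂gaussianReal 0 (v / 2) := fun a b =>
    integral_prod_mul (fun x : ℝ => x ^ a) (fun x : ℝ => x ^ b)
  have e : ∀ z : ℝ × ℝ, ‖(⟨z.1, z.2⟩ : ℂ)‖ ^ 4
      = z.1 ^ 4 * z.2 ^ 0 + 2 * (z.1 ^ 2 * z.2 ^ 2) + z.1 ^ 0 * z.2 ^ 4 := by
    intro z
    rw [show (4 : ℕ) = 2 * 2 by norm_num, pow_mul ‖_‖, Complex.sq_norm, Complex.normSq_mk]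
    ring
  simp only [e]
  rw [integral_add ((hi 4 0).fun_add ((hi 2 2).const_mul 2)) (hi 0 4),
    integral_add (hi 4 0) ((hi 2 2).const_mul 2)]
  simp only [integral_const_mul, hv]
  rw [integral_sq_gaussianReal, integral_pow_four_gaussianReal]
  simp
  ring

theorem integral_norm_sq_complexGaussian (v : ℝ≥0) :
    ∫ z, ‖z‖ ^ 2 ∂complexGaussian v = v := by
  rw [integral_complexGaussian v _ (by fun_prop)]
  have hi : ∀ a b : ℕ, Integrable (fun z : ℝ × ℝ => z.1 ^ a * z.2 ^ b)
      ((gaussianReal 0 (v / 2)).prod (gaussianReal 0 (v / 2))) := fun a b =>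
    (integrable_pow_gaussianReal _ a).mul_prod (integrable_pow_gaussianReal _ b)
  have hv : ∀ a b : ℕ, ∫ z : ℝ × ℝ, z.1 ^ a * z.2 ^ b
      ∂((gaussianReal 0 (v / 2)).prod (gaussianReal 0 (v / 2)))
      = (∫ x, x ^ a ∂gaussianReal 0 (v / 2)) * ∫ x, x ^ b ∂gaussianReal 0 (v / 2) := fun a b =>
    integral_prod_mul (fun x : ℝ => x ^ a) (fun x : ℝ => x ^ b)
  have e : ∀ z : ℝ × ℝ, ‖(⟨z.1, z.2⟩ : ℂ)‖ ^ 2 = z.1 ^ 2 * z.2 ^ 0 + z.1 ^ 0 * z.2 ^ 2 := by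
    intro z
    rw [Complex.sq_norm, Complex.normSq_mk]
    ring
  simp only [e]
  rw [integral_add (hi 2 0) (hi 0 2)]
  simp only [hv]
  rw [integral_sq_gaussianReal]
  simp

end OTA

/-! ### Independence of the inputs, sign symmetry of a round, slot statistics. -/

namespace OTA

section GaussianVariable

variable {Ω : Type*} [MeasurableSpace Ω] {P : Measure Ω} {Z : Ω → ℂ} {v : ℝ≥0}

theorem integral_norm_sq_of_law (hZ : Measurable Z) (hl : P.map Z = complexGaussian v) :
    ∫ ω, ‖Z ω‖ ^ 2 ∂P = v := by
  rw [← integral_norm_sq_complexGaussian v, ← hl, integral_map (by fun_prop) (by fun_prop)]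

theorem integral_norm_pow_four_of_law (hZ : Measurable Z) (hl : P.map Z = complexGaussian v) :
    ∫ ω, ‖Z ω‖ ^ 4 ∂P = 2 * (v : ℝ) ^ 2 := by
  rw [← integral_norm_pow_four_complexGaussian v, ← hl, integral_map (by fun_prop) (by fun_prop)]

theorem memLp_norm_sq_of_law (hZ : Measurable Z) (hl : P.map Z = complexGaussian v) :
    MemLp (fun ω => ‖Z ω‖ ^ 2) 2 P := by
  rw [memLp_two_iff_integrable_sq (by fun_prop)]
  have := integrable_norm_pow_four_complexGaussian v
  rw [← hl, integrable_map_measure (by fun_prop) (by fun_prop)] at this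
  refine this.congr (Eventually.of_forall fun ω => ?_)
  simp only [Function.comp]
  ring

theorem map_neg_of_law (hZ : Measurable Z) (hl : P.map Z = complexGaussian v) :
    P.map (fun ω => -Z ω) = P.map Z := by
  rw [hl, ← complexGaussian_map_neg, ← hl, Measure.map_map (by fun_prop) hZ]
  rfl

end GaussianVariable

/-- The `σ`-algebra generated by the inputs with names in `T`. -/
@[reducible]
noncomputable def inputSigma {N : ℕ} {Ω : Type*} (γ : ℕ → Fin N → Ω → ℝ) (h : ℕ → Fin N → Fin N → Ω → ℂ)
    (n : ℕ → Fin N → Ω → ℂ) (T : Set (Input N)) : MeasurableSpace Ω :=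
  ⨆ c ∈ T, MeasurableSpace.comap (inputs γ h n c) inferInstance

/-- The slot choices, channels and noises of one communication round. -/
abbrev Round (N : ℕ) : Type := (Fin N → ℝ) × (Fin N → Fin N → ℂ) × (Fin N → ℂ)

/-- The random inputs of the round at time `k`. -/
def roundInput {N : ℕ} {Ω : Type*} (γ : ℕ → Fin N → Ω → ℝ) (h : ℕ → Fin N → Fin N → Ω → ℂ)
    (n : ℕ → Fin N → Ω → ℂ) (k : ℕ) (ω : Ω) : Round N :=
  (fun j => γ k j ω, fun a b => h k a b ω, fun j => n k j ω)

/-- Change the signs of channels and noises. -/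
def signFlip {N : ℕ} (e : Fin N → Fin N → ℝ) (e' : Fin N → ℝ) (r : Round N) : Round N :=
  (r.1, fun a b => (e a b : ℂ) * r.2.1 a b, fun a => (e' a : ℂ) * r.2.2 a)

section Sigma

variable {N : ℕ} {Ω : Type*} {γ : ℕ → Fin N → Ω → ℝ} {h : ℕ → Fin N → Fin N → Ω → ℂ}
  {n : ℕ → Fin N → Ω → ℂ}

theorem measurable_inputSigma {T : Set (Input N)} {c : Input N} (hc : c ∈ T) :
    Measurable[inputSigma γ h n T] (inputs γ h n c) := by
  have : MeasurableSpace.comap (inputs γ h n c) inferInstance ≤ inputSigma γ h n T :=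
    le_iSup₂_of_le c hc le_rfl
  exact (comap_measurable _).mono this le_rfl

theorem measurable_slot_inputSigma {T : Set (Input N)} {k : ℕ} {i : Fin N}
    (hc : Input.slot k i ∈ T) : Measurable[inputSigma γ h n T] (γ k i) := by
  have := Complex.measurable_re.comp (measurable_inputSigma (γ := γ) (h := h) (n := n) hc)
  exact this

theorem measurable_channel_inputSigma {T : Set (Input N)} {k : ℕ} {i j : Fin N}
    (hc : Input.channel k i j ∈ T) : Measurable[inputSigma γ h n T] (h k i j) :=
  measurable_inputSigma hc

theorem measurable_noise_inputSigma {T : Set (Input N)} {k : ℕ} {i : Fin N}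
    (hc : Input.noise k i ∈ T) : Measurable[inputSigma γ h n T] (n k i) :=
  measurable_inputSigma hc

theorem measurable_roundInput_inputSigma {T : Set (Input N)} {k : ℕ}
    (h1 : ∀ i, Input.slot k i ∈ T) (h2 : ∀ i j, Input.channel k i j ∈ T)
    (h3 : ∀ i, Input.noise k i ∈ T) :
    Measurable[inputSigma γ h n T] (roundInput γ h n k) := by
  let := inputSigma γ h n T
  refine Measurable.prodMk ?_ (Measurable.prodMk ?_ ?_)
  · exact measurable_pi_iff.2 fun i => measurable_slot_inputSigma (h1 i)
  · exact measurable_pi_iff.2 fun i => measurable_pi_iff.2 fun j =>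
      measurable_channel_inputSigma (h2 i j)
  · exact measurable_pi_iff.2 fun i => measurable_noise_inputSigma (h3 i)

end Sigma

namespace System.IsModel

variable {N : ℕ} {S : System N} {Ω : Type*} [MeasurableSpace Ω] {P : Measure Ω}
  {γ : ℕ → Fin N → Ω → ℝ} {h : ℕ → Fin N → Fin N → Ω → ℂ} {n : ℕ → Fin N → Ω → ℂ}

theorem measurable_inputs (hm : S.IsModel P γ h n) (c : Input N) :
    Measurable (inputs γ h n c) := by
  cases c with
  | slot k i => exact Complex.measurable_ofReal.comp (hm.measurable_slot k i)
  | channel k i j => exact hm.measurable_channel k i j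
  | noise k i => exact hm.measurable_noise k i

theorem inputSigma_le (hm : S.IsModel P γ h n) (T : Set (Input N)) :
    inputSigma γ h n T ≤ ‹MeasurableSpace Ω› :=
  iSup₂_le fun c _ => (hm.measurable_inputs c).comap_le

/-- Mutual independence of the family passes to `σ`-algebras generated by disjoint sets of inputs.
Every independence of two quantities used later is an instance. -/
theorem indepFun (hm : S.IsModel P γ h n) {T T' : Set (Input N)} (hT : Disjoint T T')
    {α β : Type*} [MeasurableSpace α] [MeasurableSpace β] {f : Ω → α} {g : Ω → β}
    (hf : Measurable[inputSigma γ h n T] f) (hg : Measurable[inputSigma γ h n T'] g) :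
    IndepFun f g P := by
  have h1 := indep_iSup_of_disjoint (fun c => (hm.measurable_inputs c).comap_le) hm.indep hT
  rw [IndepFun_iff_Indep]
  exact indep_of_indep_of_le_left (indep_of_indep_of_le_right h1 hg.comap_le) hf.comap_le

theorem measurable_roundInput (hm : S.IsModel P γ h n) (k : ℕ) :
    Measurable (roundInput γ h n k) :=
  (measurable_roundInput_inputSigma (T := Set.univ) (by simp) (by simp) (by simp)).mono
    (hm.inputSigma_le _) le_rfl

/-- The law of a round is invariant under sign changes of channels and noises. -/
theorem map_signFlip [IsProbabilityMeasure P] (hm : S.IsModel P γ h n) (k : ℕ)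
    (e : Fin N → Fin N → ℝ) (e' : Fin N → ℝ)
    (he : ∀ a b, e a b = 1 ∨ e a b = -1) (he' : ∀ a, e' a = 1 ∨ e' a = -1) :
    P.map (fun ω => signFlip e e' (roundInput γ h n k ω)) = P.map (roundInput γ h n k) := by
  let ι : Fin N ⊕ (Fin N × Fin N) ⊕ Fin N → Input N :=
    Sum.elim (Input.slot k) (Sum.elim (fun p => Input.channel k p.1 p.2) (Input.noise k))
  have hι : Function.Injective ι := by
    rintro (a | ⟨a, b⟩ | a) (c | ⟨c, d⟩ | c) hac <;> simp_all [ι]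
  let s : Fin N ⊕ (Fin N × Fin N) ⊕ Fin N → ℝ :=
    Sum.elim (fun _ => 1) (Sum.elim (fun p => e p.1 p.2) e')
  have h1 : iIndepFun (fun r => inputs γ h n (ι r)) P := hm.indep.precomp hι
  have h2 : iIndepFun (fun r ω => (s r : ℂ) * inputs γ h n (ι r) ω) P :=
    h1.comp (fun r z => (s r : ℂ) * z) fun r => by fun_prop
  have hmeas := hm.measurable_inputs
  -- Both joint laws are products of their marginals, and each marginal is unchanged by its sign.
  have h3 : P.map (fun ω r => (s r : ℂ) * inputs γ h n (ι r) ω)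
      = P.map (fun ω r => inputs γ h n (ι r) ω) := by
    rw [(iIndepFun_iff_map_fun_eq_pi_map (by fun_prop)).1 h1,
      (iIndepFun_iff_map_fun_eq_pi_map (by fun_prop)).1 h2]
    congr 1
    funext r
    have hneg : ∀ (x : ℝ) (Z : Ω → ℂ), (x = 1 ∨ x = -1) → P.map (fun ω => -Z ω) = P.map Z →
        P.map (fun ω => (x : ℂ) * Z ω) = P.map Z := by
      rintro x Z (rfl | rfl) hZ
      · simp
      · simpa using hZ
    rcases r with a | ⟨a, b⟩ | a
    · simp [s]
    · exact hneg _ _ (he a b) (map_neg_of_law (hm.measurable_channel k a b) (hm.channel_law k a b))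
    · exact hneg _ _ (he' a) (map_neg_of_law (hm.measurable_noise k a) (hm.noise_law k a))
  -- Slots entered the family as complex numbers; the real part recovers them.
  let ψ : (Fin N ⊕ (Fin N × Fin N) ⊕ Fin N → ℂ) → Round N := fun z =>
    (fun j => (z (Sum.inl j)).re, fun a b => z (Sum.inr (Sum.inl (a, b))),
      fun a => z (Sum.inr (Sum.inr a)))
  have hψ : Measurable ψ := by fun_prop
  have h4 := congrArg (fun μ => μ.map ψ) h3
  rw [Measure.map_map hψ (by fun_prop), Measure.map_map hψ (by fun_prop)] at h4
  convert h4 using 2 <;>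
  · funext ω
    simp [ψ, s, ι, signFlip, roundInput, inputs]

/-- The sign change preserves the law, so the integral equals its own negative; integrability plays
no role. Different choices of signs yield all the orthogonality relations between interference
terms. -/
theorem integral_eq_zero_of_odd [IsProbabilityMeasure P] (hm : S.IsModel P γ h n) (k : ℕ)
    (e : Fin N → Fin N → ℝ) (e' : Fin N → ℝ)
    (he : ∀ a b, e a b = 1 ∨ e a b = -1) (he' : ∀ a, e' a = 1 ∨ e' a = -1)
    {F : Round N → ℝ} (hF : Measurable F) (hodd : ∀ r, F (signFlip e e' r) = -F r) :
    ∫ ω, F (roundInput γ h n k ω) ∂P = 0 := by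
  have hr := hm.measurable_roundInput k
  have hfl : Measurable (signFlip e e') := by unfold signFlip; fun_prop
  have h1 : ∫ ω, F (roundInput γ h n k ω) ∂P
      = ∫ ω, F (signFlip e e' (roundInput γ h n k ω)) ∂P := by
    rw [← integral_map (φ := roundInput γ h n k) (by fun_prop) hF.aestronglyMeasurable,
      ← hm.map_signFlip k e e' he he', integral_map (by fun_prop) hF.aestronglyMeasurable]
  simp only [hodd, integral_neg] at h1
  linarith

theorem slot_zero_or_one [IsProbabilityMeasure P] (hm : S.IsModel P γ h n) (k : ℕ) (i : Fin N) :
    ∀ᵐ ω ∂P, γ k i ω = 0 ∨ γ k i ω = 1 := by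
  have hs := hm.measurable_slot k i
  have h0 : MeasurableSet {ω | γ k i ω = 0} := hs (measurableSet_singleton 0)
  have h1 : MeasurableSet {ω | γ k i ω = 1} := hs (measurableSet_singleton 1)
  have hd : Disjoint {ω | γ k i ω = 0} {ω | γ k i ω = 1} := by
    rw [Set.disjoint_left]
    intro ω h0 h1
    change _ = _ at h0 h1
    linarith
  have : P ({ω | γ k i ω = 0} ∪ {ω | γ k i ω = 1}) = 1 := by
    rw [measure_union hd h1, hm.slot_zero, hm.slot_one,
      ← ENNReal.ofReal_add (by linarith [S.p_lt_one i]) (S.p_pos i).le]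
    simp
  have h2 := (prob_compl_eq_zero_iff (h0.union h1)).2 this
  rw [ae_iff]
  exact h2

theorem integral_slot [IsProbabilityMeasure P] (hm : S.IsModel P γ h n) (k : ℕ) (i : Fin N) :
    ∫ ω, γ k i ω ∂P = S.p i := by
  have hs := hm.measurable_slot k i
  have h1 : MeasurableSet {ω | γ k i ω = 1} := hs (measurableSet_singleton 1)
  have : γ k i =ᵐ[P] {ω | γ k i ω = 1}.indicator 1 := by
    filter_upwards [hm.slot_zero_or_one k i] with ω hω
    rcases hω with h | h <;> simp [Set.indicator, h]
  rw [integral_congr_ae this, integral_indicator_one h1, measureReal_def, hm.slot_one,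
    ENNReal.toReal_ofReal (S.p_pos i).le]

theorem gam_sq_ae [IsProbabilityMeasure P] (hm : S.IsModel P γ h n) (k : ℕ) (i : Fin N) :
    ∀ᵐ ω ∂P, ∀ j, Gam (fun j => γ k j ω) i j ^ 2 = Gam (fun j => γ k j ω) i j ∧
      0 ≤ Gam (fun j => γ k j ω) i j ∧ Gam (fun j => γ k j ω) i j ≤ 1 := by
  filter_upwards [ae_all_iff.2 (hm.slot_zero_or_one k)] with ω hω j
  unfold Gam
  rcases hω i with h | h <;> rcases hω j with h' | h' <;> simp [h, h']

theorem measurable_gam (hm : S.IsModel P γ h n) (k : ℕ) (i j : Fin N) :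
    Measurable fun ω => Gam (fun j => γ k j ω) i j := by
  have := hm.measurable_slot k
  unfold Gam
  fun_prop

theorem integrable_gam [IsProbabilityMeasure P] (hm : S.IsModel P γ h n) (k : ℕ) (i j : Fin N) :
    Integrable (fun ω => Gam (fun j => γ k j ω) i j) P := by
  refine Integrable.of_bound (hm.measurable_gam k i j).aestronglyMeasurable 1 ?_
  filter_upwards [hm.gam_sq_ae k i] with ω hω
  rw [Real.norm_of_nonneg (hω j).2.1]
  exact (hω j).2.2

theorem integrable_slot [IsProbabilityMeasure P] (hm : S.IsModel P γ h n) (k : ℕ) (i : Fin N) :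
    Integrable (γ k i) P := by
  refine Integrable.of_bound (hm.measurable_slot k i).aestronglyMeasurable 1 ?_
  filter_upwards [hm.slot_zero_or_one k i] with ω hω
  rcases hω with h | h <;> simp [h]

/-- For `i = j` the two slots are the same variable and the product moment does not factor, hence
`hij`. -/
theorem integral_gam [IsProbabilityMeasure P] (hm : S.IsModel P γ h n) (k : ℕ) {i j : Fin N}
    (hij : i ≠ j) : ∫ ω, Gam (fun j => γ k j ω) i j ∂P = S.q i j := by
  have hi : IndepFun (γ k i) (γ k j) P :=
    hm.indepFun (T := {Input.slot k i}) (T' := {Input.slot k j}) (by simpa using hij)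
      (measurable_slot_inputSigma (by simp)) (measurable_slot_inputSigma (by simp))
  have i1 := hm.integrable_slot k i
  have i2 := hm.integrable_slot k j
  have i3 : Integrable (fun ω => γ k i ω * γ k j ω) P := hi.integrable_mul i1 i2
  have e : ∀ ω, Gam (fun j => γ k j ω) i j = γ k i ω + γ k j ω - 2 * (γ k i ω * γ k j ω) := by
    intro ω
    unfold Gam
    ring
  simp only [e]
  rw [integral_sub (i1.fun_add i2) (i3.const_mul 2), integral_add i1 i2, integral_const_mul,
    hi.integral_fun_mul_eq_mul_integral i1.aestronglyMeasurable i2.aestronglyMeasurable,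
    hm.integral_slot, hm.integral_slot, q]
  ring

end System.IsModel

end OTA

/-! ### The disturbance of one round and its splitting. -/

namespace OTA

namespace System

variable {N : ℕ} (S : System N)

open Classical in
/-- The centred disturbance of agent `i` in a round with states `x`. -/
noncomputable def dist (k : ℕ) (x : Fin N → ℝ) (r : Round N) (i : Fin N) : ℝ :=
  if i ∈ S.failed k then 0
  else S.energy k x r.1 r.2.1 r.2.2 i - S.sig i ^ 2 - ∑ j, S.abar k i j * x j

/-- The part of the disturbance that is quadratic in a single channel. -/
noncomputable def distGain (k : ℕ) (x : Fin N → ℝ) (i : Fin N) (r : Round N) : ℝ :=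
  ∑ j ∈ S.nbrs k i, x j * (S.rho * Gam r.1 i j * ‖r.2.1 i j‖ ^ 2 - S.abar k i j)

/-- The part of the disturbance that comes from the superposition of signals. -/
noncomputable def distCross (k : ℕ) (x : Fin N → ℝ) (i : Fin N) (r : Round N) : ℝ :=
  ∑ p ∈ (S.nbrs k i).offDiag, S.Y1 x r.1 r.2.1 i p.1 p.2

/-- The part of the disturbance that comes from the superposition of signals and noise. -/
noncomputable def distNoise (k : ℕ) (x : Fin N → ℝ) (i : Fin N) (r : Round N) : ℝ :=
  2 * ∑ j ∈ S.nbrs k i, S.Y2 x r.1 r.2.1 r.2.2 i j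

theorem mem_nbrs {k : ℕ} {i j : Fin N} : j ∈ S.nbrs k i ↔ (S.G k).Adj i j := by
  simp [nbrs]

theorem abar_of_mem {k : ℕ} {i j : Fin N} (hj : j ∈ S.nbrs k i) :
    S.abar k i j = S.rho * S.q i j * S.Lam i j := by
  rw [abar, if_pos (S.mem_nbrs.1 hj)]

theorem abar_of_notMem {k : ℕ} {i j : Fin N} (hj : j ∉ S.nbrs k i) : S.abar k i j = 0 := by
  rw [abar, if_neg fun h => hj (S.mem_nbrs.2 h)]

theorem q_nonneg (i j : Fin N) : 0 ≤ S.q i j := by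
  have := S.p_pos i
  have := S.p_pos j
  have := S.p_lt_one i
  have := S.p_lt_one j
  unfold q
  have := mul_nonneg (S.p_pos i).le (sub_nonneg.2 (S.p_lt_one j).le)
  have := mul_nonneg (S.p_pos j).le (sub_nonneg.2 (S.p_lt_one i).le)
  linarith

theorem q_pos (i j : Fin N) : 0 < S.q i j := by
  have := mul_pos (S.p_pos i) (sub_pos.2 (S.p_lt_one j))
  have := mul_pos (S.p_pos j) (sub_pos.2 (S.p_lt_one i))
  unfold q
  linarith

theorem q_le_one (i j : Fin N) : S.q i j ≤ 1 := by
  have := mul_nonneg (S.p_pos i).le (S.p_pos j).le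
  have := mul_nonneg (sub_nonneg.2 (S.p_lt_one i).le) (sub_nonneg.2 (S.p_lt_one j).le)
  unfold q
  nlinarith

theorem q_symm (i j : Fin N) : S.q i j = S.q j i := by
  unfold q
  ring

theorem abar_nonneg (k : ℕ) (i j : Fin N) : 0 ≤ S.abar k i j := by
  unfold abar
  split_ifs
  · exact mul_nonneg (mul_nonneg S.rho_pos.le (S.q_nonneg i j)) (S.Lam_nonneg i j)
  · rfl

theorem abar_symm (k : ℕ) (i j : Fin N) : S.abar k i j = S.abar k j i := by
  unfold abar
  rw [S.q_symm i j, S.Lam_symm i j]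
  by_cases hij : (S.G k).Adj i j
  · rw [if_pos hij, if_pos hij.symm]
  · rw [if_neg hij, if_neg fun h => hij h.symm]

theorem link_nonneg (k : ℕ) {i j : Fin N} (hj : j ∈ S.nbrs k i) :
    0 ≤ 8 * S.Lam i j ^ 2 * S.rho ^ 2 * S.q i j - S.abar k i j ^ 2 := by
  rw [S.abar_of_mem hj]
  have h1 := S.q_nonneg i j
  have h2 := S.q_le_one i j
  have h3 : 0 ≤ S.Lam i j ^ 2 * S.rho ^ 2 * S.q i j := by positivity
  nlinarith [mul_le_mul_of_nonneg_left h2 h3]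

/-- The grouping is by parity: gains and noise energy are even under every sign change, each cross
term is odd in either of its two channels, and each noise term is odd in its channel and in the
noise. -/
theorem dist_eq (k : ℕ) (x : Fin N → ℝ) (r : Round N) {i : Fin N} (hi : i ∉ S.failed k) :
    S.dist k x r i = (S.distGain k x i r + (‖r.2.2 i‖ ^ 2 - S.sig i ^ 2))
      + S.distCross k x i r + S.distNoise k x i r := by
  rw [dist, if_neg hi, energy, distGain, distCross, distNoise]
  have h1 : ∑ j, S.abar k i j * x j = ∑ j ∈ S.nbrs k i, S.abar k i j * x j := by
    symm
    refine Finset.sum_subset (Finset.subset_univ _) fun j _ hj => ?_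
    rw [S.abar_of_notMem hj, zero_mul]
  have h2 : ∑ j ∈ S.nbrs k i, ∑ l ∈ (S.nbrs k i).erase j, S.Y1 x r.1 r.2.1 i j l
      = ∑ p ∈ (S.nbrs k i).offDiag, S.Y1 x r.1 r.2.1 i p.1 p.2 := by
    rw [Finset.sum_sigma']
    refine Finset.sum_bij' (fun p _ => (p.1, p.2)) (fun p _ => ⟨p.1, p.2⟩) ?_ ?_ ?_ ?_ ?_ <;>
      simp +contextual [eq_comm]
  rw [h1, h2]
  have h3 : ∑ j ∈ S.nbrs k i, x j * (S.rho * Gam r.1 i j * ‖r.2.1 i j‖ ^ 2 - S.abar k i j)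
      = ∑ j ∈ S.nbrs k i, S.rho * x j * Gam r.1 i j * ‖r.2.1 i j‖ ^ 2
        - ∑ j ∈ S.nbrs k i, S.abar k i j * x j := by
    rw [← Finset.sum_sub_distrib]
    exact Finset.sum_congr rfl fun j _ => by ring
  rw [h3]
  ring

theorem abs_re_mul_re_add_im_mul_im_le (z w : ℂ) : |z.re * w.re + z.im * w.im| ≤ ‖z‖ * ‖w‖ := by
  have h := Complex.abs_re_le_norm (z * (starRingEnd ℂ) w)
  rw [norm_mul, RCLike.norm_conj] at h
  simpa [Complex.mul_re] using h

theorem norm_mul_u (z : ℂ) : ‖z * S.u‖ = ‖z‖ := by rw [norm_mul, S.norm_u, mul_one]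

theorem abs_Y1_le (x : Fin N → ℝ) (r : Round N) (i j l : Fin N) :
    |S.Y1 x r.1 r.2.1 i j l| ≤ S.rho * √(x j * x l) * |Gam r.1 i j| * |Gam r.1 i l|
      * (‖r.2.1 i j‖ * ‖r.2.1 i l‖) := by
  have h := abs_re_mul_re_add_im_mul_im_le (r.2.1 i j * S.u) (r.2.1 i l * S.u)
  rw [S.norm_mul_u, S.norm_mul_u] at h
  rw [Y1, abs_mul, abs_mul, abs_mul, abs_of_nonneg (mul_nonneg S.rho_pos.le (Real.sqrt_nonneg _))]
  have := S.rho_pos.le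
  gcongr

theorem abs_Y2_le (x : Fin N → ℝ) (r : Round N) (i j : Fin N) :
    |S.Y2 x r.1 r.2.1 r.2.2 i j| ≤ √(S.rho * x j) * |Gam r.1 i j| * (‖r.2.1 i j‖ * ‖r.2.2 i‖) := by
  have h := abs_re_mul_re_add_im_mul_im_le (r.2.1 i j * S.u) (r.2.2 i)
  rw [S.norm_mul_u] at h
  rw [Y2, abs_mul, abs_mul, abs_of_nonneg (Real.sqrt_nonneg _)]
  gcongr

theorem Y1_comm (x g : Fin N → ℝ) (h : Fin N → Fin N → ℂ) (i j l : Fin N) :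
    S.Y1 x g h i j l = S.Y1 x g h i l j := by
  unfold Y1
  rw [mul_comm (x j)]
  ring

theorem Y1_signFlip (x : Fin N → ℝ) (e : Fin N → Fin N → ℝ) (e' : Fin N → ℝ) (r : Round N)
    (i j l : Fin N) :
    S.Y1 x (signFlip e e' r).1 (signFlip e e' r).2.1 i j l
      = e i j * e i l * S.Y1 x r.1 r.2.1 i j l := by
  simp only [Y1, signFlip, mul_assoc, Complex.re_ofReal_mul, Complex.im_ofReal_mul]
  ring

theorem Y2_signFlip (x : Fin N → ℝ) (e : Fin N → Fin N → ℝ) (e' : Fin N → ℝ) (r : Round N)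
    (i j : Fin N) :
    S.Y2 x (signFlip e e' r).1 (signFlip e e' r).2.1 (signFlip e e' r).2.2 i j
      = e i j * e' i * S.Y2 x r.1 r.2.1 r.2.2 i j := by
  simp only [Y2, signFlip, mul_assoc, Complex.re_ofReal_mul, Complex.im_ofReal_mul]
  ring

theorem norm_sq_sign_mul {e : ℝ} (he : e = 1 ∨ e = -1) (z : ℂ) : ‖(e : ℂ) * z‖ ^ 2 = ‖z‖ ^ 2 := by
  rcases he with rfl | rfl <;> simp

theorem distGain_signFlip (k : ℕ) (x : Fin N → ℝ) (e : Fin N → Fin N → ℝ) (e' : Fin N → ℝ)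
    (he : ∀ a b, e a b = 1 ∨ e a b = -1) (r : Round N) (i : Fin N) :
    S.distGain k x i (signFlip e e' r) = S.distGain k x i r := by
  simp only [distGain, signFlip, norm_sq_sign_mul (he _ _)]

theorem measurable_Y1 (i j l : Fin N) :
    Measurable fun z : (Fin N → ℝ) × Round N => S.Y1 z.1 z.2.1 z.2.2.1 i j l := by
  unfold Y1 Gam
  fun_prop

theorem measurable_Y2 (i j : Fin N) :
    Measurable fun z : (Fin N → ℝ) × Round N => S.Y2 z.1 z.2.1 z.2.2.1 z.2.2.2 i j := by
  unfold Y2 Gam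
  fun_prop

theorem measurable_distGain (k : ℕ) (x : Fin N → ℝ) (i : Fin N) :
    Measurable (S.distGain k x i) := by
  unfold distGain Gam
  fun_prop

theorem measurable_Y1_right (x : Fin N → ℝ) (i j l : Fin N) :
    Measurable fun r : Round N => S.Y1 x r.1 r.2.1 i j l :=
  (S.measurable_Y1 i j l).comp (measurable_const.prodMk measurable_id)

theorem measurable_Y2_right (x : Fin N → ℝ) (i j : Fin N) :
    Measurable fun r : Round N => S.Y2 x r.1 r.2.1 r.2.2 i j :=
  (S.measurable_Y2 i j).comp (measurable_const.prodMk measurable_id)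

theorem measurable_distCross (k : ℕ) (x : Fin N → ℝ) (i : Fin N) :
    Measurable (S.distCross k x i) := by
  unfold distCross
  exact Finset.measurable_fun_sum _ fun p _ => S.measurable_Y1_right x i p.1 p.2

theorem measurable_distNoise (k : ℕ) (x : Fin N → ℝ) (i : Fin N) :
    Measurable (S.distNoise k x i) := by
  unfold distNoise
  exact (Finset.measurable_fun_sum _ fun p _ => S.measurable_Y2_right x i p).const_mul 2

theorem measurable_dist (k : ℕ) (i : Fin N) :
    Measurable fun z : (Fin N → ℝ) × Round N => S.dist k z.1 z.2 i := by
  by_cases hi : i ∈ S.failed k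
  · simp only [dist, if_pos hi]
    fun_prop
  · simp only [dist, if_neg hi, energy]
    have h1 := S.measurable_Y1 i
    have h2 := S.measurable_Y2 i
    unfold Gam
    fun_prop

end System

end OTA

/-! ### Moments of single links for frozen states. -/

namespace OTA

namespace System.IsModel

variable {N : ℕ} {S : System N} {Ω : Type*} [MeasurableSpace Ω] {P : Measure Ω}
  {γ : ℕ → Fin N → Ω → ℝ} {h : ℕ → Fin N → Fin N → Ω → ℂ} {n : ℕ → Fin N → Ω → ℂ}

theorem integral_channel_sq (hm : S.IsModel P γ h n) (k : ℕ) (i j : Fin N) :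
    ∫ ω, ‖h k i j ω‖ ^ 2 ∂P = S.Lam i j := by
  rw [integral_norm_sq_of_law (hm.measurable_channel k i j) (hm.channel_law k i j),
    Real.coe_toNNReal _ (S.Lam_nonneg i j)]

theorem integral_channel_pow_four (hm : S.IsModel P γ h n) (k : ℕ) (i j : Fin N) :
    ∫ ω, ‖h k i j ω‖ ^ 4 ∂P = 2 * S.Lam i j ^ 2 := by
  rw [integral_norm_pow_four_of_law (hm.measurable_channel k i j) (hm.channel_law k i j),
    Real.coe_toNNReal _ (S.Lam_nonneg i j)]

theorem memLp_channel_sq (hm : S.IsModel P γ h n) (k : ℕ) (i j : Fin N) :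
    MemLp (fun ω => ‖h k i j ω‖ ^ 2) 2 P :=
  memLp_norm_sq_of_law (hm.measurable_channel k i j) (hm.channel_law k i j)

theorem integral_noise_sq (hm : S.IsModel P γ h n) (k : ℕ) (i : Fin N) :
    ∫ ω, ‖n k i ω‖ ^ 2 ∂P = S.sig i ^ 2 := by
  rw [integral_norm_sq_of_law (hm.measurable_noise k i) (hm.noise_law k i),
    Real.coe_toNNReal _ (sq_nonneg _)]

theorem integral_noise_pow_four (hm : S.IsModel P γ h n) (k : ℕ) (i : Fin N) :
    ∫ ω, ‖n k i ω‖ ^ 4 ∂P = 2 * S.sig i ^ 4 := by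
  rw [integral_norm_pow_four_of_law (hm.measurable_noise k i) (hm.noise_law k i),
    Real.coe_toNNReal _ (sq_nonneg _)]
  ring

theorem memLp_noise_sq (hm : S.IsModel P γ h n) (k : ℕ) (i : Fin N) :
    MemLp (fun ω => ‖n k i ω‖ ^ 2) 2 P :=
  memLp_norm_sq_of_law (hm.measurable_noise k i) (hm.noise_law k i)

/-- Slot choices are independent of the channels and noises of the same round. -/
theorem integral_slot_mul (hm : S.IsModel P γ h n) (k : ℕ) {φ : (Fin N → ℝ) → ℝ}
    (hφ : Measurable φ) {ψ : (Fin N → Fin N → ℂ) × (Fin N → ℂ) → ℝ} (hψ : Measurable ψ) :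
    ∫ ω, φ (roundInput γ h n k ω).1 * ψ (roundInput γ h n k ω).2 ∂P
      = (∫ ω, φ (roundInput γ h n k ω).1 ∂P) * ∫ ω, ψ (roundInput γ h n k ω).2 ∂P := by
  have h1 : Measurable[inputSigma γ h n {c | ∃ i, c = Input.slot k i}]
      (fun ω => (roundInput γ h n k ω).1) := by
    let := inputSigma γ h n {c | ∃ i, c = Input.slot k i}
    exact measurable_pi_iff.2 fun i => measurable_slot_inputSigma ⟨i, rfl⟩
  have h2 : Measurable[inputSigma γ h n {c | ¬ ∃ i, c = Input.slot k i}]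
      (fun ω => (roundInput γ h n k ω).2) := by
    let := inputSigma γ h n {c | ¬ ∃ i, c = Input.slot k i}
    refine Measurable.prodMk ?_ ?_
    · exact measurable_pi_iff.2 fun i => measurable_pi_iff.2 fun j =>
        measurable_channel_inputSigma (by simp)
    · exact measurable_pi_iff.2 fun i => measurable_noise_inputSigma (by simp)
  have hi := (hm.indepFun (disjoint_compl_right) h1 h2).comp hφ hψ
  have hr := hm.measurable_roundInput k
  exact hi.integral_fun_mul_eq_mul_integral (hφ.comp hr.fst).aestronglyMeasurable
    (hψ.comp hr.snd).aestronglyMeasurable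

theorem integral_channel_sq_mul (hm : S.IsModel P γ h n) (k : ℕ) (i : Fin N) {j l : Fin N}
    (hjl : j ≠ l) :
    ∫ ω, ‖h k i j ω‖ ^ 2 * ‖h k i l ω‖ ^ 2 ∂P = S.Lam i j * S.Lam i l := by
  have hi : IndepFun (h k i j) (h k i l) P :=
    hm.indepFun (T := {Input.channel k i j}) (T' := {Input.channel k i l}) (by simpa using hjl)
      (measurable_channel_inputSigma (by simp)) (measurable_channel_inputSigma (by simp))
  have hi' := hi.comp (φ := fun z => ‖z‖ ^ 2) (ψ := fun z => ‖z‖ ^ 2) (by fun_prop) (by fun_prop)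
  have hr := hm.measurable_channel
  rw [← hm.integral_channel_sq k i j, ← hm.integral_channel_sq k i l]
  exact hi'.integral_fun_mul_eq_mul_integral (by fun_prop) (by fun_prop)

theorem integral_channel_sq_mul_noise_sq (hm : S.IsModel P γ h n) (k : ℕ) (i j : Fin N) :
    ∫ ω, ‖h k i j ω‖ ^ 2 * ‖n k i ω‖ ^ 2 ∂P = S.Lam i j * S.sig i ^ 2 := by
  have hi : IndepFun (h k i j) (n k i) P :=
    hm.indepFun (T := {Input.channel k i j}) (T' := {Input.noise k i}) (by simp)
      (measurable_channel_inputSigma (by simp)) (measurable_noise_inputSigma (by simp))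
  have hi' := hi.comp (φ := fun z => ‖z‖ ^ 2) (ψ := fun z => ‖z‖ ^ 2) (by fun_prop) (by fun_prop)
  have hr := hm.measurable_channel
  have hr' := hm.measurable_noise
  rw [← hm.integral_channel_sq k i j, ← hm.integral_noise_sq k i]
  exact hi'.integral_fun_mul_eq_mul_integral (by fun_prop) (by fun_prop)

variable [IsProbabilityMeasure P]

theorem memLp_gain (hm : S.IsModel P γ h n) (k : ℕ) (i j : Fin N) :
    MemLp (fun ω => Gam (fun j => γ k j ω) i j * ‖h k i j ω‖ ^ 2) 2 P := by
  have hG := hm.measurable_gam k i j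
  have hh := hm.measurable_channel
  refine (hm.memLp_channel_sq k i j).mono (by fun_prop) ?_
  filter_upwards [hm.gam_sq_ae k i] with ω hω
  rw [norm_mul, Real.norm_of_nonneg (hω j).2.1]
  exact mul_le_of_le_one_left (norm_nonneg _) (hω j).2.2

theorem memLp_gain_sub (hm : S.IsModel P γ h n) (k : ℕ) (i j : Fin N) (c : ℝ) :
    MemLp (fun ω => S.rho * Gam (fun j => γ k j ω) i j * ‖h k i j ω‖ ^ 2 - c) 2 P := by
  simp only [mul_assoc]
  exact ((hm.memLp_gain k i j).const_mul S.rho).sub (memLp_const c)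

/-- A product of two moduli is at most the sum of their squares, and those squares are in `L²`
because fourth moments are finite. -/
theorem memLp_Y1 (hm : S.IsModel P γ h n) (k : ℕ) (x : Fin N → ℝ) (i j l : Fin N) :
    MemLp (fun ω => S.Y1 x (roundInput γ h n k ω).1 (roundInput γ h n k ω).2.1 i j l) 2 P := by
  have hr := hm.measurable_roundInput k
  refine MemLp.mono (((hm.memLp_channel_sq k i j).add (hm.memLp_channel_sq k i l)).const_mul
    (S.rho * √(x j * x l))) ((S.measurable_Y1_right x i j l).comp hr).aestronglyMeasurable ?_
  filter_upwards [hm.gam_sq_ae k i] with ω hω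
  refine (S.abs_Y1_le x _ i j l).trans ?_
  simp only [roundInput, Pi.add_apply]
  rw [abs_of_nonneg (hω j).2.1, abs_of_nonneg (hω l).2.1, norm_mul]
  have h0 : 0 ≤ S.rho * √(x j * x l) := mul_nonneg S.rho_pos.le (Real.sqrt_nonneg _)
  rw [Real.norm_of_nonneg h0, Real.norm_of_nonneg (by positivity), mul_assoc, mul_assoc]
  refine mul_le_mul_of_nonneg_left ?_ h0
  have h1 := (hω j).2
  have h2 := (hω l).2
  have h3 : ‖h k i j ω‖ * ‖h k i l ω‖ ≤ ‖h k i j ω‖ ^ 2 + ‖h k i l ω‖ ^ 2 := by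
    nlinarith [sq_nonneg (‖h k i j ω‖ - ‖h k i l ω‖), sq_nonneg (‖h k i j ω‖),
      sq_nonneg (‖h k i l ω‖)]
  rw [← mul_assoc]
  exact (mul_le_of_le_one_left (by positivity) (mul_le_one₀ h1.2 h2.1 h2.2)).trans h3

theorem memLp_Y2 (hm : S.IsModel P γ h n) (k : ℕ) (x : Fin N → ℝ) (i j : Fin N) :
    MemLp (fun ω => S.Y2 x (roundInput γ h n k ω).1 (roundInput γ h n k ω).2.1
      (roundInput γ h n k ω).2.2 i j) 2 P := by
  have hr := hm.measurable_roundInput k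
  refine MemLp.mono (((hm.memLp_channel_sq k i j).add (hm.memLp_noise_sq k i)).const_mul
    (√(S.rho * x j))) ((S.measurable_Y2_right x i j).comp hr).aestronglyMeasurable ?_
  filter_upwards [hm.gam_sq_ae k i] with ω hω
  refine (S.abs_Y2_le x _ i j).trans ?_
  simp only [roundInput, Pi.add_apply]
  rw [abs_of_nonneg (hω j).2.1, norm_mul]
  rw [Real.norm_of_nonneg (Real.sqrt_nonneg _), Real.norm_of_nonneg (by positivity), mul_assoc]
  refine mul_le_mul_of_nonneg_left ?_ (Real.sqrt_nonneg _)
  have h1 := (hω j).2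
  have h3 : ‖h k i j ω‖ * ‖n k i ω‖ ≤ ‖h k i j ω‖ ^ 2 + ‖n k i ω‖ ^ 2 := by
    nlinarith [sq_nonneg (‖h k i j ω‖ - ‖n k i ω‖), sq_nonneg (‖h k i j ω‖),
      sq_nonneg (‖n k i ω‖)]
  exact (mul_le_of_le_one_left (by positivity) h1.2).trans h3

/-- Mean energy gain of a link. -/
theorem integral_gain (hm : S.IsModel P γ h n) (k : ℕ) {i j : Fin N} (hij : i ≠ j) :
    ∫ ω, Gam (fun j => γ k j ω) i j * ‖h k i j ω‖ ^ 2 ∂P = S.q i j * S.Lam i j := by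
  rw [← hm.integral_gam k hij, ← hm.integral_channel_sq k i j]
  exact hm.integral_slot_mul k (φ := fun g => Gam g i j) (ψ := fun z => ‖z.1 i j‖ ^ 2)
    (by unfold Gam; fun_prop) (by fun_prop)

/-- Almost surely `Γ² = Γ`, so the second moment of the gain has a single factor `q` and the
Gaussian fourth moment `2 Λ²`. -/
theorem integral_gain_sub_sq (hm : S.IsModel P γ h n) (k : ℕ) {i j : Fin N} (hij : i ≠ j) :
    ∫ ω, (S.rho * Gam (fun j => γ k j ω) i j * ‖h k i j ω‖ ^ 2 - S.rho * S.q i j * S.Lam i j) ^ 2 ∂P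
      = 2 * S.rho ^ 2 * S.q i j * S.Lam i j ^ 2 - (S.rho * S.q i j * S.Lam i j) ^ 2 := by
  set a := S.rho * S.q i j * S.Lam i j with ha
  have h4 : ∫ ω, Gam (fun j => γ k j ω) i j * ‖h k i j ω‖ ^ 4 ∂P
      = S.q i j * (2 * S.Lam i j ^ 2) := by
    rw [← hm.integral_gam k hij, ← hm.integral_channel_pow_four k i j]
    exact hm.integral_slot_mul k (φ := fun g => Gam g i j) (ψ := fun z => ‖z.1 i j‖ ^ 4)
      (by unfold Gam; fun_prop) (by fun_prop)
  have hL := hm.memLp_gain k i j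
  have e : (fun ω => (S.rho * Gam (fun j => γ k j ω) i j * ‖h k i j ω‖ ^ 2 - a) ^ 2) =ᵐ[P]
      fun ω => S.rho ^ 2 * (Gam (fun j => γ k j ω) i j * ‖h k i j ω‖ ^ 4)
        - 2 * S.rho * a * (Gam (fun j => γ k j ω) i j * ‖h k i j ω‖ ^ 2) + a ^ 2 := by
    filter_upwards [hm.gam_sq_ae k i] with ω hω
    have := (hω j).1
    linear_combination (S.rho ^ 2 * ‖h k i j ω‖ ^ 4) * this
  have i1 : Integrable (fun ω => Gam (fun j => γ k j ω) i j * ‖h k i j ω‖ ^ 4) P := by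
    refine hL.integrable_sq.congr ?_
    filter_upwards [hm.gam_sq_ae k i] with ω hω
    have := (hω j).1
    linear_combination (‖h k i j ω‖ ^ 4) * this
  have i2 := hL.integrable (by norm_num)
  have i3 : Integrable (fun ω => S.rho ^ 2 * (Gam (fun j => γ k j ω) i j * ‖h k i j ω‖ ^ 4)
      - 2 * S.rho * a * (Gam (fun j => γ k j ω) i j * ‖h k i j ω‖ ^ 2)) P :=
    (i1.const_mul _).sub (i2.const_mul _)
  rw [integral_congr_ae e, integral_add i3 (integrable_const _), integral_sub (i1.const_mul _) (i2.const_mul _)]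
  simp only [integral_const_mul, h4, hm.integral_gain k hij, integral_const, probReal_univ,
    one_smul]
  rw [ha]
  ring

theorem integral_noise_sub_sq (hm : S.IsModel P γ h n) (k : ℕ) (i : Fin N) :
    ∫ ω, (‖n k i ω‖ ^ 2 - S.sig i ^ 2) ^ 2 ∂P = S.sig i ^ 4 := by
  have hL := hm.memLp_noise_sq k i
  have e : (fun ω => (‖n k i ω‖ ^ 2 - S.sig i ^ 2) ^ 2) =
      fun ω => ‖n k i ω‖ ^ 4 - 2 * S.sig i ^ 2 * ‖n k i ω‖ ^ 2 + S.sig i ^ 4 := by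
    funext ω
    ring
  have i1 : Integrable (fun ω => ‖n k i ω‖ ^ 4) P := by
    refine hL.integrable_sq.congr (Eventually.of_forall fun ω => ?_)
    ring
  have i2 := hL.integrable (by norm_num)
  have i3 : Integrable (fun ω => ‖n k i ω‖ ^ 4 - 2 * S.sig i ^ 2 * ‖n k i ω‖ ^ 2) P :=
    i1.sub (i2.const_mul _)
  rw [e, integral_add i3 (integrable_const _),
    integral_sub i1 (i2.const_mul _)]
  simp only [integral_const_mul, hm.integral_noise_sq, hm.integral_noise_pow_four, integral_const,
    probReal_univ, one_smul]
  ring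

/-- The expectation of the two indicators stays unevaluated: both involve the slot of agent `i`, so
it need not factor. `integral_distCross_sq_le` resums these expectations instead. -/
theorem integral_Y1_sq_le (hm : S.IsModel P γ h n) (k : ℕ) (x : Fin N → ℝ) (i : Fin N)
    {j l : Fin N} (hjl : j ≠ l) :
    ∫ ω, S.Y1 x (roundInput γ h n k ω).1 (roundInput γ h n k ω).2.1 i j l ^ 2 ∂P
      ≤ S.rho ^ 2 * |x j| * |x l| * (S.Lam i j * S.Lam i l) *
        ∫ ω, Gam (fun j => γ k j ω) i j * Gam (fun j => γ k j ω) i l ∂P := by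
  have e := hm.integral_slot_mul k (φ := fun g => Gam g i j * Gam g i l)
    (ψ := fun z => ‖z.1 i j‖ ^ 2 * ‖z.1 i l‖ ^ 2) (by unfold Gam; fun_prop) (by fun_prop)
  simp only [roundInput] at e
  rw [hm.integral_channel_sq_mul k i hjl] at e
  rw [mul_assoc, mul_comm (S.Lam i j * S.Lam i l), ← e, ← integral_const_mul]
  have hi : Integrable (fun ω => ‖h k i j ω‖ ^ 2 * ‖h k i l ω‖ ^ 2) P :=
    (hm.memLp_channel_sq k i j).integrable_mul (hm.memLp_channel_sq k i l)
  have hg1 := hm.measurable_gam k i j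
  have hg2 := hm.measurable_gam k i l
  have hh := hm.measurable_channel
  refine integral_mono_ae (hm.memLp_Y1 k x i j l).integrable_sq ?_ ?_
  · refine Integrable.const_mul ?_ _
    refine hi.mono (by fun_prop) ?_
    filter_upwards [hm.gam_sq_ae k i] with ω hω
    rw [norm_mul]
    refine mul_le_of_le_one_left (norm_nonneg _) ?_
    rw [norm_mul, Real.norm_of_nonneg (hω j).2.1, Real.norm_of_nonneg (hω l).2.1]
    exact mul_le_one₀ (hω j).2.2 (hω l).2.1 (hω l).2.2
  · filter_upwards [hm.gam_sq_ae k i] with ω hω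
    have h1 := S.abs_Y1_le x (roundInput γ h n k ω) i j l
    have h2 := pow_le_pow_left₀ (abs_nonneg _) h1 2
    rw [sq_abs] at h2
    refine h2.trans ?_
    -- States may have become negative; when the product is negative, its root counts as `0`.
    have h3 : √(x j * x l) ^ 2 ≤ |x j| * |x l| := by
      rw [← abs_mul]
      rcases le_total 0 (x j * x l) with h | h
      · rw [Real.sq_sqrt h]
        exact le_abs_self _
      · rw [Real.sqrt_eq_zero_of_nonpos h, zero_pow two_ne_zero]
        positivity
    have h4 := (hω j).1
    have h5 := (hω l).1
    simp only [roundInput]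
    rw [mul_pow, mul_pow, mul_pow, mul_pow, sq_abs, sq_abs, h4, h5, mul_pow]
    have : 0 ≤ Gam (fun j => γ k j ω) i j * Gam (fun j => γ k j ω) i l :=
      mul_nonneg (hω j).2.1 (hω l).2.1
    calc S.rho ^ 2 * √(x j * x l) ^ 2 * Gam (fun j => γ k j ω) i j * Gam (fun j => γ k j ω) i l
          * (‖h k i j ω‖ ^ 2 * ‖h k i l ω‖ ^ 2)
        = S.rho ^ 2 * √(x j * x l) ^ 2 * (Gam (fun j => γ k j ω) i j * Gam (fun j => γ k j ω) i l
          * (‖h k i j ω‖ ^ 2 * ‖h k i l ω‖ ^ 2)) := by ring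
      _ ≤ S.rho ^ 2 * (|x j| * |x l|) * (Gam (fun j => γ k j ω) i j * Gam (fun j => γ k j ω) i l
          * (‖h k i j ω‖ ^ 2 * ‖h k i l ω‖ ^ 2)) := by gcongr
      _ = _ := by ring

theorem integral_Y2_sq_le (hm : S.IsModel P γ h n) (k : ℕ) (x : Fin N → ℝ) {i j : Fin N}
    (hij : i ≠ j) :
    ∫ ω, S.Y2 x (roundInput γ h n k ω).1 (roundInput γ h n k ω).2.1
        (roundInput γ h n k ω).2.2 i j ^ 2 ∂P
      ≤ S.sig i ^ 2 * (S.rho * S.q i j * S.Lam i j * |x j|) := by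
  have e := hm.integral_slot_mul k (φ := fun g => Gam g i j)
    (ψ := fun z => ‖z.1 i j‖ ^ 2 * ‖z.2 i‖ ^ 2) (by unfold Gam; fun_prop) (by fun_prop)
  simp only [roundInput] at e
  rw [hm.integral_channel_sq_mul_noise_sq k i j, hm.integral_gam k hij] at e
  rw [show S.sig i ^ 2 * (S.rho * S.q i j * S.Lam i j * |x j|)
    = S.rho * |x j| * (S.q i j * (S.Lam i j * S.sig i ^ 2)) by ring, ← e, ← integral_const_mul]
  have hi : Integrable (fun ω => ‖h k i j ω‖ ^ 2 * ‖n k i ω‖ ^ 2) P :=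
    (hm.memLp_channel_sq k i j).integrable_mul (hm.memLp_noise_sq k i)
  have hg1 := hm.measurable_gam k i j
  have hh := hm.measurable_channel
  have hn := hm.measurable_noise
  refine integral_mono_ae (hm.memLp_Y2 k x i j).integrable_sq ?_ ?_
  · refine Integrable.const_mul ?_ _
    refine hi.mono (by fun_prop) ?_
    filter_upwards [hm.gam_sq_ae k i] with ω hω
    rw [norm_mul, Real.norm_of_nonneg (hω j).2.1]
    exact mul_le_of_le_one_left (norm_nonneg _) (hω j).2.2
  · filter_upwards [hm.gam_sq_ae k i] with ω hω
    have h1 := S.abs_Y2_le x (roundInput γ h n k ω) i j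
    have h2 := pow_le_pow_left₀ (abs_nonneg _) h1 2
    rw [sq_abs] at h2
    refine h2.trans ?_
    have h3 : √(S.rho * x j) ^ 2 ≤ S.rho * |x j| := by
      rw [← abs_of_pos S.rho_pos, ← abs_mul, abs_of_pos S.rho_pos]
      rcases le_total 0 (S.rho * x j) with h | h
      · rw [Real.sq_sqrt h]
        exact le_abs_self _
      · rw [Real.sqrt_eq_zero_of_nonpos h, zero_pow two_ne_zero]
        positivity
    have h4 := (hω j).1
    simp only [roundInput]
    rw [mul_pow, mul_pow, sq_abs, h4, mul_pow, mul_assoc]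
    have := (hω j).2.1
    gcongr

end System.IsModel

end OTA

/-! ### Mean and second moment of the disturbance for frozen states. -/

namespace OTA

/-- The sign pattern that flips the channels from agent `j`. -/
def flipFrom {N : ℕ} (j : Fin N) : Fin N → Fin N → ℝ := fun _ b => if b = j then -1 else 1

theorem flipFrom_eq {N : ℕ} (j a b : Fin N) : flipFrom j a b = 1 ∨ flipFrom j a b = -1 := by
  unfold flipFrom
  split_ifs <;> simp

theorem flipFrom_self {N : ℕ} (j a : Fin N) : flipFrom j a j = -1 := if_pos rfl

theorem flipFrom_of_ne {N : ℕ} {j b : Fin N} (a : Fin N) (hb : b ≠ j) : flipFrom j a b = 1 :=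
  if_neg hb

namespace System

variable {N : ℕ} {S : System N}

theorem ne_of_mem_nbrs {k : ℕ} {i j : Fin N} (hj : j ∈ S.nbrs k i) : i ≠ j :=
  (S.mem_nbrs.1 hj).ne

variable {Ω : Type*} [MeasurableSpace Ω] {P : Measure Ω}
  {γ : ℕ → Fin N → Ω → ℝ} {h : ℕ → Fin N → Fin N → Ω → ℂ} {n : ℕ → Fin N → Ω → ℂ}
  [IsProbabilityMeasure P]

namespace IsModel

theorem memLp_distGain (hm : S.IsModel P γ h n) (k : ℕ) (x : Fin N → ℝ) (i : Fin N) :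
    MemLp (fun ω => S.distGain k x i (roundInput γ h n k ω)) 2 P :=
  memLp_finsetSum _ fun j _ => (hm.memLp_gain_sub k i j (S.abar k i j)).const_mul (x j)

theorem memLp_noise_sub (hm : S.IsModel P γ h n) (k : ℕ) (i : Fin N) :
    MemLp (fun ω => ‖(roundInput γ h n k ω).2.2 i‖ ^ 2 - S.sig i ^ 2) 2 P :=
  (hm.memLp_noise_sq k i).sub (memLp_const _)

theorem memLp_distCross (hm : S.IsModel P γ h n) (k : ℕ) (x : Fin N → ℝ) (i : Fin N) :
    MemLp (fun ω => S.distCross k x i (roundInput γ h n k ω)) 2 P :=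
  memLp_finsetSum _ fun p _ => hm.memLp_Y1 k x i p.1 p.2

theorem memLp_distNoise (hm : S.IsModel P γ h n) (k : ℕ) (x : Fin N → ℝ) (i : Fin N) :
    MemLp (fun ω => S.distNoise k x i (roundInput γ h n k ω)) 2 P :=
  (memLp_finsetSum _ fun j _ => hm.memLp_Y2 k x i j).const_mul 2

theorem memLp_dist_const (hm : S.IsModel P γ h n) (k : ℕ) (x : Fin N → ℝ) (i : Fin N) :
    MemLp (fun ω => S.dist k x (roundInput γ h n k ω) i) 2 P := by
  by_cases hi : i ∈ S.failed k
  · simp only [dist, if_pos hi]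
    exact memLp_const 0
  · simp only [S.dist_eq k x _ hi]
    exact (((hm.memLp_distGain k x i).add (hm.memLp_noise_sub k i)).add
      (hm.memLp_distCross k x i)).add (hm.memLp_distNoise k x i)

theorem integral_distGain (hm : S.IsModel P γ h n) (k : ℕ) (x : Fin N → ℝ) (i : Fin N) :
    ∫ ω, S.distGain k x i (roundInput γ h n k ω) ∂P = 0 := by
  simp only [distGain, roundInput]
  rw [integral_finsetSum _ fun j _ =>
    ((hm.memLp_gain_sub k i j (S.abar k i j)).const_mul (x j)).integrable (by norm_num)]
  refine Finset.sum_eq_zero fun j hj => ?_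
  have hi : Integrable (fun ω => S.rho * (Gam (fun j => γ k j ω) i j * ‖h k i j ω‖ ^ 2)) P :=
    ((hm.memLp_gain k i j).integrable (by norm_num)).const_mul _
  simp only [mul_assoc]
  rw [integral_const_mul, integral_sub hi (integrable_const _), integral_const_mul,
    hm.integral_gain k (ne_of_mem_nbrs hj), S.abar_of_mem hj]
  simp [mul_assoc]

/-- Flipping the channel from `j` alone reverses the sign, because `l ≠ j` leaves the other factor
unchanged. -/
theorem integral_Y1 (hm : S.IsModel P γ h n) (k : ℕ) (x : Fin N → ℝ) (i : Fin N) {j l : Fin N}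
    (hjl : j ≠ l) :
    ∫ ω, S.Y1 x (roundInput γ h n k ω).1 (roundInput γ h n k ω).2.1 i j l ∂P = 0 := by
  refine hm.integral_eq_zero_of_odd k (flipFrom j) (fun _ => 1) (flipFrom_eq j) (by simp)
    (F := fun r => S.Y1 x r.1 r.2.1 i j l) (S.measurable_Y1_right x i j l) fun r => ?_
  rw [S.Y1_signFlip, flipFrom_self, flipFrom_of_ne _ hjl.symm]
  ring

theorem integral_Y2 (hm : S.IsModel P γ h n) (k : ℕ) (x : Fin N → ℝ) (i j : Fin N) :
    ∫ ω, S.Y2 x (roundInput γ h n k ω).1 (roundInput γ h n k ω).2.1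
      (roundInput γ h n k ω).2.2 i j ∂P = 0 := by
  refine hm.integral_eq_zero_of_odd k (flipFrom j) (fun _ => 1) (flipFrom_eq j) (by simp)
    (F := fun r => S.Y2 x r.1 r.2.1 r.2.2 i j) (S.measurable_Y2_right x i j) fun r => ?_
  rw [S.Y2_signFlip, flipFrom_self]
  ring

/-- The disturbance is centred, for every value of the states. -/
theorem integral_dist_const (hm : S.IsModel P γ h n) (k : ℕ) (x : Fin N → ℝ) (i : Fin N) :
    ∫ ω, S.dist k x (roundInput γ h n k ω) i ∂P = 0 := by
  by_cases hi : i ∈ S.failed k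
  · simp [dist, if_pos hi]
  simp only [S.dist_eq k x _ hi]
  have i1 := (hm.memLp_distGain k x i).integrable (by norm_num)
  have i2 := (hm.memLp_noise_sub k i).integrable (by norm_num)
  have i3 := (hm.memLp_distCross k x i).integrable (by norm_num)
  have i4 := (hm.memLp_distNoise k x i).integrable (by norm_num)
  have e2 : ∫ ω, (‖(roundInput γ h n k ω).2.2 i‖ ^ 2 - S.sig i ^ 2) ∂P = 0 := by
    simp only [roundInput]
    rw [integral_sub ((hm.memLp_noise_sq k i).integrable (by norm_num)) (integrable_const _),
      hm.integral_noise_sq]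
    simp
  have e3 : ∫ ω, S.distCross k x i (roundInput γ h n k ω) ∂P = 0 := by
    unfold distCross
    rw [integral_finsetSum _ fun p _ => (hm.memLp_Y1 k x i p.1 p.2).integrable (by norm_num)]
    exact Finset.sum_eq_zero fun p hp => hm.integral_Y1 k x i (Finset.mem_offDiag.1 hp).2.2
  have e4 : ∫ ω, S.distNoise k x i (roundInput γ h n k ω) ∂P = 0 := by
    unfold distNoise
    rw [integral_const_mul,
      integral_finsetSum _ fun j _ => (hm.memLp_Y2 k x i j).integrable (by norm_num)]
    simp [hm.integral_Y2]
  rw [integral_add ((i1.fun_add i2).fun_add i3) i4, integral_add (i1.fun_add i2) i3,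
    integral_add i1 i2, hm.integral_distGain, e2, e3, e4]
  simp

/-- Cauchy–Schwarz splits off the states pointwise, so correlations between the gains of different
links (they share the slot of `i`) never enter. -/
theorem integral_distGain_sq_le (hm : S.IsModel P γ h n) (k : ℕ) (x : Fin N → ℝ) (i : Fin N) :
    ∫ ω, S.distGain k x i (roundInput γ h n k ω) ^ 2 ∂P
      ≤ (∑ j, x j ^ 2) * ∑ j ∈ S.nbrs k i,
        (2 * S.rho ^ 2 * S.q i j * S.Lam i j ^ 2 - S.abar k i j ^ 2) := by
  have hL := fun j => hm.memLp_gain_sub k i j (S.abar k i j)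
  have e : ∑ j ∈ S.nbrs k i, (2 * S.rho ^ 2 * S.q i j * S.Lam i j ^ 2 - S.abar k i j ^ 2)
      = ∫ ω, ∑ j ∈ S.nbrs k i,
        (S.rho * Gam (fun j => γ k j ω) i j * ‖h k i j ω‖ ^ 2 - S.abar k i j) ^ 2 ∂P := by
    rw [integral_finsetSum _ fun j _ => (hL j).integrable_sq]
    refine Finset.sum_congr rfl fun j hj => ?_
    rw [S.abar_of_mem hj, hm.integral_gain_sub_sq k (ne_of_mem_nbrs hj)]
  rw [e, ← integral_const_mul]
  refine integral_mono (hm.memLp_distGain k x i).integrable_sq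
    ((integrable_finsetSum _ fun j _ => (hL j).integrable_sq).const_mul _) fun ω => ?_
  refine (Finset.sum_mul_sq_le_sq_mul_sq _ _ _).trans ?_
  refine mul_le_mul_of_nonneg_right ?_ (Finset.sum_nonneg fun j _ => sq_nonneg _)
  exact Finset.sum_le_sum_of_subset_of_nonneg (Finset.subset_univ _) fun j _ _ => sq_nonneg _

/-- For distinct unordered pairs some index of `p` does not occur in `p'`; flipping the channel from
that index reverses the product. -/
theorem integral_Y1_mul_Y1 (hm : S.IsModel P γ h n) (k : ℕ) (x : Fin N → ℝ) (i : Fin N)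
    {p p' : Fin N × Fin N} (hp : p.1 ≠ p.2) (hp' : p'.1 ≠ p'.2) (h1 : p' ≠ p)
    (h2 : p' ≠ p.swap) :
    ∫ ω, S.Y1 x (roundInput γ h n k ω).1 (roundInput γ h n k ω).2.1 i p.1 p.2
      * S.Y1 x (roundInput γ h n k ω).1 (roundInput γ h n k ω).2.1 i p'.1 p'.2 ∂P = 0 := by
  obtain ⟨j, l⟩ := p
  obtain ⟨j', l'⟩ := p'
  simp only [Prod.swap, ne_eq, Prod.mk.injEq, not_and] at hp hp' h1 h2 ⊢
  have hF : Measurable fun r : Round N => S.Y1 x r.1 r.2.1 i j l * S.Y1 x r.1 r.2.1 i j' l' :=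
    (S.measurable_Y1_right x i j l).mul (S.measurable_Y1_right x i j' l')
  by_cases hj : j' ≠ j ∧ l' ≠ j
  · refine hm.integral_eq_zero_of_odd k (flipFrom j) (fun _ => 1) (flipFrom_eq j) (by simp) hF
      fun r => ?_
    rw [S.Y1_signFlip, S.Y1_signFlip, flipFrom_self, flipFrom_of_ne _ (Ne.symm hp),
      flipFrom_of_ne _ hj.1, flipFrom_of_ne _ hj.2]
    ring
  -- If `j` occurs in `p'`, then `l` cannot, as `p'` is neither `p` nor its swap.
  · have hl : j' ≠ l ∧ l' ≠ l := by
      constructor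
      · rintro rfl
        have : l' = j := by
          by_contra hne
          exact hj ⟨fun h => hp h.symm, hne⟩
        exact h2 rfl this
      · rintro rfl
        have : j' = j := by
          by_contra hne
          exact hj ⟨hne, fun h => hp h.symm⟩
        exact h1 this rfl
    refine hm.integral_eq_zero_of_odd k (flipFrom l) (fun _ => 1) (flipFrom_eq l) (by simp) hF
      fun r => ?_
    rw [S.Y1_signFlip, S.Y1_signFlip, flipFrom_self, flipFrom_of_ne _ hp,
      flipFrom_of_ne _ hl.1, flipFrom_of_ne _ hl.2]
    ring

/-- Of the products with a given pair, only those with itself and with its swap survive, and the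
swap carries the same term: hence the factor `2`. -/
theorem integral_distCross_sq (hm : S.IsModel P γ h n) (k : ℕ) (x : Fin N → ℝ) (i : Fin N) :
    ∫ ω, S.distCross k x i (roundInput γ h n k ω) ^ 2 ∂P
      = 2 * ∑ p ∈ (S.nbrs k i).offDiag,
        ∫ ω, S.Y1 x (roundInput γ h n k ω).1 (roundInput γ h n k ω).2.1 i p.1 p.2 ^ 2 ∂P := by
  have hL := fun p : Fin N × Fin N => hm.memLp_Y1 k x i p.1 p.2
  have hLL : ∀ p p' : Fin N × Fin N, Integrable (fun ω =>
      S.Y1 x (roundInput γ h n k ω).1 (roundInput γ h n k ω).2.1 i p.1 p.2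
        * S.Y1 x (roundInput γ h n k ω).1 (roundInput γ h n k ω).2.1 i p'.1 p'.2) P :=
    fun p p' => (hL p).integrable_mul (hL p')
  simp only [distCross, sq, Finset.sum_mul_sum]
  rw [integral_finsetSum _ fun p _ => integrable_finsetSum _ fun p' _ => hLL p p', Finset.mul_sum]
  refine Finset.sum_congr rfl fun p hp => ?_
  rw [integral_finsetSum _ fun p' _ => hLL p p']
  obtain ⟨hp1, hp2, hne⟩ := Finset.mem_offDiag.1 hp
  have hsw : p.swap ∈ (S.nbrs k i).offDiag := Finset.mem_offDiag.2 ⟨hp2, hp1, hne.symm⟩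
  have hps : p ≠ p.swap := fun h => hne (congrArg Prod.fst h)
  rw [← Finset.sum_subset (s₁ := {p, p.swap}), Finset.sum_pair hps]
  · simp only [Prod.fst_swap, Prod.snd_swap, S.Y1_comm x _ _ i p.2 p.1]
    ring
  · intro p' hp'
    rcases Finset.mem_insert.1 hp' with rfl | hp'
    · exact hp
    · rwa [Finset.mem_singleton.1 hp']
  · intro p' hp' hnot
    simp only [Finset.mem_insert, Finset.mem_singleton, not_or] at hnot
    exact hm.integral_Y1_mul_Y1 k x i hne (Finset.mem_offDiag.1 hp').2.2 hnot.1 hnot.2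

/-- The products of indicators are reassembled into the expectation of one square before
Cauchy–Schwarz is applied. This bypasses their dependence, and `Γ² = Γ` leaves one factor `q` per
link. -/
theorem integral_distCross_sq_le (hm : S.IsModel P γ h n) (k : ℕ) (x : Fin N → ℝ) (i : Fin N) :
    ∫ ω, S.distCross k x i (roundInput γ h n k ω) ^ 2 ∂P
      ≤ (∑ j, x j ^ 2) * ∑ j ∈ S.nbrs k i, 2 * S.rho ^ 2 * S.q i j * S.Lam i j ^ 2 := by
  rw [hm.integral_distCross_sq]
  have hint : ∀ j l, Integrable
      (fun ω => Gam (fun j => γ k j ω) i j * Gam (fun j => γ k j ω) i l) P := by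
    intro j l
    have hg1 := hm.measurable_gam k i j
    have hg2 := hm.measurable_gam k i l
    refine (hm.integrable_gam k i j).mono (by fun_prop) ?_
    filter_upwards [hm.gam_sq_ae k i] with ω hω
    rw [norm_mul, Real.norm_of_nonneg (hω l).2.1]
    exact mul_le_of_le_one_right (norm_nonneg _) (hω l).2.2
  have step1 : ∑ p ∈ (S.nbrs k i).offDiag,
        ∫ ω, S.Y1 x (roundInput γ h n k ω).1 (roundInput γ h n k ω).2.1 i p.1 p.2 ^ 2 ∂P
      ≤ ∫ ω, S.rho ^ 2 * (∑ j ∈ S.nbrs k i, |x j| * (S.Lam i j * Gam (fun j => γ k j ω) i j)) ^ 2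
        ∂P := by
    have e : ∀ ω, S.rho ^ 2 *
        (∑ j ∈ S.nbrs k i, |x j| * (S.Lam i j * Gam (fun j => γ k j ω) i j)) ^ 2
        = ∑ p ∈ S.nbrs k i ×ˢ S.nbrs k i,
          S.rho ^ 2 * |x p.1| * |x p.2| * (S.Lam i p.1 * S.Lam i p.2) *
          (Gam (fun j => γ k j ω) i p.1 * Gam (fun j => γ k j ω) i p.2) := by
      intro ω
      rw [sq (Finset.sum _ _), Finset.sum_mul_sum, Finset.mul_sum, Finset.sum_product]
      refine Finset.sum_congr rfl fun j _ => ?_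
      rw [Finset.mul_sum]
      exact Finset.sum_congr rfl fun l _ => by ring
    simp only [e]
    rw [integral_finsetSum _ fun p _ => (hint p.1 p.2).const_mul _]
    simp only [integral_const_mul]
    -- Nonnegativity allows the diagonal pairs to be added, which completes the square.
    have hpos : ∀ p : Fin N × Fin N, 0 ≤ S.rho ^ 2 * |x p.1| * |x p.2| *
        (S.Lam i p.1 * S.Lam i p.2) *
        ∫ ω, Gam (fun j => γ k j ω) i p.1 * Gam (fun j => γ k j ω) i p.2 ∂P := by
      intro p
      have h0 := S.Lam_nonneg i p.1
      have h1 := S.Lam_nonneg i p.2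
      refine mul_nonneg (by positivity) (integral_nonneg_of_ae ?_)
      filter_upwards [hm.gam_sq_ae k i] with ω hω
      exact mul_nonneg (hω p.1).2.1 (hω p.2).2.1
    refine (Finset.sum_le_sum fun p hp => hm.integral_Y1_sq_le k x i
      (Finset.mem_offDiag.1 hp).2.2).trans ?_
    refine Finset.sum_le_sum_of_subset_of_nonneg ?_ fun p _ _ => hpos p
    intro p hp
    have := Finset.mem_offDiag.1 hp
    exact Finset.mem_product.2 ⟨this.1, this.2.1⟩
  have hi2 : Integrable (fun ω => (∑ j, x j ^ 2) * ∑ j ∈ S.nbrs k i, S.rho ^ 2 * S.Lam i j ^ 2 *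
      Gam (fun j => γ k j ω) i j) P :=
    (integrable_finsetSum _ fun j _ => (hm.integrable_gam k i j).const_mul _).const_mul _
  have step2 : ∫ ω, S.rho ^ 2 *
        (∑ j ∈ S.nbrs k i, |x j| * (S.Lam i j * Gam (fun j => γ k j ω) i j)) ^ 2 ∂P
      ≤ ∫ ω, (∑ j, x j ^ 2) * ∑ j ∈ S.nbrs k i, S.rho ^ 2 * S.Lam i j ^ 2 *
        Gam (fun j => γ k j ω) i j ∂P := by
    refine integral_mono_of_nonneg (Eventually.of_forall fun ω => by positivity) hi2 ?_
    filter_upwards [hm.gam_sq_ae k i] with ω hω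
    have h1 := Finset.sum_mul_sq_le_sq_mul_sq (S.nbrs k i) (fun j => |x j|)
      (fun j => S.Lam i j * Gam (fun j => γ k j ω) i j)
    have h2 : ∑ j ∈ S.nbrs k i, |x j| ^ 2 ≤ ∑ j, x j ^ 2 := by
      simp only [sq_abs]
      exact Finset.sum_le_sum_of_subset_of_nonneg (Finset.subset_univ _) fun j _ _ => sq_nonneg _
    have h3 : ∑ j ∈ S.nbrs k i, S.rho ^ 2 * S.Lam i j ^ 2 * Gam (fun j => γ k j ω) i j
        = S.rho ^ 2 * ∑ j ∈ S.nbrs k i, (S.Lam i j * Gam (fun j => γ k j ω) i j) ^ 2 := by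
      rw [Finset.mul_sum]
      refine Finset.sum_congr rfl fun j _ => ?_
      rw [mul_pow, (hω j).1]
      ring
    rw [h3, mul_left_comm]
    refine mul_le_mul_of_nonneg_left (h1.trans ?_) (sq_nonneg _)
    exact mul_le_mul_of_nonneg_right h2 (Finset.sum_nonneg fun j _ => sq_nonneg _)
  have step3 : ∫ ω, (∑ j, x j ^ 2) * ∑ j ∈ S.nbrs k i, S.rho ^ 2 * S.Lam i j ^ 2 *
        Gam (fun j => γ k j ω) i j ∂P
      = (∑ j, x j ^ 2) * ∑ j ∈ S.nbrs k i, S.rho ^ 2 * S.Lam i j ^ 2 * S.q i j := by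
    rw [integral_const_mul,
      integral_finsetSum _ fun j _ => (hm.integrable_gam k i j).const_mul _]
    congr 1
    refine Finset.sum_congr rfl fun j hj => ?_
    rw [integral_const_mul, hm.integral_gam k (ne_of_mem_nbrs hj)]
  refine (mul_le_mul_of_nonneg_left ((step1.trans step2).trans_eq step3)
    (by norm_num : (0 : ℝ) ≤ 2)).trans_eq ?_
  rw [mul_left_comm, Finset.mul_sum]
  congr 1
  exact Finset.sum_congr rfl fun j _ => by ring

/-- Terms of different neighbours are orthogonal. What remains is linear in the states; `4 s t ≤ 4
s² + t²`, with `s` the noise variance, makes it a constant plus a quadratic form. -/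
theorem integral_distNoise_sq_le (hm : S.IsModel P γ h n) (k : ℕ) (x : Fin N → ℝ) (i : Fin N) :
    ∫ ω, S.distNoise k x i (roundInput γ h n k ω) ^ 2 ∂P
      ≤ 4 * S.sig i ^ 4 + (∑ j, x j ^ 2) * ∑ j ∈ S.nbrs k i, S.abar k i j ^ 2 := by
  have hL := fun j : Fin N => hm.memLp_Y2 k x i j
  have hLL : ∀ p p' : Fin N, Integrable (fun ω =>
      S.Y2 x (roundInput γ h n k ω).1 (roundInput γ h n k ω).2.1 (roundInput γ h n k ω).2.2 i p
        * S.Y2 x (roundInput γ h n k ω).1 (roundInput γ h n k ω).2.1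
          (roundInput γ h n k ω).2.2 i p') P :=
    fun p p' => (hL p).integrable_mul (hL p')
  have h0 : ∫ ω, S.distNoise k x i (roundInput γ h n k ω) ^ 2 ∂P
      = 4 * ∑ j ∈ S.nbrs k i, ∫ ω, S.Y2 x (roundInput γ h n k ω).1 (roundInput γ h n k ω).2.1
        (roundInput γ h n k ω).2.2 i j ^ 2 ∂P := by
    simp only [distNoise, mul_pow]
    rw [integral_const_mul]
    norm_num
    simp only [sq, Finset.sum_mul_sum]
    rw [integral_finsetSum _ fun p _ => integrable_finsetSum _ fun p' _ => hLL p p']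
    refine Finset.sum_congr rfl fun j hj => ?_
    rw [integral_finsetSum _ fun p' _ => hLL j p']
    refine Finset.sum_eq_single_of_mem j hj fun l _ hlj => ?_
    have hF : Measurable fun r : Round N =>
        S.Y2 x r.1 r.2.1 r.2.2 i j * S.Y2 x r.1 r.2.1 r.2.2 i l :=
      (S.measurable_Y2_right x i j).mul (S.measurable_Y2_right x i l)
    refine hm.integral_eq_zero_of_odd k (flipFrom j) (fun _ => 1) (flipFrom_eq j) (by simp) hF
      fun r => ?_
    rw [S.Y2_signFlip, S.Y2_signFlip, flipFrom_self, flipFrom_of_ne _ hlj]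
    ring
  have h1 : ∑ j ∈ S.nbrs k i, ∫ ω, S.Y2 x (roundInput γ h n k ω).1 (roundInput γ h n k ω).2.1
        (roundInput γ h n k ω).2.2 i j ^ 2 ∂P
      ≤ S.sig i ^ 2 * ∑ j ∈ S.nbrs k i, |x j| * S.abar k i j := by
    rw [Finset.mul_sum]
    refine Finset.sum_le_sum fun j hj => ?_
    refine (hm.integral_Y2_sq_le k x (ne_of_mem_nbrs hj)).trans_eq ?_
    rw [S.abar_of_mem hj]
    ring
  have h2 := Finset.sum_mul_sq_le_sq_mul_sq (S.nbrs k i) (fun j => |x j|) (fun j => S.abar k i j)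
  have h3 : ∑ j ∈ S.nbrs k i, |x j| ^ 2 ≤ ∑ j, x j ^ 2 := by
    simp only [sq_abs]
    exact Finset.sum_le_sum_of_subset_of_nonneg (Finset.subset_univ _) fun j _ _ => sq_nonneg _
  have h4 := mul_le_mul_of_nonneg_right h3
    (Finset.sum_nonneg fun j (_ : j ∈ S.nbrs k i) => sq_nonneg (S.abar k i j))
  rw [h0]
  have h5 := sq_nonneg (2 * S.sig i ^ 2 - ∑ j ∈ S.nbrs k i, |x j| * S.abar k i j)
  nlinarith

/-- Second moment of the disturbance of an agent, for every value of the states. -/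
theorem integral_dist_const_sq_le (hm : S.IsModel P γ h n) (k : ℕ) (x : Fin N → ℝ) (i : Fin N) :
    ∫ ω, S.dist k x (roundInput γ h n k ω) i ^ 2 ∂P
      ≤ (∑ j, x j ^ 2) * ∑ j ∈ S.nbrs k i,
          (8 * S.Lam i j ^ 2 * S.rho ^ 2 * S.q i j - S.abar k i j ^ 2) + 7 * S.sig i ^ 4 := by
  have hs4 : 0 ≤ S.sig i ^ 4 := by positivity
  have hx : 0 ≤ ∑ j, x j ^ 2 := Finset.sum_nonneg fun j _ => sq_nonneg _
  have hsum : ∀ c : ℝ, ∀ d : ℝ, ∑ j ∈ S.nbrs k i,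
      (c * S.rho ^ 2 * S.q i j * S.Lam i j ^ 2 - d * S.abar k i j ^ 2)
      = c * ∑ j ∈ S.nbrs k i, S.rho ^ 2 * S.q i j * S.Lam i j ^ 2
        - d * ∑ j ∈ S.nbrs k i, S.abar k i j ^ 2 := by
    intro c d
    rw [Finset.mul_sum, Finset.mul_sum, ← Finset.sum_sub_distrib]
    exact Finset.sum_congr rfl fun j _ => by ring
  set Q := ∑ j ∈ S.nbrs k i, S.rho ^ 2 * S.q i j * S.Lam i j ^ 2 with hQ
  have hQ0 : 0 ≤ Q := Finset.sum_nonneg fun j _ => by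
    have := S.q_nonneg i j
    positivity
  have hrhs : ∑ j ∈ S.nbrs k i, (8 * S.Lam i j ^ 2 * S.rho ^ 2 * S.q i j - S.abar k i j ^ 2)
      = 8 * Q - ∑ j ∈ S.nbrs k i, S.abar k i j ^ 2 := by
    rw [← one_mul (∑ j ∈ S.nbrs k i, S.abar k i j ^ 2), ← hsum]
    exact Finset.sum_congr rfl fun j _ => by ring
  have hg := hm.integral_distGain_sq_le k x i
  have hc := hm.integral_distCross_sq_le k x i
  have hn := hm.integral_distNoise_sq_le k x i
  have e1 := hsum 2 1
  have e2 := hsum 2 0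
  simp only [one_mul, zero_mul, sub_zero] at e1 e2
  rw [e1] at hg
  rw [e2] at hc
  rw [hrhs]
  set T := ∑ j ∈ S.nbrs k i, S.abar k i j ^ 2 with hT
  have hT0 : 0 ≤ T := Finset.sum_nonneg fun j _ => sq_nonneg _
  -- A failed agent has no neighbours, so both link sums are empty and the disturbance is zero.
  by_cases hi : i ∈ S.failed k
  · have hempty : S.nbrs k i = ∅ := by
      refine Finset.eq_empty_of_forall_notMem fun j hj => ?_
      exact S.failed_isolated k i j hi (S.mem_nbrs.1 hj)
    simp only [dist, if_pos hi]
    simp [hQ, hT, hempty]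
    positivity
  have hA := hm.memLp_distGain k x i
  have hB := hm.memLp_noise_sub k i
  have hC := hm.memLp_distCross k x i
  have hD := hm.memLp_distNoise k x i
  have hAB := hA.add hB
  have hABC := hAB.add hC
  set A := fun ω => S.distGain k x i (roundInput γ h n k ω)
  set B := fun ω => ‖(roundInput γ h n k ω).2.2 i‖ ^ 2 - S.sig i ^ 2
  set C := fun ω => S.distCross k x i (roundInput γ h n k ω)
  set D := fun ω => S.distNoise k x i (roundInput γ h n k ω)
  have hexp : ∀ ω, S.dist k x (roundInput γ h n k ω) i ^ 2
      = (A ω + B ω) ^ 2 + C ω ^ 2 + D ω ^ 2 + 2 * ((A ω + B ω) * C ω)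
        + 2 * ((A ω + B ω + C ω) * D ω) := by
    intro ω
    rw [S.dist_eq k x _ hi]
    ring
  have o1 : ∫ ω, (A ω + B ω) * C ω ∂P = 0 := by
    have : ∀ ω, (A ω + B ω) * C ω = ∑ p ∈ (S.nbrs k i).offDiag, (A ω + B ω) *
        S.Y1 x (roundInput γ h n k ω).1 (roundInput γ h n k ω).2.1 i p.1 p.2 := fun ω =>
      Finset.mul_sum _ _ _
    simp only [this]
    have hi : ∀ p : Fin N × Fin N, Integrable (fun ω => (A ω + B ω) *
        S.Y1 x (roundInput γ h n k ω).1 (roundInput γ h n k ω).2.1 i p.1 p.2) P :=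
      fun p => hAB.integrable_mul (hm.memLp_Y1 k x i p.1 p.2)
    rw [integral_finsetSum _ fun p _ => hi p]
    refine Finset.sum_eq_zero fun p hp => ?_
    have hne := (Finset.mem_offDiag.1 hp).2.2
    have hF : Measurable fun r : Round N =>
        (S.distGain k x i r + (‖r.2.2 i‖ ^ 2 - S.sig i ^ 2)) * S.Y1 x r.1 r.2.1 i p.1 p.2 := by
      have := S.measurable_distGain k x i
      have := S.measurable_Y1_right x i p.1 p.2
      fun_prop
    -- This flip reverses `Y1` and leaves the gains and the noise energy alone.
    refine hm.integral_eq_zero_of_odd k (flipFrom p.1) (fun _ => 1) (flipFrom_eq _) (by simp) hF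
      fun r => ?_
    rw [S.Y1_signFlip, flipFrom_self, flipFrom_of_ne _ hne.symm,
      S.distGain_signFlip k x _ _ (flipFrom_eq _)]
    simp [signFlip]
  have o2 : ∫ ω, (A ω + B ω + C ω) * D ω ∂P = 0 := by
    have hF : Measurable fun r : Round N =>
        (S.distGain k x i r + (‖r.2.2 i‖ ^ 2 - S.sig i ^ 2) + S.distCross k x i r)
          * S.distNoise k x i r := by
      have := S.measurable_distGain k x i
      have := S.measurable_distCross k x i
      have := S.measurable_distNoise k x i
      fun_prop
    -- Reversing every noise and no channel changes the sign of `D` only.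
    refine hm.integral_eq_zero_of_odd k (fun _ _ => 1) (fun _ => -1) (by simp) (by simp) hF
      fun r => ?_
    rw [S.distGain_signFlip k x _ _ (by simp)]
    simp only [distCross, distNoise, S.Y1_signFlip, S.Y2_signFlip]
    simp [signFlip]
  have hABint : ∫ ω, (A ω + B ω) ^ 2 ∂P ≤ 2 * ∫ ω, A ω ^ 2 ∂P + 2 * ∫ ω, B ω ^ 2 ∂P := by
    rw [← integral_const_mul, ← integral_const_mul,
      ← integral_add (hA.integrable_sq.const_mul 2) (hB.integrable_sq.const_mul 2)]
    refine integral_mono hAB.integrable_sq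
      ((hA.integrable_sq.const_mul 2).add (hB.integrable_sq.const_mul 2)) fun ω => ?_
    have := sq_nonneg (A ω - B ω)
    change (A ω + B ω) ^ 2 ≤ 2 * A ω ^ 2 + 2 * B ω ^ 2
    nlinarith
  have hBint : ∫ ω, B ω ^ 2 ∂P = S.sig i ^ 4 := hm.integral_noise_sub_sq k i
  have i1 : Integrable (fun ω => (A ω + B ω) ^ 2) P := hAB.integrable_sq
  have i4 : Integrable (fun ω => (A ω + B ω) * C ω) P := hAB.integrable_mul hC
  have i5 : Integrable (fun ω => (A ω + B ω + C ω) * D ω) P := hABC.integrable_mul hD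
  simp only [hexp]
  rw [integral_add (((i1.fun_add hC.integrable_sq).fun_add hD.integrable_sq).fun_add
      (i4.const_mul 2)) (i5.const_mul 2),
    integral_add ((i1.fun_add hC.integrable_sq).fun_add hD.integrable_sq) (i4.const_mul 2),
    integral_add (i1.fun_add hC.integrable_sq) hD.integrable_sq, integral_add i1 hC.integrable_sq,
    integral_const_mul, integral_const_mul, o1, o2]
  -- With `∑ j, x j ^ 2` factored out, the link terms add up to `2 (2 Q - T) + 2 Q + T = 6 Q - T`,
  -- and the noise terms to `(2 + 4) σ⁴`; both fit below `8 Q - T` and `7 σ⁴`.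
  nlinarith [mul_nonneg hx hQ0, mul_nonneg hx hT0]

end IsModel

end System

end OTA

/-! ### Freezing the past: square integrability and orthogonality of the disturbance. -/

namespace OTA

/-- By independence `X` can be held fixed while `Y` is averaged. This version presupposes no
integrability, so it applies before the disturbance is known to be square integrable. -/
theorem lintegral_comp_prodMk_of_indepFun {Ω α β : Type*} [MeasurableSpace Ω] [MeasurableSpace α]
    [MeasurableSpace β] {P : Measure Ω} [IsProbabilityMeasure P] {X : Ω → α} {Y : Ω → β}
    (hX : Measurable X) (hY : Measurable Y) (hXY : IndepFun X Y P) {F : α × β → ℝ≥0∞}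
    (hF : Measurable F) :
    ∫⁻ ω, F (X ω, Y ω) ∂P = ∫⁻ ω, ∫⁻ ω', F (X ω, Y ω') ∂P ∂P := by
  have h1 := (indepFun_iff_map_prod_eq_prod_map_map hX.aemeasurable hY.aemeasurable).1 hXY
  rw [← lintegral_map (f := F) hF (hX.prodMk hY), h1, lintegral_prod _ hF.aemeasurable,
    lintegral_map (Measurable.lintegral_prod_right' hF) hX]
  refine lintegral_congr fun ω => ?_
  rw [lintegral_map (by fun_prop) hY]

theorem integral_comp_prodMk_of_indepFun {Ω α β : Type*} [MeasurableSpace Ω] [MeasurableSpace α]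
    [MeasurableSpace β] {P : Measure Ω} [IsProbabilityMeasure P] {X : Ω → α} {Y : Ω → β}
    (hX : Measurable X) (hY : Measurable Y) (hXY : IndepFun X Y P) {F : α × β → ℝ}
    (hF : Measurable F) (hi : Integrable (fun ω => F (X ω, Y ω)) P) :
    ∫ ω, F (X ω, Y ω) ∂P = ∫ ω, ∫ ω', F (X ω, Y ω') ∂P ∂P := by
  have h1 := (indepFun_iff_map_prod_eq_prod_map_map hX.aemeasurable hY.aemeasurable).1 hXY
  have hXY' := hX.prodMk hY
  have hi' : Integrable F (P.map fun ω => (X ω, Y ω)) :=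
    (integrable_map_measure hF.aestronglyMeasurable hXY'.aemeasurable).2 hi
  rw [h1] at hi'
  rw [← integral_map (f := F) hXY'.aemeasurable hF.aestronglyMeasurable, h1, integral_prod _ hi',
    integral_map hX.aemeasurable
      (hF.stronglyMeasurable.integral_prod_right').aestronglyMeasurable]
  refine integral_congr_ae (Eventually.of_forall fun ω => ?_)
  exact integral_map hY.aemeasurable
    (hF.comp (measurable_const.prodMk measurable_id)).aestronglyMeasurable

/-- The time at which an input is used. -/
def Input.time {N : ℕ} : Input N → ℕ
  | .slot k _ => k
  | .channel k _ _ => k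
  | .noise k _ => k

namespace System

variable {N : ℕ} {S : System N}

theorem abar_of_failed {k : ℕ} {i : Fin N} (hi : i ∈ S.failed k) (j : Fin N) :
    S.abar k i j = 0 := by
  rw [abar, if_neg (S.failed_isolated k i j hi)]

/-- The expected energy from the neighbours moves into the Laplacian term. Failed agents need no
separate form, since their weights and their disturbance vanish. -/
theorem step_eq (k : ℕ) (x : Fin N → ℝ) (r : Round N) (i : Fin N) :
    S.step k x r.1 r.2.1 r.2.2 i
      = x i - S.alpha k * ∑ j, S.abar k i j * (x i - x j) + S.alpha k * S.dist k x r i := by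
  by_cases hi : i ∈ S.failed k
  · simp [step, dist, hi, abar_of_failed hi]
  · rw [step, dist, if_neg hi, if_neg hi]
    have : ∑ j, S.abar k i j * (x i - x j) = (∑ j, S.abar k i j) * x i - ∑ j, S.abar k i j * x j := by
      rw [Finset.sum_mul, ← Finset.sum_sub_distrib]
      exact Finset.sum_congr rfl fun j _ => by ring
    rw [this]
    ring

theorem measurable_dist_comp (S : System N) (k : ℕ) (i : Fin N) {α : Type*} [MeasurableSpace α]
    {f : α → Fin N → ℝ} {g : α → Round N} (hf : Measurable f) (hg : Measurable g) :
    Measurable fun a => S.dist k (f a) (g a) i := by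
  have h := (S.measurable_dist k i).comp (hf.prodMk hg)
  simp only [Function.comp_def] at h
  exact h

variable {Ω : Type*}
  (S) (γ : ℕ → Fin N → Ω → ℝ) (h : ℕ → Fin N → Fin N → Ω → ℂ) (n : ℕ → Fin N → Ω → ℂ)

/-- The disturbance of agent `i` at time `k`. -/
noncomputable def disturbance (k : ℕ) (i : Fin N) (ω : Ω) : ℝ :=
  S.dist k (fun j => S.state γ h n k j ω) (roundInput γ h n k ω) i

theorem state_succ (k : ℕ) (i : Fin N) (ω : Ω) :
    S.state γ h n (k + 1) i ω = S.state γ h n k i ω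
      - S.alpha k * ∑ j, S.abar k i j * (S.state γ h n k i ω - S.state γ h n k j ω)
      + S.alpha k * S.disturbance γ h n k i ω :=
  step_eq k (fun j => S.state γ h n k j ω) (roundInput γ h n k ω) i

/-- Adaptedness: this makes the states independent of the round that acts on them. -/
theorem measurable_state_inputSigma (k : ℕ) :
    Measurable[inputSigma γ h n {c | c.time < k}] fun ω i => S.state γ h n k i ω := by
  induction k with
  | zero =>
    simp only [state]
    exact @measurable_const _ _ _ (inputSigma γ h n {c | c.time < 0}) _
  | succ k ih =>
    have hle : inputSigma γ h n {c | c.time < k} ≤ inputSigma γ h n {c | c.time < k + 1} :=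
      biSup_mono fun c hc => Nat.lt_succ_of_lt hc
    have h1 := ih.mono hle le_rfl
    have h2 : Measurable[inputSigma γ h n {c | c.time < k + 1}] (roundInput γ h n k) :=
      measurable_roundInput_inputSigma (fun i => Nat.lt_succ_self k) (fun i j => Nat.lt_succ_self k)
        (fun i => Nat.lt_succ_self k)
    let := inputSigma γ h n {c | c.time < k + 1}
    refine measurable_pi_iff.2 fun i => ?_
    simp only [S.state_succ, disturbance]
    have h3 := S.measurable_dist_comp k i h1 h2
    have h4 := fun j => measurable_pi_iff.1 h1 j
    refine Measurable.add (Measurable.sub (h4 i) (Measurable.const_mul ?_ _)) (h3.const_mul _)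
    exact Finset.measurable_fun_sum _ fun j _ => ((h4 i).sub (h4 j)).const_mul _

theorem measurable_disturbance_inputSigma (k : ℕ) (i : Fin N) :
    Measurable[inputSigma γ h n {c | c.time < k + 1}] (S.disturbance γ h n k i) := by
  have hle : inputSigma γ h n {c | c.time < k} ≤ inputSigma γ h n {c | c.time < k + 1} :=
    biSup_mono fun c hc => Nat.lt_succ_of_lt hc
  have h1 := (S.measurable_state_inputSigma γ h n k).mono hle le_rfl
  have h2 : Measurable[inputSigma γ h n {c | c.time < k + 1}] (roundInput γ h n k) :=
    measurable_roundInput_inputSigma (fun i => Nat.lt_succ_self k) (fun i j => Nat.lt_succ_self k)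
      (fun i => Nat.lt_succ_self k)
  let := inputSigma γ h n {c | c.time < k + 1}
  unfold disturbance
  exact S.measurable_dist_comp k i h1 h2

variable {S γ h n} [MeasurableSpace Ω] {P : Measure Ω}

namespace IsModel

theorem measurable_state (hm : S.IsModel P γ h n) (k : ℕ) (i : Fin N) :
    Measurable (S.state γ h n k i) :=
  measurable_pi_iff.1 ((S.measurable_state_inputSigma γ h n k).mono (hm.inputSigma_le _) le_rfl) i

theorem measurable_disturbance (hm : S.IsModel P γ h n) (k : ℕ) (i : Fin N) :
    Measurable (S.disturbance γ h n k i) :=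
  (S.measurable_disturbance_inputSigma γ h n k i).mono (hm.inputSigma_le _) le_rfl

theorem indepFun_roundInput (hm : S.IsModel P γ h n) (k : ℕ) {α : Type*} [MeasurableSpace α]
    {f : Ω → α} (hf : Measurable[inputSigma γ h n {c | c.time < k}] f) :
    IndepFun f (roundInput γ h n k) P := by
  refine hm.indepFun (T' := {c | c.time = k}) ?_ hf
    (measurable_roundInput_inputSigma (fun i => rfl) (fun i j => rfl) (fun i => rfl))
  rw [Set.disjoint_left]
  intro c h1 h2
  exact absurd h2 (ne_of_lt h1)

variable [IsProbabilityMeasure P]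

/-- A bound for the second moment of the disturbance of agent `i`. -/
theorem lintegral_disturbance_sq_le (hm : S.IsModel P γ h n) (k : ℕ) (i : Fin N) :
    ∫⁻ ω, ENNReal.ofReal (S.disturbance γ h n k i ω ^ 2) ∂P
      ≤ ∫⁻ ω, ENNReal.ofReal ((∑ j, S.state γ h n k j ω ^ 2) * ∑ j ∈ S.nbrs k i,
          (8 * S.Lam i j ^ 2 * S.rho ^ 2 * S.q i j - S.abar k i j ^ 2) + 7 * S.sig i ^ 4) ∂P := by
  have hX := measurable_pi_iff.2 (hm.measurable_state k)
  have hind := hm.indepFun_roundInput k (S.measurable_state_inputSigma γ h n k)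
  have hF : Measurable fun z : (Fin N → ℝ) × Round N => ENNReal.ofReal (S.dist k z.1 z.2 i ^ 2) :=
    ((S.measurable_dist k i).pow_const 2).ennreal_ofReal
  have e := lintegral_comp_prodMk_of_indepFun hX (hm.measurable_roundInput k) hind hF
  refine e.trans_le (lintegral_mono fun ω => ?_)
  simp only
  rw [← ofReal_integral_eq_lintegral_ofReal]
  · exact ENNReal.ofReal_le_ofReal (hm.integral_dist_const_sq_le k _ i)
  · exact (hm.memLp_dist_const k _ i).integrable_sq
  · exact Eventually.of_forall fun ω' => sq_nonneg _

/-- States and disturbances become square integrable by one alternating induction over time; this is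
the passage from state to disturbance at a fixed time. -/
theorem memLp_disturbance_of_state (hm : S.IsModel P γ h n) (k : ℕ)
    (hL : ∀ i, MemLp (S.state γ h n k i) 2 P) (i : Fin N) :
    MemLp (S.disturbance γ h n k i) 2 P := by
  rw [memLp_two_iff_integrable_sq (hm.measurable_disturbance k i).aestronglyMeasurable]
  refine ⟨((hm.measurable_disturbance k i).pow_const 2).aestronglyMeasurable, ?_⟩
  rw [hasFiniteIntegral_iff_ofReal (Eventually.of_forall fun ω => sq_nonneg _)]
  refine (hm.lintegral_disturbance_sq_le k i).trans_lt ?_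
  refine Integrable.lintegral_lt_top ?_
  exact ((integrable_finsetSum _ fun j _ => (hL j).integrable_sq).mul_const _).add
    (integrable_const _)

theorem memLp_state (hm : S.IsModel P γ h n) (k : ℕ) :
    ∀ i, MemLp (S.state γ h n k i) 2 P := by
  induction k with
  | zero => exact fun i => memLp_const _
  | succ k ih =>
    intro i
    have e : S.state γ h n (k + 1) i = _ := funext fun ω => S.state_succ γ h n k i ω
    rw [e]
    refine ((ih i).sub (MemLp.const_mul ?_ _)).add
      ((hm.memLp_disturbance_of_state k ih i).const_mul _)
    exact memLp_finsetSum _ fun j _ => ((ih i).sub (ih j)).const_mul _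

theorem memLp_disturbance (hm : S.IsModel P γ h n) (k : ℕ) (i : Fin N) :
    MemLp (S.disturbance γ h n k i) 2 P :=
  hm.memLp_disturbance_of_state k (hm.memLp_state k) i

theorem integral_disturbance_sq_le (hm : S.IsModel P γ h n) (k : ℕ) (i : Fin N) :
    ∫ ω, S.disturbance γ h n k i ω ^ 2 ∂P
      ≤ (∫ ω, ∑ j, S.state γ h n k j ω ^ 2 ∂P) * ∑ j ∈ S.nbrs k i,
          (8 * S.Lam i j ^ 2 * S.rho ^ 2 * S.q i j - S.abar k i j ^ 2) + 7 * S.sig i ^ 4 := by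
  have hint : Integrable (fun ω => ∑ j, S.state γ h n k j ω ^ 2) P :=
    integrable_finsetSum _ fun j _ => (hm.memLp_state k j).integrable_sq
  have hnn : 0 ≤ ∑ j ∈ S.nbrs k i,
      (8 * S.Lam i j ^ 2 * S.rho ^ 2 * S.q i j - S.abar k i j ^ 2) :=
    Finset.sum_nonneg fun j hj => S.link_nonneg k hj
  have h1 := hm.lintegral_disturbance_sq_le k i
  rw [← ofReal_integral_eq_lintegral_ofReal (hm.memLp_disturbance k i).integrable_sq
      (Eventually.of_forall fun ω => sq_nonneg _),
    ← ofReal_integral_eq_lintegral_ofReal ((hint.mul_const _).fun_add (integrable_const _))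
      (Eventually.of_forall fun ω => ?_), ENNReal.ofReal_le_ofReal_iff] at h1
  · rw [integral_add (hint.mul_const _) (integrable_const _), integral_mul_const] at h1
    simpa using h1
  · refine integral_nonneg fun ω => ?_
    have : 0 ≤ ∑ j, S.state γ h n k j ω ^ 2 := Finset.sum_nonneg fun j _ => sq_nonneg _
    positivity
  · have : 0 ≤ ∑ j, S.state γ h n k j ω ^ 2 := Finset.sum_nonneg fun j _ => sq_nonneg _
    positivity

/-- The disturbance is orthogonal to every square-integrable function of the past. -/
theorem integral_past_mul_disturbance (hm : S.IsModel P γ h n) (k : ℕ) (i : Fin N) {φ : Ω → ℝ}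
    (hφ : Measurable[inputSigma γ h n {c | c.time < k}] φ) (hL : MemLp φ 2 P) :
    ∫ ω, φ ω * S.disturbance γ h n k i ω ∂P = 0 := by
  have hφ' : Measurable φ := hφ.mono (hm.inputSigma_le _) le_rfl
  have hX := measurable_pi_iff.2 (hm.measurable_state k)
  -- `φ` and the states are frozen together, so that the inner integral is `φ` times a centred
  -- quantity.
  have hpair : Measurable[inputSigma γ h n {c | c.time < k}]
      fun ω => (φ ω, fun i => S.state γ h n k i ω) := by
    let := inputSigma γ h n {c | c.time < k}
    exact hφ.prodMk (S.measurable_state_inputSigma γ h n k)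
  have hind := hm.indepFun_roundInput k hpair
  have hF : Measurable fun z : (ℝ × (Fin N → ℝ)) × Round N => z.1.1 * S.dist k z.1.2 z.2 i :=
    Measurable.mul (by fun_prop) (S.measurable_dist_comp k i (by fun_prop) (by fun_prop))
  have hd := hm.memLp_disturbance k i
  unfold disturbance at hd ⊢
  have hint : Integrable (fun ω => φ ω * S.dist k (fun j => S.state γ h n k j ω)
      (roundInput γ h n k ω) i) P := hL.integrable_mul hd
  have e := integral_comp_prodMk_of_indepFun (hφ'.prodMk hX) (hm.measurable_roundInput k) hind hF
    hint
  simp only [integral_const_mul, hm.integral_dist_const, mul_zero, integral_zero] at e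
  exact e

end IsModel

end System

end OTA

/-! ### The mean Laplacian and boundedness of the constants. -/

namespace OTA

/-- A product of factors that exceed `1` by a summable amount is bounded. -/
theorem abs_prod_Ico_le {f c : ℕ → ℝ} (hc : ∀ j, 0 ≤ c j) (hs : Summable c)
    (hf : ∀ j, |f j| ≤ 1 + c j) (l m : ℕ) :
    |∏ j ∈ Finset.Ico l m, f j| ≤ Real.exp (∑' j, c j) := by
  rw [Finset.abs_prod]
  calc ∏ j ∈ Finset.Ico l m, |f j| ≤ ∏ j ∈ Finset.Ico l m, Real.exp (c j) :=
        Finset.prod_le_prod (fun j _ => abs_nonneg _) fun j _ =>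
          (hf j).trans (by linarith [Real.add_one_le_exp (c j)])
    _ = Real.exp (∑ j ∈ Finset.Ico l m, c j) := (Real.exp_sum _ _).symm
    _ ≤ _ := Real.exp_le_exp.2 (hs.sum_le_tsum _ fun j _ => hc j)

namespace System

variable {N : ℕ} (S : System N)

/-- The Dirichlet form of the mean Laplacian, with every edge counted twice. -/
noncomputable def dirichlet (k : ℕ) (x : Fin N → ℝ) : ℝ :=
  ∑ i, ∑ j, S.abar k i j * (x i - x j) ^ 2

theorem dirichlet_nonneg (k : ℕ) (x : Fin N → ℝ) : 0 ≤ S.dirichlet k x :=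
  Finset.sum_nonneg fun i _ => Finset.sum_nonneg fun j _ =>
    mul_nonneg (S.abar_nonneg k i j) (sq_nonneg _)

/-- The mean Laplacian applied to a vector. -/
noncomputable def lap (k : ℕ) (x : Fin N → ℝ) (i : Fin N) : ℝ :=
  ∑ j, S.abar k i j * (x i - x j)

theorem Lbar_mulVec (k : ℕ) (x : Fin N → ℝ) : (S.Lbar k).mulVec x = S.lap k x := by
  funext i
  rw [Lbar, Matrix.sub_mulVec, Pi.sub_apply, Matrix.mulVec_diagonal, lap, Finset.sum_mul]
  simp only [Matrix.mulVec, dotProduct, Matrix.of_apply, mul_sub, Finset.sum_sub_distrib]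

/-- Symmetrisation in `i` and `j`; the half appears because the Dirichlet form counts each edge
twice. -/
theorem sum_mul_lap (k : ℕ) (x : Fin N → ℝ) :
    ∑ i, x i * S.lap k x i = S.dirichlet k x / 2 := by
  have h1 : ∑ i, x i * S.lap k x i = ∑ i, ∑ j, S.abar k i j * (x i * (x i - x j)) := by
    refine Finset.sum_congr rfl fun i _ => ?_
    rw [lap, Finset.mul_sum]
    exact Finset.sum_congr rfl fun j _ => by ring
  have h2 : ∑ i, x i * S.lap k x i = ∑ i, ∑ j, S.abar k i j * (x j * (x j - x i)) := by
    rw [h1, Finset.sum_comm]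
    exact Finset.sum_congr rfl fun i _ => Finset.sum_congr rfl fun j _ => by rw [S.abar_symm]
  have h3 : S.dirichlet k x
      = ∑ i, ∑ j, S.abar k i j * (x i * (x i - x j))
        + ∑ i, ∑ j, S.abar k i j * (x j * (x j - x i)) := by
    rw [dirichlet]
    simp only [← Finset.sum_add_distrib]
    exact Finset.sum_congr rfl fun i _ => Finset.sum_congr rfl fun j _ => by ring
  rw [h3, ← h1, ← h2]
  ring

/-- Antisymmetry under exchange of `i` and `j`. This is why averaging preserves the mean of the
states. -/
theorem sum_lap (k : ℕ) (x : Fin N → ℝ) : ∑ i, S.lap k x i = 0 := by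
  have h : ∑ i, S.lap k x i = -∑ i, S.lap k x i := by
    simp only [lap, ← Finset.sum_neg_distrib]
    rw [Finset.sum_comm]
    exact Finset.sum_congr rfl fun i _ => Finset.sum_congr rfl fun j _ => by
      rw [S.abar_symm]
      ring
  linarith

theorem sum_mulVec_sq_le (A : Matrix (Fin N) (Fin N) ℝ) (x : Fin N → ℝ) :
    ∑ i, (A.mulVec x i) ^ 2 ≤ norm2 A ^ 2 * ∑ i, x i ^ 2 := by
  have h := (Matrix.toEuclideanCLM (n := Fin N) (𝕜 := ℝ) A).le_opNorm (WithLp.toLp 2 x)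
  have h2 := pow_le_pow_left₀ (norm_nonneg _) h 2
  rw [mul_pow, EuclideanSpace.real_norm_sq_eq, EuclideanSpace.real_norm_sq_eq] at h2
  exact h2

theorem one_sub_mulVec (k : ℕ) (x : Fin N → ℝ) (i : Fin N) :
    (1 - S.alpha k • S.Lbar k).mulVec x i = x i - S.alpha k * S.lap k x i := by
  rw [Matrix.sub_mulVec, Matrix.one_mulVec, Matrix.smul_mulVec, S.Lbar_mulVec]
  rfl

/-- The constant vector is fixed by the averaging matrix, and for `0 < N` it is nonzero. -/
theorem one_le_norm2 (k : ℕ) (hN : 0 < N) : 1 ≤ norm2 (1 - S.alpha k • S.Lbar k) ^ 2 := by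
  have h := sum_mulVec_sq_le (1 - S.alpha k • S.Lbar k) (fun _ => 1)
  simp only [S.one_sub_mulVec, lap, sub_self, mul_zero, Finset.sum_const_zero, sub_zero, one_pow,
    Finset.sum_const, Finset.card_univ, Fintype.card_fin, nsmul_eq_mul, mul_one] at h
  have : (0 : ℝ) < N := by exact_mod_cast hN
  nlinarith

/-- One averaging step does not increase the Euclidean norm. -/
theorem sum_sq_averaging_le {k : ℕ} (hs : ∀ i, 0 < 1 - S.alpha k * ∑ j, S.abar k i j)
    (x : Fin N → ℝ) : ∑ i, (x i - S.alpha k * S.lap k x i) ^ 2 ≤ ∑ i, x i ^ 2 := by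
  have hstep : ∀ i, (x i - S.alpha k * S.lap k x i) ^ 2
      ≤ (1 - S.alpha k * ∑ j, S.abar k i j) * x i ^ 2
        + S.alpha k * ∑ j, S.abar k i j * x j ^ 2 := by
    intro i
    set c := 1 - S.alpha k * ∑ j, S.abar k i j with hc
    have hc0 := hs i
    -- The new value is a convex combination: `none` carries the weight `c` kept on `x i`, and `some
    -- j` the weight given to `x j`. Jensen's inequality for the square is then weighted
    -- Cauchy–Schwarz.
    set p : Option (Fin N) → ℝ := fun o => o.elim c fun j => S.alpha k * S.abar k i j
    set y : Option (Fin N) → ℝ := fun o => o.elim (x i) x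
    have hp : ∀ o, 0 ≤ p o := by
      rintro (_ | j)
      · exact hc0.le
      · exact mul_nonneg (S.alpha_pos k).le (S.abar_nonneg k i j)
    have hcs := Finset.sum_sq_le_sum_mul_sum_of_sq_le_mul Finset.univ (r := fun o => p o * y o)
      (f := p) (g := fun o => p o * y o ^ 2) (fun o _ => hp o)
      (fun o _ => mul_nonneg (hp o) (sq_nonneg _)) (fun o _ => (by ring_nf; rfl))
    simp only [Fintype.sum_option] at hcs
    simp only [p, y, Option.elim] at hcs
    have h1 : c + ∑ j, S.alpha k * S.abar k i j = 1 := by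
      rw [hc, Finset.mul_sum]
      ring
    have h2 : x i - S.alpha k * S.lap k x i
        = c * x i + ∑ j, S.alpha k * S.abar k i j * x j := by
      rw [hc, lap]
      simp only [mul_sub, Finset.sum_sub_distrib, ← Finset.sum_mul, ← Finset.mul_sum, mul_assoc]
      ring
    rw [h1, one_mul] at hcs
    rw [h2, Finset.mul_sum]
    simpa only [mul_assoc] using hcs
  refine (Finset.sum_le_sum fun i _ => hstep i).trans_eq ?_
  -- By symmetry the columns of the averaging matrix also sum to one, so the total weight on each `x
  -- i ^ 2` is one.
  have h3 : ∑ i, S.alpha k * ∑ j, S.abar k i j * x j ^ 2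
      = ∑ i, S.alpha k * (∑ j, S.abar k i j) * x i ^ 2 := by
    simp only [Finset.mul_sum, Finset.sum_mul]
    rw [Finset.sum_comm]
    exact Finset.sum_congr rfl fun i _ => Finset.sum_congr rfl fun j _ => by
      rw [S.abar_symm]
      ring
  rw [Finset.sum_add_distrib, h3, ← Finset.sum_add_distrib]
  exact Finset.sum_congr rfl fun i _ => by ring

theorem norm2_le_one {k : ℕ} (hs : ∀ i, 0 < 1 - S.alpha k * ∑ j, S.abar k i j) :
    norm2 (1 - S.alpha k • S.Lbar k) ≤ 1 := by
  refine ContinuousLinearMap.opNorm_le_bound _ zero_le_one fun x => ?_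
  rw [one_mul]
  refine le_of_sq_le_sq ?_ (norm_nonneg _)
  rw [EuclideanSpace.real_norm_sq_eq, EuclideanSpace.real_norm_sq_eq]
  have := S.sum_sq_averaging_le hs (fun i => x i)
  simp only [← S.one_sub_mulVec] at this
  exact this

theorem posSemidef_Lbar (k : ℕ) : (S.Lbar k).PosSemidef := by
  refine Matrix.PosSemidef.of_dotProduct_mulVec_nonneg ?_ fun x => ?_
  · refine Matrix.IsHermitian.ext fun i j => ?_
    simp only [Lbar, Matrix.sub_apply, Matrix.of_apply, Matrix.diagonal_apply, star_trivial,
      S.abar_symm k j i]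
    by_cases h : i = j
    · simp [h]
    · simp [h, Ne.symm h]
  · rw [S.Lbar_mulVec]
    simp only [star_trivial, dotProduct]
    rw [S.sum_mul_lap]
    linarith [S.dirichlet_nonneg k x]

/-- The sorted list consists of eigenvalues; if it has fewer than two entries, the default `0` is
returned. -/
theorem lambda2_nonneg {A : Matrix (Fin N) (Fin N) ℝ} (hA : A.PosSemidef) : 0 ≤ lambda2 A := by
  unfold lambda2
  by_cases h : 1 < (A.charpoly.roots.sort (· ≤ ·)).length
  · rw [List.getD_eq_getElem _ _ h]
    have hmem := List.getElem_mem h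
    have hroots := hA.1.roots_charpoly_eq_eigenvalues
    have hmem' := (Multiset.mem_sort _).1 hmem
    generalize (A.charpoly.roots.sort (· ≤ ·))[1] = μ at hmem' ⊢
    rw [hroots] at hmem'
    obtain ⟨i, _, hi⟩ := Multiset.mem_map.1 hmem'
    rw [← hi]
    exact hA.eigenvalues_nonneg i
  · rw [List.getD_eq_default (hn := not_lt.1 h)]

/-! ### The constants -/

theorem link_sum_le_CL (k : ℕ) :
    ∑ i, ∑ j ∈ S.nbrs k i, (8 * S.Lam i j ^ 2 * S.rho ^ 2 * S.q i j - S.abar k i j ^ 2) ≤ S.CL := by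
  refine le_ciSup (f := fun k => ∑ i, ∑ j ∈ S.nbrs k i,
    (8 * S.Lam i j ^ 2 * S.rho ^ 2 * S.q i j - S.abar k i j ^ 2)) ?_ k
  -- Summing over all pairs bounds every topology at once.
  refine ⟨∑ i, ∑ j, 8 * S.Lam i j ^ 2 * S.rho ^ 2 * S.q i j, ?_⟩
  rintro _ ⟨k, rfl⟩
  refine Finset.sum_le_sum fun i _ => ?_
  refine (Finset.sum_le_sum fun j _ => sub_le_self _ (sq_nonneg _)).trans ?_
  refine Finset.sum_le_sum_of_subset_of_nonneg (Finset.subset_univ _) fun j _ _ => ?_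
  have := S.q_nonneg i j
  positivity

theorem CL_nonneg : 0 ≤ S.CL := by
  refine le_trans ?_ (S.link_sum_le_CL 0)
  exact Finset.sum_nonneg fun i _ => Finset.sum_nonneg fun j hj => S.link_nonneg 0 hj

theorem CM1_nonneg : 0 ≤ S.CM1 := by
  refine Finset.sum_nonneg fun i _ => Finset.sum_nonneg fun j _ => Finset.sum_nonneg fun l _ => ?_
  have h1 := S.q_nonneg i j
  have h2 := S.q_nonneg i l
  have h3 := S.Lam_nonneg i j
  have h4 := S.Lam_nonneg i l
  unfold M1
  positivity

theorem noise_sum_le_CM2 : ∑ i, 7 * S.sig i ^ 4 ≤ S.CM2 := by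
  refine Finset.sum_le_sum fun i _ => le_add_of_nonneg_right ?_
  refine mul_nonneg zero_le_two (Finset.sum_nonneg fun j _ => mul_nonneg ?_ ?_)
  · have h1 := S.q_nonneg i j
    have h3 := S.Lam_nonneg i j
    have h4 := S.rho_pos
    unfold M2
    positivity
  · exact Real.iSup_nonneg S.x0_nonneg

theorem CM2_nonneg : 0 ≤ S.CM2 :=
  (Finset.sum_nonneg fun i _ => by positivity).trans S.noise_sum_le_CM2

/-- The growth factor of the second moment of the states. -/
noncomputable def growth (k : ℕ) : ℝ :=
  norm2 (1 - S.alpha k • S.Lbar k) ^ 2 + S.alpha k ^ 2 * (S.CL + S.CM1)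

theorem one_le_growth (hN : 0 < N) (k : ℕ) : 1 ≤ S.growth k := by
  have h1 := S.one_le_norm2 k hN
  have h2 := mul_nonneg (sq_nonneg (S.alpha k)) (add_nonneg S.CL_nonneg S.CM1_nonneg)
  unfold growth
  linarith

theorem growth_le (hs : S.StepSizeCondition) (k : ℕ) :
    S.growth k ≤ 1 + S.alpha k ^ 2 * (S.CL + S.CM1) := by
  have h1 := S.norm2_le_one (hs.small k)
  have h2 : norm2 (1 - S.alpha k • S.Lbar k) ^ 2 ≤ 1 := pow_le_one₀ (norm_nonneg _) h1
  unfold growth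
  linarith

theorem growth_nonneg (k : ℕ) : 0 ≤ S.growth k := by
  have h2 := mul_nonneg (sq_nonneg (S.alpha k)) (add_nonneg S.CL_nonneg S.CM1_nonneg)
  unfold growth
  positivity

theorem Phi3_nonneg (l k : ℕ) : 0 ≤ S.Phi3 l k := Finset.prod_nonneg fun j _ => S.growth_nonneg j

theorem Phi3_le (hs : S.StepSizeCondition) :
    ∃ D : ℝ, 0 ≤ D ∧ ∀ l k, S.Phi3 l k ≤ D := by
  refine ⟨Real.exp (∑' k, S.alpha k ^ 2 * (S.CL + S.CM1)), (Real.exp_pos _).le, fun l k => ?_⟩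
  refine (le_abs_self _).trans (abs_prod_Ico_le (f := S.growth) (fun j => ?_)
    (hs.sum_sq.mul_right _) (fun j => ?_) l k)
  · exact mul_nonneg (sq_nonneg _) (add_nonneg S.CL_nonneg S.CM1_nonneg)
  · rw [abs_of_nonneg (S.growth_nonneg j)]
    exact S.growth_le hs j

theorem tendsto_alpha (hs : S.StepSizeCondition) : Tendsto S.alpha atTop (𝓝 0) := by
  have h := hs.sum_sq.tendsto_atTop_zero
  have h2 := (Real.continuous_sqrt.tendsto 0).comp h
  rw [Real.sqrt_zero] at h2
  refine h2.congr fun k => ?_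
  simp only [Function.comp]
  exact Real.sqrt_sq (S.alpha_pos k).le

theorem summable_alpha_block (hs : S.StepSizeCondition) {L : ℕ} (hL : 0 < L) :
    Summable fun j => S.alpha ((j + 1) * L) ^ 2 :=
  hs.sum_sq.comp_injective (i := fun j => (j + 1) * L) fun a b hab => by
    have := Nat.eq_of_mul_eq_mul_right hL hab
    omega

/-- This serves to show that the supremum in `Mbar2` is over a bounded set. The term linear in `α`
only lowers a factor, so once `α` is small a factor exceeds one in modulus by at most order `α²`. -/
theorem abs_Phi2_le (hs : S.StepSizeCondition) {L : ℕ} (hL : 0 < L) (C : ℝ) :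
    ∃ D : ℝ, 0 ≤ D ∧ ∀ l m, |S.Phi2 L C l m| ≤ D := by
  set lam := ⨅ b : ℕ, lambda2 (∑ i ∈ Finset.Ico (b * L) ((b + 1) * L), S.Lbar i)
  have hlam : 0 ≤ lam := Real.iInf_nonneg fun b => lambda2_nonneg <|
    Matrix.posSemidef_sum _ fun i _ => S.posSemidef_Lbar i
  set f : ℕ → ℝ := fun j => 1 - 2 * lam * S.alpha ((j + 1) * L)
    + S.alpha ((j + 1) * L) ^ 2 * S.B1 L C
  -- The positive part of the excess also covers the finitely many early factors, where the linear
  -- term may be larger than one.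
  set c : ℕ → ℝ := fun j => max 0 (|f j| - 1)
  have hc : ∀ j, 0 ≤ c j := fun j => le_max_left _ _
  have hsub : Tendsto (fun j => S.alpha ((j + 1) * L)) atTop (𝓝 0) :=
    (S.tendsto_alpha hs).comp <| tendsto_atTop_mono
      (fun j => (Nat.le_succ j).trans (Nat.le_mul_of_pos_right _ hL)) tendsto_id
  have hev : ∀ᶠ j in atTop, 2 * lam * S.alpha ((j + 1) * L) < 1 := by
    have := hsub.const_mul (2 * lam)
    rw [mul_zero] at this
    exact this.eventually_lt_const one_pos
  have hsum : Summable c := by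
    refine Summable.of_norm_bounded_eventually_nat
      ((S.summable_alpha_block hs hL).mul_right |S.B1 L C|) ?_
    filter_upwards [hev] with j hj
    rw [Real.norm_of_nonneg (hc j)]
    refine max_le (by positivity) ?_
    have h1 := mul_nonneg (mul_nonneg zero_le_two hlam) (S.alpha_pos ((j + 1) * L)).le
    have h2 : |f j| ≤ |1 - 2 * lam * S.alpha ((j + 1) * L)|
        + |S.alpha ((j + 1) * L) ^ 2 * S.B1 L C| := abs_add_le _ _
    rw [abs_mul (S.alpha ((j + 1) * L) ^ 2), abs_of_nonneg (sq_nonneg (S.alpha _)),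
      abs_of_pos (a := 1 - 2 * lam * S.alpha ((j + 1) * L)) (by linarith)] at h2
    linarith
  refine ⟨Real.exp (∑' j, c j), (Real.exp_pos _).le, fun l m => ?_⟩
  refine abs_prod_Ico_le (f := f) hc hsum (fun j => ?_) l m
  have := le_max_right 0 (|f j| - 1)
  change |f j| ≤ 1 + max 0 (|f j| - 1)
  linarith

theorem sum_alpha_le {hs : S.StepSizeCondition} (s : Finset ℕ) :
    ∑ i ∈ s, S.alpha i ^ 2 ≤ ∑' t, S.alpha t ^ 2 :=
  hs.sum_sq.sum_le_tsum _ fun _ _ => sq_nonneg _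

/-- The expression over which `Mbar2` takes its supremum, at the first block, is a lower bound. -/
theorem le_Mbar2 (hs : S.StepSizeCondition) {L : ℕ} (hL : 0 < L) (C : ℝ) (k : ℕ) :
    (S.CL + S.CM1) * (S.Phi3 0 k * ∑ i, S.x0 i ^ 2
      + ∑ i ∈ Finset.Ico 0 k, S.alpha i ^ 2 * S.CM2 * S.Phi3 i k) + S.CM2 ≤ S.Mbar2 L C := by
  obtain ⟨D3, hD3, h3⟩ := S.Phi3_le hs
  obtain ⟨D2, hD2, h2⟩ := S.abs_Phi2_le hs hL C
  set T := ∑' t, S.alpha t ^ 2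
  have hT : 0 ≤ T := tsum_nonneg fun _ => sq_nonneg _
  have hM := S.CM2_nonneg
  have hX : 0 ≤ ∑ i, S.x0 i ^ 2 := Finset.sum_nonneg fun _ _ => sq_nonneg _
  have hsum : ∀ (s : Finset ℕ) (k : ℕ),
      ∑ i ∈ s, S.alpha i ^ 2 * S.CM2 * S.Phi3 i k ≤ T * S.CM2 * D3 := by
    intro s k
    refine (Finset.sum_le_sum fun i _ => mul_le_mul_of_nonneg_left (h3 i k)
      (mul_nonneg (sq_nonneg _) hM)).trans ?_
    rw [← Finset.sum_mul, ← Finset.sum_mul]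
    have := S.sum_alpha_le (hs := hs) s
    gcongr
  have hsum0 : ∀ (s : Finset ℕ) (k : ℕ),
      0 ≤ ∑ i ∈ s, S.alpha i ^ 2 * S.CM2 * S.Phi3 i k := fun s k =>
    Finset.sum_nonneg fun i _ => mul_nonneg (mul_nonneg (sq_nonneg _) hM) (S.Phi3_nonneg _ _)
  -- The real supremum of an unbounded set is `0`, so a lower bound by one entry requires all
  -- entries to be bounded.
  have hbdd : BddAbove (Set.range fun m : ℕ =>
      ((⨆ k₀ : ℕ, S.Phi3 (m * L) (k₀ + m * L)) *
          (S.Phi2 L C 0 m * ∑ i, S.x0 i ^ 2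
            + ∑ l ∈ Finset.range m, S.Phi2 L C l m *
                ∑ i ∈ Finset.Ico (l * L) ((l + 1) * L),
                  S.alpha i ^ 2 * S.CM2 * S.Phi3 i (m * L))
        + ⨆ k₀ : ℕ, ∑ i ∈ Finset.Ico (m * L) (k₀ + m * L),
            S.alpha i ^ 2 * S.CM2 * S.Phi3 i (k₀ + m * L))) := by
    refine ⟨D3 * (D2 * ∑ i, S.x0 i ^ 2 + D2 * (T * S.CM2 * D3)) + T * S.CM2 * D3, ?_⟩
    rintro _ ⟨m, rfl⟩
    refine add_le_add ?_ (ciSup_le fun k₀ => hsum _ _)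
    have hsup0 : 0 ≤ ⨆ k₀ : ℕ, S.Phi3 (m * L) (k₀ + m * L) :=
      Real.iSup_nonneg fun k₀ => S.Phi3_nonneg _ _
    have hsup : ⨆ k₀ : ℕ, S.Phi3 (m * L) (k₀ + m * L) ≤ D3 := ciSup_le fun k₀ => h3 _ _
    have hin : S.Phi2 L C 0 m * ∑ i, S.x0 i ^ 2
            + ∑ l ∈ Finset.range m, S.Phi2 L C l m *
                ∑ i ∈ Finset.Ico (l * L) ((l + 1) * L),
                  S.alpha i ^ 2 * S.CM2 * S.Phi3 i (m * L)
          ≤ D2 * ∑ i, S.x0 i ^ 2 + D2 * (T * S.CM2 * D3) := by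
      refine add_le_add (mul_le_mul_of_nonneg_right ((le_abs_self _).trans (h2 _ _)) hX) ?_
      refine (Finset.sum_le_sum fun l _ => mul_le_mul_of_nonneg_right
        ((le_abs_self _).trans (h2 l m)) (hsum0 _ _)).trans ?_
      rw [← Finset.mul_sum]
      refine mul_le_mul_of_nonneg_left ?_ hD2
      -- Blocks are disjoint, so the double sum is a single sum over a finite set of times.
      rw [← Finset.sum_biUnion]
      · exact hsum _ _
      · intro a _ b _ hab
        rw [Function.onFun, Finset.disjoint_left]
        intro t ha hb
        rw [Finset.mem_Ico] at ha hb
        rcases lt_or_gt_of_ne hab with h | h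
        · have := Nat.mul_le_mul_right L (Nat.succ_le_of_lt h)
          simp only [Nat.succ_eq_add_one] at this
          omega
        · have := Nat.mul_le_mul_right L (Nat.succ_le_of_lt h)
          simp only [Nat.succ_eq_add_one] at this
          omega
    refine (mul_le_mul_of_nonneg_left hin hsup0).trans (mul_le_mul_of_nonneg_right hsup ?_)
    positivity
  have h0 := le_ciSup hbdd 0
  have hb3 : BddAbove (Set.range fun k₀ => S.Phi3 0 k₀) := ⟨D3, by rintro _ ⟨k, rfl⟩; exact h3 _ _⟩
  have hbs : BddAbove (Set.range fun k₀ => ∑ i ∈ Finset.Ico 0 k₀,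
      S.alpha i ^ 2 * S.CM2 * S.Phi3 i k₀) := ⟨T * S.CM2 * D3, by rintro _ ⟨k, rfl⟩; exact hsum _ _⟩
  -- At `m = 0` the product `Phi2` and the sum over earlier blocks are empty; the two suprema over
  -- `k₀` are then evaluated at the same `k`.
  simp only [zero_mul, add_zero, Finset.range_zero, Finset.sum_empty] at h0
  rw [show S.Phi2 L C 0 0 = 1 by simp [Phi2], one_mul] at h0
  unfold Mbar2
  refine add_le_add (mul_le_mul_of_nonneg_left (le_trans ?_ h0)
    (add_nonneg S.CL_nonneg S.CM1_nonneg)) le_rfl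
  exact add_le_add (mul_le_mul_of_nonneg_right (le_ciSup hb3 k) hX) (le_ciSup hbs k)

end System

end OTA

/-! ### Real recursions, Poincaré inequality, step-size ratios. -/

namespace OTA

/-- Subtracting the partial sums of `b` makes the sequence antitone, and it stays bounded below. -/
theorem exists_tendsto_of_le_add {u b : ℕ → ℝ} (hu : ∀ m, 0 ≤ u m) (hb : ∀ m, 0 ≤ b m)
    (hs : Summable b) (h : ∀ m, u (m + 1) ≤ u m + b m) : ∃ ℓ, Tendsto u atTop (𝓝 ℓ) := by
  set v : ℕ → ℝ := fun m => u m - ∑ j ∈ Finset.range m, b j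
  have hv : Antitone v := antitone_nat_of_succ_le fun m => by
    simp only [v, Finset.sum_range_succ]
    linarith [h m]
  have hbdd : BddBelow (Set.range v) := by
    refine ⟨-∑' j, b j, ?_⟩
    rintro _ ⟨m, rfl⟩
    have := hs.sum_le_tsum (Finset.range m) fun j _ => hb j
    simp only [v]
    linarith [hu m]
  refine ⟨_, ((tendsto_atTop_ciInf hv hbdd).add hs.hasSum.tendsto_sum_nat).congr fun m => ?_⟩
  simp [v]

/-- A limit exists by the preceding lemma. Were it positive, the telescoped losses `∑ a u` would
diverge, although they are bounded by `u 0 + ∑ b`. -/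
theorem tendsto_zero_of_le_sub_mul_add {u a b : ℕ → ℝ} (hu : ∀ m, 0 ≤ u m) (ha : ∀ m, 0 ≤ a m)
    (hb : ∀ m, 0 ≤ b m) (hs : Summable b)
    (hinf : Tendsto (fun m => ∑ j ∈ Finset.range m, a j) atTop atTop)
    (h : ∀ m, u (m + 1) ≤ u m - a m * u m + b m) : Tendsto u atTop (𝓝 0) := by
  obtain ⟨ℓ, hℓ⟩ := exists_tendsto_of_le_add hu hb hs fun m => by
    have := mul_nonneg (ha m) (hu m)
    linarith [h m]
  have hℓ0 : 0 ≤ ℓ := ge_of_tendsto' hℓ hu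
  rcases hℓ0.eq_or_lt with rfl | hpos
  · exact hℓ
  exfalso
  have hsum : ∀ m, u m + ∑ j ∈ Finset.range m, a j * u j ≤ u 0 + ∑ j ∈ Finset.range m, b j := by
    intro m
    induction m with
    | zero => simp
    | succ m ih =>
      rw [Finset.sum_range_succ, Finset.sum_range_succ]
      linarith [h m]
  obtain ⟨m₀, hm₀⟩ := eventually_atTop.1 (hℓ.eventually_const_lt (half_lt_self hpos))
  have hlow : ∀ m ≥ m₀, ℓ / 2 * (∑ j ∈ Finset.range m, a j - ∑ j ∈ Finset.range m₀, a j)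
      ≤ ∑ j ∈ Finset.range m, a j * u j := by
    intro m hm
    rw [← Finset.sum_Ico_eq_sub _ hm, Finset.mul_sum]
    refine (Finset.sum_le_sum fun j hj => ?_).trans (Finset.sum_le_sum_of_subset_of_nonneg
      (s := Finset.Ico m₀ m) (fun j hj => ?_) fun j _ _ => mul_nonneg (ha j) (hu j))
    · rw [mul_comm]
      exact mul_le_mul_of_nonneg_left (hm₀ j (Finset.mem_Ico.1 hj).1).le (ha j)
    · exact Finset.mem_range.2 (Finset.mem_Ico.1 hj).2
  have htend : Tendsto (fun m => ℓ / 2 * (∑ j ∈ Finset.range m, a j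
      - ∑ j ∈ Finset.range m₀, a j)) atTop atTop :=
    (tendsto_atTop_add_const_right _ _ hinf).const_mul_atTop (half_pos hpos)
  obtain ⟨m, hm, hbig⟩ := ((eventually_ge_atTop m₀).and
    (htend.eventually_gt_atTop (u 0 + ∑' j, b j))).exists
  have h1 := hs.sum_le_tsum (Finset.range m) fun j _ => hb j
  linarith [hlow m hm, hsum m, hu m]

/-- By monotonicity each block sum is at most `L` times its first term. Dropping the first `L` terms
aligns the blocks with the indices `(m + 1) * L`. -/
theorem tendsto_sum_block {a : ℕ → ℝ} (ha : Antitone a) (L : ℕ) (hL : 0 < L)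
    (hinf : Tendsto (fun K => ∑ k ∈ Finset.range K, a k) atTop atTop) :
    Tendsto (fun M => ∑ m ∈ Finset.range M, a ((m + 1) * L)) atTop atTop := by
  have h1 : ∀ M, ∑ k ∈ Finset.range (M * L), a (L + k) ≤ L * ∑ m ∈ Finset.range M, a ((m + 1) * L) := by
    intro M
    induction M with
    | zero => simp
    | succ M ih =>
      rw [Nat.succ_mul, Finset.sum_range_add, Finset.sum_range_succ, mul_add]
      refine add_le_add ih ?_
      have : ∀ r ∈ Finset.range L, a (L + (M * L + r)) ≤ a ((M + 1) * L) := fun r _ =>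
        ha (by rw [Nat.succ_mul]; omega)
      simpa using Finset.sum_le_card_nsmul _ _ _ this
  have h2 : Tendsto (fun K => ∑ k ∈ Finset.range K, a (L + k)) atTop atTop := by
    have h3 := tendsto_atTop_add_const_right _ (-∑ k ∈ Finset.range L, a k)
      (hinf.comp (tendsto_add_atTop_nat L))
    refine h3.congr fun K => ?_
    simp only [Function.comp]
    rw [add_comm K L, Finset.sum_range_add]
    ring
  have h4 : Tendsto (fun M : ℕ => M * L) atTop atTop :=
    tendsto_atTop_mono (fun M => Nat.le_mul_of_pos_right M hL) tendsto_id
  have hL' : (0 : ℝ) < L := by exact_mod_cast hL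
  exact (tendsto_const_mul_atTop_of_pos hL').1 (tendsto_atTop_mono h1 (h2.comp h4))

/-- The mean of a vector. -/
noncomputable def avg {N : ℕ} (x : Fin N → ℝ) : ℝ := (1 / (N : ℝ)) * ∑ i, x i

theorem natCast_mul_avg {N : ℕ} (hN : 0 < N) (x : Fin N → ℝ) : (N : ℝ) * avg x = ∑ i, x i := by
  have : (N : ℝ) ≠ 0 := by exact_mod_cast hN.ne'
  rw [avg]
  field_simp

theorem sum_sub_avg_sq {N : ℕ} (hN : 0 < N) (x : Fin N → ℝ) :
    ∑ i, (x i - avg x) ^ 2 = ∑ i, x i ^ 2 - N * avg x ^ 2 := by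
  have h := natCast_mul_avg hN x
  have : ∀ i, (x i - avg x) ^ 2 = x i ^ 2 - 2 * avg x * x i + avg x ^ 2 := fun i => by ring
  simp only [this, Finset.sum_add_distrib, Finset.sum_sub_distrib, ← Finset.mul_sum, ← h,
    Finset.sum_const, Finset.card_univ, Fintype.card_fin, nsmul_eq_mul]
  ring

theorem avg_sq_le {N : ℕ} (hN : 0 < N) (x : Fin N → ℝ) : avg x ^ 2 ≤ (∑ i, x i ^ 2) / N := by
  have h0 : (0 : ℝ) < N := by exact_mod_cast hN
  have h1 := sum_sub_avg_sq hN x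
  have h2 : 0 ≤ ∑ i, (x i - avg x) ^ 2 := Finset.sum_nonneg fun i _ => sq_nonneg _
  rw [le_div_iff₀ h0]
  linarith

theorem abs_sub_le_length_mul {V : Type*} {H : SimpleGraph V} {x : V → ℝ} {μ : ℝ}
    (hadj : ∀ i j, H.Adj i j → |x i - x j| ≤ μ) {u v : V} (p : H.Walk u v) :
    |x u - x v| ≤ p.length * μ := by
  induction p with
  | nil => simp
  | cons hab p ih =>
    rw [SimpleGraph.Walk.length_cons]
    push_cast
    have := hadj _ _ hab
    have := abs_sub_le (x _) (x _) (x _) |>.trans (add_le_add (hadj _ _ hab) ih)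
    linarith

/-- Poincaré inequality on a connected graph. -/
theorem sum_sub_avg_sq_le_of_connected {N : ℕ} {H : SimpleGraph (Fin N)} (hH : H.Connected)
    {x : Fin N → ℝ} {D : ℝ} (hD : 0 ≤ D) (hadj : ∀ i j, H.Adj i j → (x i - x j) ^ 2 ≤ D) :
    ∑ i, (x i - avg x) ^ 2 ≤ N ^ 3 * D := by
  have hne := hH.nonempty
  have hN : 0 < N := Fin.pos hne.some
  have hN' : (0 : ℝ) < N := by exact_mod_cast hN
  have h1 : ∀ i j, |x i - x j| ≤ N * √D := by
    intro i j
    -- A path visits each vertex once, so it has fewer than `N` edges, each contributing at most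
    -- `√D`.
    obtain ⟨p, hp⟩ := (hH.preconnected i j).exists_isPath
    refine (abs_sub_le_length_mul (fun a b hab => Real.abs_le_sqrt (hadj a b hab)) p).trans ?_
    refine mul_le_mul_of_nonneg_right ?_ (Real.sqrt_nonneg _)
    have := hp.length_lt
    rw [Fintype.card_fin] at this
    exact_mod_cast this.le
  have h2 : ∀ i, (x i - avg x) ^ 2 ≤ N ^ 2 * D := by
    intro i
    have h3 : N * (x i - avg x) = ∑ j, (x i - x j) := by
      rw [Finset.sum_sub_distrib, ← natCast_mul_avg hN x]
      simp
      ring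
    have h4 : |N * (x i - avg x)| ≤ N * (N * √D) := by
      rw [h3]
      refine (Finset.abs_sum_le_sum_abs _ _).trans ?_
      simpa using Finset.sum_le_card_nsmul Finset.univ (fun j => |x i - x j|) _ fun j _ => h1 i j
    rw [abs_mul, abs_of_pos hN'] at h4
    have h5 := le_of_mul_le_mul_left h4 hN'
    have h6 := pow_le_pow_left₀ (abs_nonneg _) h5 2
    rwa [sq_abs, mul_pow, Real.sq_sqrt hD] at h6
  refine (Finset.sum_le_sum fun i _ => h2 i).trans_eq ?_
  simp
  ring

namespace System

variable {N : ℕ} (S : System N)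

/-- The total weight of all potential links. -/
noncomputable def totalWeight : ℝ := ∑ i, ∑ j, S.rho * S.q i j * S.Lam i j

theorem weight_nonneg (i j : Fin N) : 0 ≤ S.rho * S.q i j * S.Lam i j :=
  mul_nonneg (mul_nonneg S.rho_pos.le (S.q_nonneg i j)) (S.Lam_nonneg i j)

theorem abar_le_weight (k : ℕ) (i j : Fin N) : S.abar k i j ≤ S.rho * S.q i j * S.Lam i j := by
  unfold abar
  split_ifs
  · rfl
  · exact S.weight_nonneg i j

theorem totalWeight_nonneg : 0 ≤ S.totalWeight :=
  Finset.sum_nonneg fun i _ => Finset.sum_nonneg fun j _ => S.weight_nonneg i j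

theorem dirichlet_le (k : ℕ) (x : Fin N → ℝ) :
    S.dirichlet k x ≤ 4 * S.totalWeight * ∑ i, x i ^ 2 := by
  have h : ∀ i j, S.abar k i j * (x i - x j) ^ 2
      ≤ S.rho * S.q i j * S.Lam i j * (4 * ∑ i, x i ^ 2) := by
    intro i j
    refine mul_le_mul (S.abar_le_weight k i j) ?_ (sq_nonneg _) (S.weight_nonneg i j)
    have h1 := Finset.single_le_sum (f := fun i => x i ^ 2) (fun i _ => sq_nonneg _)
      (Finset.mem_univ i)
    have h2 := Finset.single_le_sum (f := fun i => x i ^ 2) (fun i _ => sq_nonneg _)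
      (Finset.mem_univ j)
    nlinarith [sq_nonneg (x i + x j)]
  refine (Finset.sum_le_sum fun i _ => Finset.sum_le_sum fun j _ => h i j).trans_eq ?_
  simp only [← Finset.sum_mul, totalWeight]
  ring

/-- Cauchy–Schwarz with the weights of a row, whose sum is at most the total weight. -/
theorem sum_lap_sq_le (k : ℕ) (x : Fin N → ℝ) :
    ∑ i, S.lap k x i ^ 2 ≤ 4 * S.totalWeight ^ 2 * ∑ i, x i ^ 2 := by
  have h : ∀ i, S.lap k x i ^ 2 ≤ S.totalWeight * ∑ j, S.abar k i j * (x i - x j) ^ 2 := by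
    intro i
    have h1 := Finset.sum_sq_le_sum_mul_sum_of_sq_le_mul Finset.univ
      (r := fun j => S.abar k i j * (x i - x j)) (f := S.abar k i)
      (g := fun j => S.abar k i j * (x i - x j) ^ 2) (fun j _ => S.abar_nonneg k i j)
      (fun j _ => mul_nonneg (S.abar_nonneg k i j) (sq_nonneg _)) (fun j _ => by ring_nf; rfl)
    refine h1.trans (mul_le_mul_of_nonneg_right ?_ (Finset.sum_nonneg fun j _ =>
      mul_nonneg (S.abar_nonneg k i j) (sq_nonneg _)))
    refine (Finset.sum_le_sum fun j _ => S.abar_le_weight k i j).trans ?_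
    exact Finset.single_le_sum (f := fun i => ∑ j, S.rho * S.q i j * S.Lam i j)
      (fun i _ => Finset.sum_nonneg fun j _ => S.weight_nonneg i j) (Finset.mem_univ i)
  refine (Finset.sum_le_sum fun i _ => h i).trans ?_
  rw [← Finset.mul_sum]
  refine (mul_le_mul_of_nonneg_left (S.dirichlet_le k x) S.totalWeight_nonneg).trans_eq ?_
  ring

/-- This replaces the Dirichlet form of the current state by that of the state at the start of a
block, at the price of a factor `1/2` and of the displacement. -/
theorem half_dirichlet_sub_le (k : ℕ) (x y : Fin N → ℝ) :
    S.dirichlet k x / 2 - S.dirichlet k (fun i => y i - x i) ≤ S.dirichlet k y := by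
  have h : S.dirichlet k x ≤ 2 * S.dirichlet k y + 2 * S.dirichlet k (fun i => y i - x i) := by
    simp only [dirichlet, Finset.mul_sum, ← Finset.sum_add_distrib]
    refine Finset.sum_le_sum fun i _ => Finset.sum_le_sum fun j _ => ?_
    have h1 := S.abar_nonneg k i j
    have h2 : (x i - x j) ^ 2 ≤ 2 * (y i - y j) ^ 2 + 2 * (y i - x i - (y j - x j)) ^ 2 := by
      nlinarith [sq_nonneg ((y i - y j) + (y i - x i - (y j - x j)))]
    nlinarith [mul_le_mul_of_nonneg_left h2 h1]
  linarith

/-- There are infinitely many times but finitely many pairs: the least weight among pairs with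
nondegenerate channels serves all topologies. -/
theorem exists_weight_lower_bound :
    ∃ ε > 0, ∀ k i j, (S.G k).Adj i j → ε ≤ S.abar k i j := by
  classical
  set s : Finset (Fin N × Fin N) := Finset.univ.filter fun p => 0 < S.Lam p.1 p.2
  have hmem : ∀ k i j, (S.G k).Adj i j → (i, j) ∈ s := fun k i j hij =>
    Finset.mem_filter.2 ⟨Finset.mem_univ _, S.Lam_pos k i j hij⟩
  rcases s.eq_empty_or_nonempty with hs | hs
  · refine ⟨1, one_pos, fun k i j hij => ?_⟩
    have := hmem k i j hij
    rw [hs] at this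
    exact absurd this (Finset.notMem_empty _)
  · obtain ⟨p, hp, hmin⟩ := s.exists_min_image (fun p => S.rho * S.q p.1 p.2 * S.Lam p.1 p.2) hs
    refine ⟨S.rho * S.q p.1 p.2 * S.Lam p.1 p.2, ?_, fun k i j hij => ?_⟩
    · exact mul_pos (mul_pos S.rho_pos (S.q_pos _ _)) (Finset.mem_filter.1 hp).2
    · rw [abar, if_pos hij]
      exact hmin (i, j) (hmem k i j hij)

/-- The Dirichlet forms of `L` consecutive topologies together control the deviation from the
mean. -/
theorem exists_poincare {L : ℕ} (hconn : S.JointlyConnected L) :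
    ∃ κ > 0, ∀ (s : ℕ) (x : Fin N → ℝ),
      κ * ∑ i, (x i - avg x) ^ 2 ≤ ∑ t ∈ Finset.Ico s (s + L), S.dirichlet t x := by
  obtain ⟨ε, hε, hw⟩ := S.exists_weight_lower_bound
  have hN : 0 < N := Fin.pos (hconn.2 0).nonempty.some
  have hN' : (0 : ℝ) < N := by exact_mod_cast hN
  refine ⟨ε / N ^ 3, by positivity, fun s x => ?_⟩
  set D := ∑ t ∈ Finset.Ico s (s + L), S.dirichlet t x with hD
  have hD0 : 0 ≤ D := Finset.sum_nonneg fun t _ => S.dirichlet_nonneg t x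
  have h := sum_sub_avg_sq_le_of_connected (hconn.2 s) (x := x) (D := D / ε)
    (div_nonneg hD0 hε.le) fun i j hij => ?_
  · rw [div_mul_eq_mul_div, div_le_iff₀ (by positivity)]
    have h2 := mul_le_mul_of_nonneg_left h hε.le
    refine h2.trans_eq ?_
    field_simp
  · simp only [SimpleGraph.iSup_adj] at hij
    obtain ⟨t, ht, hadj⟩ := hij
    rw [le_div_iff₀ hε]
    have h1 : S.dirichlet t x ≤ D := Finset.single_le_sum (f := fun t => S.dirichlet t x)
      (fun t _ => S.dirichlet_nonneg t x) (Finset.mem_Ico.2 ht)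
    have h2 : S.abar t i j * (x i - x j) ^ 2 ≤ S.dirichlet t x := by
      refine le_trans ?_ (Finset.single_le_sum (f := fun i => ∑ j, S.abar t i j * (x i - x j) ^ 2)
        (fun i _ => Finset.sum_nonneg fun j _ => mul_nonneg (S.abar_nonneg t i j) (sq_nonneg _))
        (Finset.mem_univ i))
      exact Finset.single_le_sum (f := fun j => S.abar t i j * (x i - x j) ^ 2)
        (fun j _ => mul_nonneg (S.abar_nonneg t i j) (sq_nonneg _)) (Finset.mem_univ j)
    have h3 := mul_le_mul_of_nonneg_right (hw t i j hadj) (sq_nonneg (x i - x j))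
    linarith

/-- Bounded ratios of consecutive step sizes give a ratio bound over blocks. -/
theorem exists_isRatioBound (hs : S.StepSizeCondition) (hd : S.StepSizeDecay) (L : ℕ)
    (hL : 0 < L) : ∃ C, S.IsRatioBound L C := by
  -- A limsup below `⊤` leaves room for a real `b` that eventually exceeds the ratios.
  obtain ⟨b, hb1, hb2⟩ := EReal.lt_iff_exists_real_btwn.1 hd.ratio
  have hev := eventually_lt_of_limsup_lt hb1
  simp only [EReal.coe_lt_coe_iff] at hev
  have hone := (S.tendsto_alpha hs).eventually_le_const one_pos
  obtain ⟨k₀, hk₀⟩ := eventually_atTop.1 (hev.and hone)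
  have hstep : ∀ k ≥ k₀, S.alpha k ≤ b * S.alpha (k + 1) := fun k hk =>
    ((div_lt_iff₀ (S.alpha_pos _)).1 (hk₀ k hk).1).le
  have hb : 0 ≤ b := by
    have h1 := hstep k₀ le_rfl
    have h2 := S.alpha_pos k₀
    have h3 := S.alpha_pos (k₀ + 1)
    by_contra hneg
    nlinarith
  have hiter : ∀ r, ∀ k ≥ k₀, S.alpha k ≤ b ^ r * S.alpha (k + r) := by
    intro r
    induction r with
    | zero => simp
    | succ r ih =>
      intro k hk
      refine (ih k hk).trans ?_
      rw [pow_succ, mul_assoc]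
      exact mul_le_mul_of_nonneg_left (hstep (k + r) (by omega)) (pow_nonneg hb r)
  -- `L` consecutive steps cost `b ^ L`; the extra `1` only makes `m₀` positive.
  refine ⟨b ^ L, k₀ + 1, Nat.succ_pos _, fun m hm => ?_⟩
  have hmL : k₀ ≤ m * L := (by omega : k₀ ≤ m).trans (Nat.le_mul_of_pos_right m hL)
  refine ⟨?_, (hk₀ _ hmL).2⟩
  rw [Nat.succ_mul]
  exact hiter L _ hmL

end System

end OTA

/-! ### Recursions for the second moments and for the mean of the states. -/

namespace OTA.System

variable {N : ℕ} (S : System N) {Ω : Type*} (γ : ℕ → Fin N → Ω → ℝ)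
  (h : ℕ → Fin N → Fin N → Ω → ℂ) (n : ℕ → Fin N → Ω → ℂ)

/-- The mean of the states. -/
noncomputable def meanState (k : ℕ) (ω : Ω) : ℝ := avg fun i => S.state γ h n k i ω

/-- The mean of the disturbances. -/
noncomputable def meanDisturbance (k : ℕ) (ω : Ω) : ℝ := avg fun i => S.disturbance γ h n k i ω

theorem meanState_succ (k : ℕ) (ω : Ω) :
    S.meanState γ h n (k + 1) ω
      = S.meanState γ h n k ω + S.alpha k * S.meanDisturbance γ h n k ω := by
  have h1 := S.sum_lap k fun i => S.state γ h n k i ω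
  simp only [meanState, meanDisturbance, avg, S.state_succ, Finset.sum_add_distrib,
    Finset.sum_sub_distrib, ← Finset.mul_sum]
  simp only [lap] at h1
  rw [h1]
  ring

theorem measurable_meanState_inputSigma (k : ℕ) :
    Measurable[inputSigma γ h n {c | c.time < k}] (S.meanState γ h n k) := by
  have h1 := S.measurable_state_inputSigma γ h n k
  let := inputSigma γ h n {c | c.time < k}
  have h2 := fun i => measurable_pi_iff.1 h1 i
  unfold meanState avg
  exact (Finset.measurable_fun_sum _ fun i _ => h2 i).const_mul _

variable [MeasurableSpace Ω] (P : Measure Ω)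

/-- The second moment of the states. -/
noncomputable def secondMoment (k : ℕ) : ℝ := ∫ ω, ∑ i, S.state γ h n k i ω ^ 2 ∂P

/-- The second moment of the disturbances. -/
noncomputable def disturbanceMoment (k : ℕ) : ℝ := ∫ ω, ∑ i, S.disturbance γ h n k i ω ^ 2 ∂P

/-- The mean squared deviation of the states from their mean. -/
noncomputable def deviation (k : ℕ) : ℝ :=
  ∫ ω, ∑ i, (S.state γ h n k i ω - S.meanState γ h n k ω) ^ 2 ∂P

namespace IsModel

variable {S P γ h n}

theorem secondMoment_nonneg (k : ℕ) : 0 ≤ S.secondMoment γ h n P k :=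
  integral_nonneg fun _ => Finset.sum_nonneg fun _ _ => sq_nonneg _

theorem disturbanceMoment_nonneg (k : ℕ) : 0 ≤ S.disturbanceMoment γ h n P k :=
  integral_nonneg fun _ => Finset.sum_nonneg fun _ _ => sq_nonneg _

theorem integrable_dirichlet_of_memLp {x : Fin N → Ω → ℝ} (hx : ∀ i, MemLp (x i) 2 P) (k : ℕ) :
    Integrable (fun ω => S.dirichlet k fun i => x i ω) P :=
  integrable_finsetSum _ fun i _ => integrable_finsetSum _ fun j _ =>
    (((hx i).sub (hx j)).integrable_sq).const_mul _

variable [IsProbabilityMeasure P]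

theorem memLp_lap (hm : S.IsModel P γ h n) (k : ℕ) (i : Fin N) :
    MemLp (fun ω => S.lap k (fun j => S.state γ h n k j ω) i) 2 P :=
  memLp_finsetSum _ fun j _ => ((hm.memLp_state k i).sub (hm.memLp_state k j)).const_mul _

theorem integrable_sum_sq (hm : S.IsModel P γ h n) (k : ℕ) :
    Integrable (fun ω => ∑ i, S.state γ h n k i ω ^ 2) P :=
  integrable_finsetSum _ fun i _ => (hm.memLp_state k i).integrable_sq

theorem integrable_sum_disturbance_sq (hm : S.IsModel P γ h n) (k : ℕ) :
    Integrable (fun ω => ∑ i, S.disturbance γ h n k i ω ^ 2) P :=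
  integrable_finsetSum _ fun i _ => (hm.memLp_disturbance k i).integrable_sq

/-- Pythagoras: the averaged state is a function of the past, hence orthogonal to the disturbance.
-/
theorem secondMoment_succ (hm : S.IsModel P γ h n) (k : ℕ) :
    S.secondMoment γ h n P (k + 1)
      = ∫ ω, ∑ i, (S.state γ h n k i ω
          - S.alpha k * S.lap k (fun j => S.state γ h n k j ω) i) ^ 2 ∂P
        + S.alpha k ^ 2 * S.disturbanceMoment γ h n P k := by
  have hy : ∀ i, MemLp (fun ω => S.state γ h n k i ω
      - S.alpha k * S.lap k (fun j => S.state γ h n k j ω) i) 2 P := fun i =>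
    (hm.memLp_state k i).sub ((hm.memLp_lap k i).const_mul _)
  have hpast : ∀ i, Measurable[inputSigma γ h n {c | c.time < k}] (fun ω => S.state γ h n k i ω
      - S.alpha k * S.lap k (fun j => S.state γ h n k j ω) i) := by
    intro i
    have h1 := S.measurable_state_inputSigma γ h n k
    let := inputSigma γ h n {c | c.time < k}
    have h2 := fun i => measurable_pi_iff.1 h1 i
    unfold lap
    exact (h2 i).sub ((Finset.measurable_fun_sum _ fun j _ =>
      ((h2 i).sub (h2 j)).const_mul _).const_mul _)
  set y := fun (i : Fin N) (ω : Ω) => S.state γ h n k i ω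
      - S.alpha k * S.lap k (fun j => S.state γ h n k j ω) i with hydef
  have hw := hm.memLp_disturbance k
  have hcross : ∀ i, ∫ ω, y i ω * S.disturbance γ h n k i ω ∂P = 0 := fun i =>
    hm.integral_past_mul_disturbance k i (hpast i) (hy i)
  have e : ∀ ω, ∑ i, S.state γ h n (k + 1) i ω ^ 2 = ∑ i, y i ω ^ 2
      + (2 * S.alpha k * ∑ i, y i ω * S.disturbance γ h n k i ω
        + S.alpha k ^ 2 * ∑ i, S.disturbance γ h n k i ω ^ 2) := by
    intro ω
    rw [Finset.mul_sum, Finset.mul_sum, ← Finset.sum_add_distrib, ← Finset.sum_add_distrib]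
    refine Finset.sum_congr rfl fun i _ => ?_
    rw [S.state_succ]
    simp only [hydef, lap]
    ring
  have i1 : Integrable (fun ω => ∑ i, y i ω ^ 2) P :=
    integrable_finsetSum _ fun i _ => (hy i).integrable_sq
  have i2' : ∀ i, Integrable (fun ω => y i ω * S.disturbance γ h n k i ω) P := fun i =>
    (hy i).integrable_mul (hw i)
  have i2 : Integrable (fun ω => ∑ i, y i ω * S.disturbance γ h n k i ω) P :=
    integrable_finsetSum _ fun i _ => i2' i
  have i3 := hm.integrable_sum_disturbance_sq k
  unfold secondMoment disturbanceMoment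
  simp only [e]
  rw [integral_add i1 ((i2.const_mul _).fun_add (i3.const_mul _)),
    integral_add (i2.const_mul _) (i3.const_mul _), integral_const_mul, integral_const_mul,
    integral_finsetSum _ fun i _ => i2' i]
  simp [hcross]
  rfl

/-- The estimate itself needs only `CL`; the nonnegative `CM1` is added to match `Mbar2`. -/
theorem disturbanceMoment_le (hm : S.IsModel P γ h n) (k : ℕ) :
    S.disturbanceMoment γ h n P k ≤ (S.CL + S.CM1) * S.secondMoment γ h n P k + S.CM2 := by
  unfold disturbanceMoment
  rw [integral_finsetSum _ fun i _ => (hm.memLp_disturbance k i).integrable_sq]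
  refine (Finset.sum_le_sum fun i _ => hm.integral_disturbance_sq_le k i).trans ?_
  rw [Finset.sum_add_distrib, ← Finset.mul_sum, mul_comm]
  refine add_le_add (mul_le_mul_of_nonneg_right ?_ (secondMoment_nonneg k)) S.noise_sum_le_CM2
  exact (S.link_sum_le_CL k).trans (le_add_of_nonneg_right S.CM1_nonneg)

theorem secondMoment_succ_le (hm : S.IsModel P γ h n) (k : ℕ) :
    S.secondMoment γ h n P (k + 1)
      ≤ S.growth k * S.secondMoment γ h n P k + S.alpha k ^ 2 * S.CM2 := by
  rw [hm.secondMoment_succ]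
  have h1 : ∫ ω, ∑ i, (S.state γ h n k i ω
          - S.alpha k * S.lap k (fun j => S.state γ h n k j ω) i) ^ 2 ∂P
      ≤ norm2 (1 - S.alpha k • S.Lbar k) ^ 2 * S.secondMoment γ h n P k := by
    unfold secondMoment
    rw [← integral_const_mul]
    refine integral_mono (integrable_finsetSum _ fun i _ =>
      ((hm.memLp_state k i).sub ((hm.memLp_lap k i).const_mul _)).integrable_sq)
      ((hm.integrable_sum_sq k).const_mul _) fun ω => ?_
    have := sum_mulVec_sq_le (1 - S.alpha k • S.Lbar k) fun i => S.state γ h n k i ω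
    simp only [S.one_sub_mulVec] at this
    exact this
  have h2 := mul_le_mul_of_nonneg_left (hm.disturbanceMoment_le k) (sq_nonneg (S.alpha k))
  unfold growth
  linarith

theorem secondMoment_le (hm : S.IsModel P γ h n) (hN : 0 < N) (k : ℕ) :
    S.secondMoment γ h n P k ≤ S.Phi3 0 k * ∑ i, S.x0 i ^ 2
      + ∑ i ∈ Finset.Ico 0 k, S.alpha i ^ 2 * S.CM2 * S.Phi3 i k := by
  induction k with
  | zero => simp [secondMoment, state, Phi3]
  | succ k ih =>
    refine (hm.secondMoment_succ_le k).trans ?_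
    have h1 := mul_le_mul_of_nonneg_left ih (S.growth_nonneg k)
    have hPhi : ∀ i ≤ k, S.Phi3 i (k + 1) = S.Phi3 i k * S.growth k := fun i hi =>
      Finset.prod_Ico_succ_top hi _
    have hkk : S.Phi3 k k = 1 := by simp [Phi3]
    have h2 : ∑ i ∈ Finset.Ico 0 k, S.alpha i ^ 2 * S.CM2 * S.Phi3 i (k + 1)
        = S.growth k * ∑ i ∈ Finset.Ico 0 k, S.alpha i ^ 2 * S.CM2 * S.Phi3 i k := by
      rw [Finset.mul_sum]
      refine Finset.sum_congr rfl fun i hi => ?_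
      rw [hPhi i (Finset.mem_Ico.1 hi).2.le]
      ring
    rw [Finset.sum_Ico_succ_top (Nat.zero_le k), h2, hPhi 0 (Nat.zero_le k), hPhi k le_rfl, hkk]
    -- The newest term enters the recursion with factor `1`, but the claimed sum gives it the factor
    -- `growth k`.
    have h3 := mul_le_mul_of_nonneg_left (S.one_le_growth hN k)
      (mul_nonneg (sq_nonneg (S.alpha k)) S.CM2_nonneg)
    linarith

theorem disturbanceMoment_le_Mbar2 (hm : S.IsModel P γ h n) (hs : S.StepSizeCondition)
    (hN : 0 < N) {L : ℕ} (hL : 0 < L) (C : ℝ) (k : ℕ) :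
    S.disturbanceMoment γ h n P k ≤ S.Mbar2 L C := by
  refine (hm.disturbanceMoment_le k).trans (le_trans ?_ (S.le_Mbar2 hs hL C k))
  exact add_le_add (mul_le_mul_of_nonneg_left (hm.secondMoment_le hN k)
    (add_nonneg S.CL_nonneg S.CM1_nonneg)) le_rfl

theorem exists_moment_bounds (hm : S.IsModel P γ h n) (hs : S.StepSizeCondition) (hN : 0 < N) :
    ∃ M : ℝ, 0 ≤ M ∧ (∀ k, S.secondMoment γ h n P k ≤ M)
      ∧ ∀ k, S.disturbanceMoment γ h n P k ≤ M := by
  obtain ⟨D, hD, h3⟩ := S.Phi3_le hs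
  have hM := S.CM2_nonneg
  have hX : 0 ≤ ∑ i, S.x0 i ^ 2 := Finset.sum_nonneg fun _ _ => sq_nonneg _
  have hV : ∀ k, S.secondMoment γ h n P k
      ≤ D * ∑ i, S.x0 i ^ 2 + (∑' t, S.alpha t ^ 2) * S.CM2 * D := by
    intro k
    refine (hm.secondMoment_le hN k).trans ?_
    refine add_le_add (mul_le_mul_of_nonneg_right (h3 _ _) hX) ?_
    refine (Finset.sum_le_sum fun i _ => mul_le_mul_of_nonneg_left (h3 i k)
      (mul_nonneg (sq_nonneg _) hM)).trans ?_
    rw [← Finset.sum_mul, ← Finset.sum_mul]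
    have := S.sum_alpha_le (hs := hs) (Finset.Ico 0 k)
    gcongr
  -- The arguments of `Mbar2` are arbitrary here: the bound holds for every positive `L` and every
  -- `C`.
  refine ⟨max (D * ∑ i, S.x0 i ^ 2 + (∑' t, S.alpha t ^ 2) * S.CM2 * D) (S.Mbar2 1 1), ?_,
    fun k => (hV k).trans (le_max_left _ _),
    fun k => (hm.disturbanceMoment_le_Mbar2 hs hN one_pos 1 k).trans (le_max_right _ _)⟩
  exact ((secondMoment_nonneg 0).trans (hV 0)).trans (le_max_left _ _)

/-! ### The mean of the states -/

theorem memLp_meanState (hm : S.IsModel P γ h n) (k : ℕ) : MemLp (S.meanState γ h n k) 2 P :=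
  (memLp_finsetSum _ fun i _ => hm.memLp_state k i).const_mul _

theorem memLp_meanDisturbance (hm : S.IsModel P γ h n) (k : ℕ) :
    MemLp (S.meanDisturbance γ h n k) 2 P :=
  (memLp_finsetSum _ fun i _ => hm.memLp_disturbance k i).const_mul _

theorem integral_past_mul_meanDisturbance (hm : S.IsModel P γ h n) (k : ℕ) {φ : Ω → ℝ}
    (hφ : Measurable[inputSigma γ h n {c | c.time < k}] φ) (hL : MemLp φ 2 P) :
    ∫ ω, φ ω * S.meanDisturbance γ h n k ω ∂P = 0 := by
  have hi : ∀ i, Integrable (fun ω => φ ω * S.disturbance γ h n k i ω) P := fun i =>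
    hL.integrable_mul (hm.memLp_disturbance k i)
  have e : ∀ ω, φ ω * S.meanDisturbance γ h n k ω
      = (1 / (N : ℝ)) * ∑ i, φ ω * S.disturbance γ h n k i ω := by
    intro ω
    rw [meanDisturbance, avg, ← Finset.mul_sum]
    ring
  simp only [e]
  rw [integral_const_mul, integral_finsetSum _ fun i _ => hi i]
  simp [hm.integral_past_mul_disturbance k _ hφ hL]

theorem integral_meanDisturbance (hm : S.IsModel P γ h n) (k : ℕ) :
    ∫ ω, S.meanDisturbance γ h n k ω ∂P = 0 := by
  have := hm.integral_past_mul_meanDisturbance k (φ := fun _ => 1)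
    (@measurable_const _ _ _ (inputSigma γ h n {c | c.time < k}) _) (memLp_const 1)
  simpa using this

theorem integral_meanDisturbance_sq_le (hm : S.IsModel P γ h n) (hN : 0 < N) (k : ℕ) :
    ∫ ω, S.meanDisturbance γ h n k ω ^ 2 ∂P ≤ S.disturbanceMoment γ h n P k / N := by
  unfold disturbanceMoment
  rw [← integral_div]
  exact integral_mono (hm.memLp_meanDisturbance k).integrable_sq
    ((hm.integrable_sum_disturbance_sq k).div_const _) fun ω => avg_sq_le hN _

/-- Increments of the mean are orthogonal. -/
theorem integral_meanState_sub_sq_succ (hm : S.IsModel P γ h n) {l k : ℕ} (hlk : l ≤ k) :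
    ∫ ω, (S.meanState γ h n (k + 1) ω - S.meanState γ h n l ω) ^ 2 ∂P
      = ∫ ω, (S.meanState γ h n k ω - S.meanState γ h n l ω) ^ 2 ∂P
        + S.alpha k ^ 2 * ∫ ω, S.meanDisturbance γ h n k ω ^ 2 ∂P := by
  have hle : inputSigma γ h n {c | c.time < l} ≤ inputSigma γ h n {c | c.time < k} :=
    biSup_mono fun c hc => lt_of_lt_of_le hc hlk
  have hL : MemLp (fun ω => S.meanState γ h n k ω - S.meanState γ h n l ω) 2 P :=
    (hm.memLp_meanState k).sub (hm.memLp_meanState l)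
  have hpast : Measurable[inputSigma γ h n {c | c.time < k}]
      (fun ω => S.meanState γ h n k ω - S.meanState γ h n l ω) := by
    have h1 := S.measurable_meanState_inputSigma γ h n k
    have h2 := (S.measurable_meanState_inputSigma γ h n l).mono
      hle le_rfl
    let := inputSigma γ h n {c | c.time < k}
    exact h1.sub h2
  have h0 := hm.integral_past_mul_meanDisturbance k hpast hL
  have e : ∀ ω, (S.meanState γ h n (k + 1) ω - S.meanState γ h n l ω) ^ 2
      = (S.meanState γ h n k ω - S.meanState γ h n l ω) ^ 2
        + (2 * S.alpha k * ((S.meanState γ h n k ω - S.meanState γ h n l ω)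
            * S.meanDisturbance γ h n k ω)
          + S.alpha k ^ 2 * S.meanDisturbance γ h n k ω ^ 2) := by
    intro ω
    rw [meanState_succ]
    ring
  have i2 : Integrable (fun ω => (S.meanState γ h n k ω - S.meanState γ h n l ω)
      * S.meanDisturbance γ h n k ω) P := hL.integrable_mul (hm.memLp_meanDisturbance k)
  have i3 := (hm.memLp_meanDisturbance k).integrable_sq
  simp only [e]
  rw [integral_add hL.integrable_sq ((i2.const_mul _).fun_add (i3.const_mul _)),
    integral_add (i2.const_mul _) (i3.const_mul _), integral_const_mul, integral_const_mul, h0]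
  ring

theorem integral_meanState_sub_sq (hm : S.IsModel P γ h n) {l k : ℕ} (hlk : l ≤ k) :
    ∫ ω, (S.meanState γ h n k ω - S.meanState γ h n l ω) ^ 2 ∂P
      = ∑ t ∈ Finset.Ico l k, S.alpha t ^ 2 * ∫ ω, S.meanDisturbance γ h n t ω ^ 2 ∂P := by
  induction k, hlk using Nat.le_induction with
  | base => simp
  | succ k hk ih => rw [hm.integral_meanState_sub_sq_succ hk, ih, Finset.sum_Ico_succ_top hk]

theorem integral_meanState (hm : S.IsModel P γ h n) (k : ℕ) :
    ∫ ω, S.meanState γ h n k ω ∂P = (1 / (N : ℝ)) * ∑ i, S.x0 i := by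
  induction k with
  | zero => simp [meanState, avg, state]
  | succ k ih =>
    simp only [meanState_succ]
    rw [integral_add ((hm.memLp_meanState k).integrable (by norm_num))
      (((hm.memLp_meanDisturbance k).integrable (by norm_num)).const_mul _), ih,
      integral_const_mul, hm.integral_meanDisturbance]
    simp

end IsModel

end OTA.System

/-! ### Convergence in mean square: the Lyapunov argument and the limit of the mean. -/

namespace OTA

section LTwo

variable {Ω : Type*} [MeasurableSpace Ω] {P : Measure Ω}

theorem norm_toLp_sq {f : Ω → ℝ} (hf : MemLp f 2 P) : ‖hf.toLp f‖ ^ 2 = ∫ ω, f ω ^ 2 ∂P := by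
  rw [← real_inner_self_eq_norm_sq, L2.inner_def]
  refine integral_congr_ae ?_
  filter_upwards [hf.coeFn_toLp] with ω hω
  rw [hω, real_inner_self_eq_norm_sq, Real.norm_eq_abs, sq_abs]

theorem norm_toLp_sub_sq {f g : Ω → ℝ} (hf : MemLp f 2 P) (hg : MemLp g 2 P) :
    ‖hf.toLp f - hg.toLp g‖ ^ 2 = ∫ ω, (f ω - g ω) ^ 2 ∂P := by
  rw [← MemLp.toLp_sub, norm_toLp_sq]
  rfl

theorem sq_integral_le [IsProbabilityMeasure P] {f : Ω → ℝ} (hf : MemLp f 2 P) :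
    (∫ ω, f ω ∂P) ^ 2 ≤ ∫ ω, f ω ^ 2 ∂P := by
  have h1 := variance_nonneg f P
  rw [variance_eq_sub hf] at h1
  exact sub_nonneg.1 h1

end LTwo

namespace System.IsModel

variable {N : ℕ} {S : System N} {Ω : Type*} [MeasurableSpace Ω] {P : Measure Ω}
  {γ : ℕ → Fin N → Ω → ℝ} {h : ℕ → Fin N → Fin N → Ω → ℂ} {n : ℕ → Fin N → Ω → ℂ}

theorem deviation_nonneg (k : ℕ) : 0 ≤ S.deviation γ h n P k :=
  integral_nonneg fun _ => Finset.sum_nonneg fun _ _ => sq_nonneg _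

variable [IsProbabilityMeasure P]

theorem deviation_eq (hm : S.IsModel P γ h n) (hN : 0 < N) (k : ℕ) :
    S.deviation γ h n P k
      = S.secondMoment γ h n P k - N * ∫ ω, S.meanState γ h n k ω ^ 2 ∂P := by
  unfold deviation secondMoment
  rw [← integral_const_mul, ← integral_sub (hm.integrable_sum_sq k)
    ((hm.memLp_meanState k).integrable_sq.const_mul _)]
  exact integral_congr_ae (Eventually.of_forall fun ω => sum_sub_avg_sq hN _)

/-- The orthogonal increment can only add. The deviation is the second moment minus `N` times this
quantity, so the growth has the favourable sign. -/
theorem integral_meanState_sq_le_succ (hm : S.IsModel P γ h n) (k : ℕ) :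
    ∫ ω, S.meanState γ h n k ω ^ 2 ∂P ≤ ∫ ω, S.meanState γ h n (k + 1) ω ^ 2 ∂P := by
  have hL := hm.memLp_meanState k
  have h0 := hm.integral_past_mul_meanDisturbance k (S.measurable_meanState_inputSigma γ h n k) hL
  have i2 : Integrable (fun ω => S.meanState γ h n k ω * S.meanDisturbance γ h n k ω) P :=
    hL.integrable_mul (hm.memLp_meanDisturbance k)
  have h1 : ∫ ω, (S.meanState γ h n k ω ^ 2
      + 2 * S.alpha k * (S.meanState γ h n k ω * S.meanDisturbance γ h n k ω)) ∂P
      = ∫ ω, S.meanState γ h n k ω ^ 2 ∂P := by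
    rw [integral_add hL.integrable_sq (i2.const_mul _), integral_const_mul, h0]
    ring
  rw [← h1]
  refine integral_mono (hL.integrable_sq.add (i2.const_mul _))
    (hm.memLp_meanState (k + 1)).integrable_sq fun ω => ?_
  simp only [meanState_succ]
  nlinarith [sq_nonneg (S.alpha k * S.meanDisturbance γ h n k ω)]

/-- One step of the Lyapunov argument. -/
theorem deviation_succ_le (hm : S.IsModel P γ h n) (hN : 0 < N) {M : ℝ}
    (hV : ∀ k, S.secondMoment γ h n P k ≤ M) (hW : ∀ k, S.disturbanceMoment γ h n P k ≤ M)
    (k : ℕ) :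
    S.deviation γ h n P (k + 1) ≤ S.deviation γ h n P k
      - S.alpha k * ∫ ω, S.dirichlet k (fun i => S.state γ h n k i ω) ∂P
      + (4 * S.totalWeight ^ 2 * M + M) * S.alpha k ^ 2 := by
  have hm2 := hm.integral_meanState_sq_le_succ k
  have hN' : (0 : ℝ) < N := by exact_mod_cast hN
  have hdir := integrable_dirichlet_of_memLp (S := S) (fun i => hm.memLp_state k i) k
  have hsq := hm.integrable_sum_sq k
  have h1 : ∫ ω, ∑ i, (S.state γ h n k i ω
          - S.alpha k * S.lap k (fun j => S.state γ h n k j ω) i) ^ 2 ∂P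
      ≤ S.secondMoment γ h n P k
        - S.alpha k * ∫ ω, S.dirichlet k (fun i => S.state γ h n k i ω) ∂P
        + S.alpha k ^ 2 * (4 * S.totalWeight ^ 2) * S.secondMoment γ h n P k := by
    unfold secondMoment
    have hd : Integrable (fun ω => ∑ i, S.state γ h n k i ω ^ 2
        - S.alpha k * S.dirichlet k (fun i => S.state γ h n k i ω)) P :=
      hsq.sub (hdir.const_mul _)
    rw [← integral_const_mul, ← integral_const_mul, ← integral_sub hsq (hdir.const_mul _),
      ← integral_add hd (hsq.const_mul _)]
    refine integral_mono (integrable_finsetSum _ fun i _ =>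
      ((hm.memLp_state k i).sub ((hm.memLp_lap k i).const_mul _)).integrable_sq)
      (hd.add (hsq.const_mul _)) fun ω => ?_
    set x := fun i => S.state γ h n k i ω
    -- The cross term sums to `-2 α ⟨x, L̄ x⟩`, which is `-α` times the Dirichlet form.
    have e : ∀ i, (x i - S.alpha k * S.lap k x i) ^ 2 = x i ^ 2
        - 2 * S.alpha k * (x i * S.lap k x i) + S.alpha k ^ 2 * S.lap k x i ^ 2 := fun i => by ring
    change ∑ i, (x i - S.alpha k * S.lap k x i) ^ 2 ≤ ∑ i, x i ^ 2 - S.alpha k * S.dirichlet k x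
      + S.alpha k ^ 2 * (4 * S.totalWeight ^ 2) * ∑ i, x i ^ 2
    simp only [e, Finset.sum_add_distrib, Finset.sum_sub_distrib, ← Finset.mul_sum, S.sum_mul_lap]
    have := mul_le_mul_of_nonneg_left (S.sum_lap_sq_le k x) (sq_nonneg (S.alpha k))
    linarith
  rw [hm.deviation_eq hN, hm.deviation_eq hN, hm.secondMoment_succ]
  have h2 := mul_le_mul_of_nonneg_left (hV k)
    (by positivity : 0 ≤ S.alpha k ^ 2 * (4 * S.totalWeight ^ 2))
  have h3 := mul_le_mul_of_nonneg_left (hW k) (sq_nonneg (S.alpha k))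
  have h4 := mul_le_mul_of_nonneg_left hm2 hN'.le
  linarith

theorem deviation_add_le (hm : S.IsModel P γ h n) (hN : 0 < N) {M : ℝ}
    (hV : ∀ k, S.secondMoment γ h n P k ≤ M) (hW : ∀ k, S.disturbanceMoment γ h n P k ≤ M)
    (s r : ℕ) :
    S.deviation γ h n P (s + r) ≤ S.deviation γ h n P s
      - ∑ t ∈ Finset.Ico s (s + r),
          S.alpha t * ∫ ω, S.dirichlet t (fun i => S.state γ h n t i ω) ∂P
      + (4 * S.totalWeight ^ 2 * M + M) * ∑ t ∈ Finset.Ico s (s + r), S.alpha t ^ 2 := by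
  induction r with
  | zero => simp
  | succ r ih =>
    rw [← add_assoc, Finset.sum_Ico_succ_top (Nat.le_add_right s r),
      Finset.sum_Ico_succ_top (Nat.le_add_right s r)]
    have := hm.deviation_succ_le hN hV hW (s + r)
    linarith

/-- Within a block the states move little. -/
theorem integral_sum_state_sub_sq_le (hm : S.IsModel P γ h n)
    (hanti : ∀ k, S.alpha (k + 1) ≤ S.alpha k) {M : ℝ}
    (hV : ∀ k, S.secondMoment γ h n P k ≤ M) (hW : ∀ k, S.disturbanceMoment γ h n P k ≤ M)
    (s r : ℕ) :
    ∫ ω, ∑ i, (S.state γ h n (s + r) i ω - S.state γ h n s i ω) ^ 2 ∂P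
      ≤ r ^ 2 * (2 * (4 * S.totalWeight ^ 2 * M + M) * S.alpha s ^ 2) := by
  have hinc : ∀ k i, MemLp (fun ω => S.state γ h n (k + 1) i ω - S.state γ h n k i ω) 2 P :=
    fun k i => (hm.memLp_state (k + 1) i).sub (hm.memLp_state k i)
  have hM : 0 ≤ M := (secondMoment_nonneg 0).trans (hV 0)
  have h1 : ∀ k, ∫ ω, ∑ i, (S.state γ h n (k + 1) i ω - S.state γ h n k i ω) ^ 2 ∂P
      ≤ 2 * (4 * S.totalWeight ^ 2 * M + M) * S.alpha k ^ 2 := by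
    intro k
    have i1 := (hm.integrable_sum_sq k).const_mul (4 * S.totalWeight ^ 2)
    have i2 := hm.integrable_sum_disturbance_sq k
    have h2 : ∫ ω, ∑ i, (S.state γ h n (k + 1) i ω - S.state γ h n k i ω) ^ 2 ∂P
        ≤ 2 * S.alpha k ^ 2 * (4 * S.totalWeight ^ 2 * S.secondMoment γ h n P k
          + S.disturbanceMoment γ h n P k) := by
      unfold secondMoment disturbanceMoment
      rw [← integral_const_mul, ← integral_add i1 i2, ← integral_const_mul]
      refine integral_mono (integrable_finsetSum _ fun i _ => (hinc k i).integrable_sq)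
        ((i1.add i2).const_mul _) fun ω => ?_
      set x := fun i => S.state γ h n k i ω
      have e : ∀ i, (S.state γ h n (k + 1) i ω - S.state γ h n k i ω) ^ 2
          ≤ 2 * S.alpha k ^ 2 * (S.lap k x i ^ 2 + S.disturbance γ h n k i ω ^ 2) := by
        intro i
        have : S.state γ h n (k + 1) i ω - S.state γ h n k i ω
            = S.alpha k * (S.disturbance γ h n k i ω - S.lap k x i) := by
          rw [S.state_succ]
          simp only [lap, x]
          ring
        rw [this, mul_pow]
        have h3 : (S.disturbance γ h n k i ω - S.lap k x i) ^ 2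
            ≤ 2 * (S.lap k x i ^ 2 + S.disturbance γ h n k i ω ^ 2) := by
          nlinarith [sq_nonneg (S.disturbance γ h n k i ω + S.lap k x i)]
        nlinarith [mul_le_mul_of_nonneg_left h3 (sq_nonneg (S.alpha k))]
      refine (Finset.sum_le_sum fun i _ => e i).trans ?_
      rw [← Finset.mul_sum, Finset.sum_add_distrib]
      refine mul_le_mul_of_nonneg_left ?_ (by positivity)
      exact add_le_add (S.sum_lap_sq_le k x) le_rfl
    refine h2.trans ?_
    have h3 := mul_le_mul_of_nonneg_left (hV k)
      (by positivity : (0 : ℝ) ≤ 4 * S.totalWeight ^ 2)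
    have h4 := mul_le_mul_of_nonneg_left (add_le_add h3 (hW k))
      (by positivity : (0 : ℝ) ≤ 2 * S.alpha k ^ 2)
    linarith
  have hanti' : Antitone S.alpha := antitone_nat_of_succ_le hanti
  -- Telescoping with Cauchy–Schwarz gives one factor `r`; summing `r` equally bounded increments
  -- later gives the second.
  have h2 : ∀ ω, ∑ i, (S.state γ h n (s + r) i ω - S.state γ h n s i ω) ^ 2
      ≤ r * ∑ t ∈ Finset.range r,
        ∑ i, (S.state γ h n (s + t + 1) i ω - S.state γ h n (s + t) i ω) ^ 2 := by
    intro ω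
    rw [Finset.sum_comm, Finset.mul_sum]
    refine Finset.sum_le_sum fun i _ => ?_
    have h3 := Finset.sum_range_sub (fun t => S.state γ h n (s + t) i ω) r
    rw [add_zero] at h3
    rw [← h3]
    have h4 := sq_sum_le_card_mul_sum_sq (s := Finset.range r)
      (f := fun t => S.state γ h n (s + t + 1) i ω - S.state γ h n (s + t) i ω)
    rw [Finset.card_range] at h4
    exact h4
  have hint : ∀ t, Integrable (fun ω => ∑ i, (S.state γ h n (s + t + 1) i ω
      - S.state γ h n (s + t) i ω) ^ 2) P := fun t =>
    integrable_finsetSum _ fun i _ => (hinc (s + t) i).integrable_sq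
  refine (integral_mono (integrable_finsetSum _ fun i _ =>
    ((hm.memLp_state (s + r) i).sub (hm.memLp_state s i)).integrable_sq)
    ((integrable_finsetSum _ fun t _ => hint t).const_mul _) h2).trans ?_
  rw [integral_const_mul, integral_finsetSum _ fun t _ => hint t, sq (r : ℝ), mul_assoc]
  refine mul_le_mul_of_nonneg_left ?_ (Nat.cast_nonneg r)
  have h5 : ∀ t ∈ Finset.range r, ∫ ω, ∑ i, (S.state γ h n (s + t + 1) i ω
      - S.state γ h n (s + t) i ω) ^ 2 ∂P
      ≤ 2 * (4 * S.totalWeight ^ 2 * M + M) * S.alpha s ^ 2 := by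
    intro t _
    refine (h1 (s + t)).trans (mul_le_mul_of_nonneg_left ?_ (by positivity))
    exact pow_le_pow_left₀ (S.alpha_pos _).le (hanti' (Nat.le_add_right s t)) 2
  simpa using Finset.sum_le_card_nsmul _ _ _ h5

/-- Contraction of the deviation over a block of `L` steps. -/
theorem exists_deviation_block_le (hm : S.IsModel P γ h n) (hs : S.StepSizeCondition)
    (hanti : ∀ k, S.alpha (k + 1) ≤ S.alpha k) {L : ℕ} (hconn : S.JointlyConnected L) :
    ∃ κ > 0, ∃ c ≥ 0, ∀ s, S.deviation γ h n P (s + L) ≤ S.deviation γ h n P s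
      - κ * S.alpha (s + L) * S.deviation γ h n P s + c * S.alpha s ^ 2 := by
  have hN : 0 < N := Fin.pos (hconn.2 0).nonempty.some
  obtain ⟨M, hM, hV, hW⟩ := hm.exists_moment_bounds hs hN
  obtain ⟨κ, hκ, hpoin⟩ := S.exists_poincare hconn
  have hanti' : Antitone S.alpha := antitone_nat_of_succ_le hanti
  have hA := S.totalWeight_nonneg
  set B := 4 * S.totalWeight ^ 2 * M + M with hB
  have hB0 : 0 ≤ B := by positivity
  -- `R * α(s)²` bounds the expected Dirichlet form of the displacement within a block: `4 *
  -- totalWeight` is from `dirichlet_le`, the rest bounds the squared displacement after at most `L`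
  -- steps.
  set R := 4 * S.totalWeight * (L ^ 2 * (2 * B)) with hR
  have hR0 : 0 ≤ R := by positivity
  -- The half is the loss in `half_dirichlet_sub_le`. In `c`, the first summand collects the `L`
  -- displacement errors, using `α(s + L) ≤ α(0)`, and the second the `O(α²)` terms of the single
  -- steps.
  refine ⟨κ / 2, half_pos hκ, S.alpha 0 * (L * R) + B * L, ?_, fun s => ?_⟩
  · have := S.alpha_pos 0
    positivity
  have hstate := fun t i => hm.memLp_state t i
  have hdirint : ∀ t r, Integrable (fun ω => S.dirichlet t fun i => S.state γ h n r i ω) P :=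
    fun t r => integrable_dirichlet_of_memLp (S := S) (hstate r) t
  have hlow : ∀ t ∈ Finset.Ico s (s + L),
      S.alpha (s + L) * ((∫ ω, S.dirichlet t (fun i => S.state γ h n s i ω) ∂P) / 2
        - R * S.alpha s ^ 2)
      ≤ S.alpha t * ∫ ω, S.dirichlet t (fun i => S.state γ h n t i ω) ∂P := by
    intro t ht
    obtain ⟨ht1, ht2⟩ := Finset.mem_Ico.1 ht
    have hpos : 0 ≤ ∫ ω, S.dirichlet t (fun i => S.state γ h n t i ω) ∂P :=
      integral_nonneg fun ω => S.dirichlet_nonneg t _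
    refine le_trans ?_ (mul_le_mul_of_nonneg_right (hanti' ht2.le) hpos)
    refine mul_le_mul_of_nonneg_left ?_ (S.alpha_pos _).le
    have hdiff : Integrable (fun ω => S.dirichlet t
        fun i => S.state γ h n t i ω - S.state γ h n s i ω) P :=
      integrable_dirichlet_of_memLp (S := S) (fun i => (hstate t i).sub (hstate s i)) t
    have h1 : (∫ ω, S.dirichlet t (fun i => S.state γ h n s i ω) ∂P) / 2
        - ∫ ω, S.dirichlet t (fun i => S.state γ h n t i ω - S.state γ h n s i ω) ∂P
        ≤ ∫ ω, S.dirichlet t (fun i => S.state γ h n t i ω) ∂P := by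
      rw [← integral_div, ← integral_sub ((hdirint t s).div_const _) hdiff]
      exact integral_mono (((hdirint t s).div_const _).sub hdiff) (hdirint t t) fun ω =>
        S.half_dirichlet_sub_le t _ _
    have h2 : ∫ ω, S.dirichlet t (fun i => S.state γ h n t i ω - S.state γ h n s i ω) ∂P
        ≤ R * S.alpha s ^ 2 := by
      have h3 : ∫ ω, S.dirichlet t (fun i => S.state γ h n t i ω - S.state γ h n s i ω) ∂P
          ≤ 4 * S.totalWeight *
            ∫ ω, ∑ i, (S.state γ h n t i ω - S.state γ h n s i ω) ^ 2 ∂P := by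
        rw [← integral_const_mul]
        exact integral_mono hdiff ((integrable_finsetSum _ fun i _ =>
          ((hstate t i).sub (hstate s i)).integrable_sq).const_mul _) fun ω => S.dirichlet_le t _
      have h4 := hm.integral_sum_state_sub_sq_le hanti hV hW s (t - s)
      rw [Nat.add_sub_cancel' ht1, ← hB] at h4
      have h5 : ((t - s : ℕ) : ℝ) ≤ L := by
        exact_mod_cast (by omega : t - s ≤ L)
      have h6 : ((t - s : ℕ) : ℝ) ^ 2 * (2 * B * S.alpha s ^ 2)
          ≤ (L : ℝ) ^ 2 * (2 * B * S.alpha s ^ 2) := by gcongr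
      have h7 := mul_le_mul_of_nonneg_left (h4.trans h6)
        (by positivity : (0 : ℝ) ≤ 4 * S.totalWeight)
      refine h3.trans (h7.trans_eq ?_)
      rw [hR]
      ring
    linarith
  have hsumlow := Finset.sum_le_sum hlow
  have hpoinint : κ * S.deviation γ h n P s
      ≤ ∑ t ∈ Finset.Ico s (s + L), ∫ ω, S.dirichlet t (fun i => S.state γ h n s i ω) ∂P := by
    unfold deviation
    rw [← integral_const_mul, ← integral_finsetSum _ fun t _ => hdirint t s]
    exact integral_mono ((integrable_finsetSum _ fun i _ =>
      ((hstate s i).sub (hm.memLp_meanState s)).integrable_sq).const_mul _)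
      (integrable_finsetSum _ fun t _ => hdirint t s) fun ω => hpoin s _
  rw [← Finset.mul_sum, Finset.sum_sub_distrib, ← Finset.sum_div, Finset.sum_const, Nat.card_Ico,
    Nat.add_sub_cancel_left, nsmul_eq_mul] at hsumlow
  have hsq : ∑ t ∈ Finset.Ico s (s + L), S.alpha t ^ 2 ≤ L * S.alpha s ^ 2 := by
    have : ∀ t ∈ Finset.Ico s (s + L), S.alpha t ^ 2 ≤ S.alpha s ^ 2 := fun t ht =>
      pow_le_pow_left₀ (S.alpha_pos _).le (hanti' (Finset.mem_Ico.1 ht).1) 2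
    simpa using Finset.sum_le_card_nsmul _ _ _ this
  have hmain := hm.deviation_add_le hN hV hW s L
  rw [← hB] at hmain
  have h8 := mul_le_mul_of_nonneg_left hpoinint (S.alpha_pos (s + L)).le
  have h9 : S.alpha (s + L) * (L * (R * S.alpha s ^ 2))
      ≤ S.alpha 0 * (L * (R * S.alpha s ^ 2)) :=
    mul_le_mul_of_nonneg_right (hanti' (Nat.zero_le _)) (by positivity)
  have h10 := mul_le_mul_of_nonneg_left hsq hB0
  nlinarith

/-- Consensus: the deviation from the mean vanishes. -/
theorem tendsto_deviation (hm : S.IsModel P γ h n) (hs : S.StepSizeCondition)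
    (hanti : ∀ k, S.alpha (k + 1) ≤ S.alpha k) {L : ℕ} (hconn : S.JointlyConnected L) :
    Tendsto (S.deviation γ h n P) atTop (𝓝 0) := by
  have hN : 0 < N := Fin.pos (hconn.2 0).nonempty.some
  have hL := hconn.1
  obtain ⟨M, hM, hV, hW⟩ := hm.exists_moment_bounds hs hN
  obtain ⟨κ, hκ, c, hc, hblock⟩ := hm.exists_deviation_block_le hs hanti hconn
  -- The deviation is monotone up to a summable error, so the whole sequence has a limit, which the
  -- subsequence of block ends identifies.
  obtain ⟨ℓ, hℓ⟩ := exists_tendsto_of_le_add (u := S.deviation γ h n P)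
    (b := fun k => (4 * S.totalWeight ^ 2 * M + M) * S.alpha k ^ 2) deviation_nonneg
    (fun k => by positivity) (hs.sum_sq.mul_left _) fun k => by
      have h1 := hm.deviation_succ_le hN hV hW k
      have h2 : 0 ≤ S.alpha k * ∫ ω, S.dirichlet k (fun i => S.state γ h n k i ω) ∂P :=
        mul_nonneg (S.alpha_pos k).le (integral_nonneg fun ω => S.dirichlet_nonneg k _)
      linarith
  have hsub : Tendsto (fun m => S.deviation γ h n P (m * L)) atTop (𝓝 0) := by
    refine tendsto_zero_of_le_sub_mul_add (a := fun m => κ * S.alpha ((m + 1) * L))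
      (b := fun m => c * S.alpha (m * L) ^ 2) (fun m => deviation_nonneg _)
      (fun m => mul_nonneg hκ.le (S.alpha_pos _).le) (fun m => by positivity) ?_ ?_ fun m => ?_
    · refine Summable.mul_left c (hs.sum_sq.comp_injective (i := fun m => m * L) fun a b hab => ?_)
      exact Nat.eq_of_mul_eq_mul_right hL hab
    · simp only [← Finset.mul_sum]
      exact (tendsto_sum_block (antitone_nat_of_succ_le hanti) L hL
        hs.sum_infinite).const_mul_atTop hκ
    · rw [Nat.succ_mul]
      exact hblock (m * L)
  have hmul : Tendsto (fun m : ℕ => m * L) atTop atTop :=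
    tendsto_atTop_mono (fun M => Nat.le_mul_of_pos_right M hL) tendsto_id
  rwa [tendsto_nhds_unique (hℓ.comp hmul) hsub] at hℓ

/-- The mean of the states converges in mean square. -/
theorem exists_limit_meanState (hm : S.IsModel P γ h n) (hs : S.StepSizeCondition) (hN : 0 < N) :
    ∃ xs : Ω → ℝ, MemLp xs 2 P ∧
      Tendsto (fun k => ∫ ω, (S.meanState γ h n k ω - xs ω) ^ 2 ∂P) atTop (𝓝 0) ∧
      ∀ L > 0, ∀ C, ∫ ω, (xs ω - (1 / (N : ℝ)) * ∑ i, S.x0 i) ^ 2 ∂P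
        ≤ S.Mbar2 L C / N * ∑' t, S.alpha t ^ 2 := by
  have hN' : (0 : ℝ) < N := by exact_mod_cast hN
  have hL := hm.memLp_meanState
  have hbound : ∀ B, (∀ k, S.disturbanceMoment γ h n P k ≤ B) → ∀ l k, l ≤ k →
      ‖(hL k).toLp _ - (hL l).toLp _‖ ^ 2 ≤ B / N * ∑ t ∈ Finset.Ico l k, S.alpha t ^ 2 := by
    intro B hB l k hlk
    rw [norm_toLp_sub_sq, hm.integral_meanState_sub_sq hlk, Finset.mul_sum]
    refine Finset.sum_le_sum fun t _ => ?_
    rw [mul_comm]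
    refine mul_le_mul_of_nonneg_right ?_ (sq_nonneg _)
    exact (hm.integral_meanDisturbance_sq_le hN t).trans (by gcongr; exact hB t)
  obtain ⟨M, hM, -, hW⟩ := hm.exists_moment_bounds hs hN
  have hcauchy : CauchySeq fun k => (hL k).toLp (S.meanState γ h n k) := by
    -- Distances beyond `l` are controlled by the tail of the sum of the `α²`.
    refine cauchySeq_of_le_tendsto_0' (fun l => √(M / N * (∑' t, S.alpha t ^ 2
      - ∑ t ∈ Finset.range l, S.alpha t ^ 2))) (fun l k hlk => ?_) ?_
    · rw [dist_comm, dist_eq_norm]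
      refine Real.le_sqrt_of_sq_le ((hbound M hW l k hlk).trans ?_)
      refine mul_le_mul_of_nonneg_left ?_ (by positivity)
      rw [Finset.sum_Ico_eq_sub _ hlk]
      have := hs.sum_sq.sum_le_tsum (Finset.range k) fun _ _ => sq_nonneg _
      linarith
    · have h1 : Tendsto (fun l => M / N * (∑' t, S.alpha t ^ 2
          - ∑ t ∈ Finset.range l, S.alpha t ^ 2)) atTop (𝓝 0) := by
        have := (hs.sum_sq.hasSum.tendsto_sum_nat.const_sub (∑' t, S.alpha t ^ 2)).const_mul
          (M / N)
        simpa using this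
      simpa using h1.sqrt
  obtain ⟨F, hF⟩ := cauchySeq_tendsto_of_complete hcauchy
  have hFL : MemLp F 2 P := Lp.memLp F
  have hFe : hFL.toLp F = F := Lp.toLp_coeFn F hFL
  refine ⟨F, hFL, ?_, fun L hLpos C => ?_⟩
  · have h1 := (tendsto_iff_norm_sub_tendsto_zero.1 hF).pow 2
    rw [zero_pow two_ne_zero] at h1
    refine h1.congr fun k => ?_
    rw [← norm_toLp_sub_sq (hL k) hFL, hFe]
  · have h0 : ∀ ω, S.meanState γ h n 0 ω = (1 / (N : ℝ)) * ∑ i, S.x0 i := fun ω => rfl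
    have h1 : ∫ ω, (F ω - (1 / (N : ℝ)) * ∑ i, S.x0 i) ^ 2 ∂P = ‖F - (hL 0).toLp _‖ ^ 2 := by
      have := norm_toLp_sub_sq hFL (hL 0)
      rw [hFe] at this
      rw [this]
      simp only [h0]
    rw [h1]
    -- The bound on the distance between times `0` and `k` passes to the limit; the mean at time `0`
    -- is a constant.
    have h2 := ((hF.sub_const ((hL 0).toLp _)).norm).pow 2
    refine le_of_tendsto h2 (Eventually.of_forall fun k => ?_)
    have hB := fun k => hm.disturbanceMoment_le_Mbar2 hs hN hLpos C k
    refine (hbound _ hB 0 k (Nat.zero_le k)).trans ?_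
    refine mul_le_mul_of_nonneg_left (S.sum_alpha_le (hs := hs) _) ?_
    exact div_nonneg ((disturbanceMoment_nonneg 0).trans (hB 0)) hN'.le

end System.IsModel

end OTA

/-! ### The theorem. -/

theorem mainTheorem8 {N : ℕ} (S : OTA.System N) (L : ℕ)
    {Ω : Type*} [MeasurableSpace Ω] (P : Measure Ω) [IsProbabilityMeasure P]
    (γ : ℕ → Fin N → Ω → ℝ) (h : ℕ → Fin N → Fin N → Ω → ℂ) (n : ℕ → Fin N → Ω → ℂ)
    (hmodel : S.IsModel P γ h n)
    (hstep : S.StepSizeCondition)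
    (hconn : S.JointlyConnected L)
    (hdecay : S.StepSizeDecay) :
    (∀ k i, MemLp (S.state γ h n k i) 2 P) ∧
    ∃ xs : Ω → ℝ, MemLp xs 2 P ∧
      (∀ i, Tendsto (fun k => ∫ ω, (S.state γ h n k i ω - xs ω) ^ 2 ∂P) atTop (𝓝 0)) ∧
      ∫ ω, xs ω ∂P = (1 / (N : ℝ)) * ∑ i, S.x0 i ∧
      (∃ C, S.IsRatioBound L C) ∧
      ∀ C, S.IsRatioBound L C →
        variance xs P ≤ S.Mbar2 L C / N * ∑' t, S.alpha t ^ 2 := by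
  have hN : 0 < N := Fin.pos (hconn.2 0).nonempty.some
  obtain ⟨xs, hxs, hlim, hvar⟩ := hmodel.exists_limit_meanState hstep hN
  have hL := hmodel.memLp_meanState
  have hmean : ∫ ω, xs ω ∂P = (1 / (N : ℝ)) * ∑ i, S.x0 i := by
    -- The expectation of the mean state does not depend on `k`, and mean-square convergence implies
    -- convergence of expectations.
    have h1 : ∀ k, ((1 / (N : ℝ)) * ∑ i, S.x0 i - ∫ ω, xs ω ∂P) ^ 2
        ≤ ∫ ω, (S.meanState γ h n k ω - xs ω) ^ 2 ∂P := by
      intro k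
      rw [← hmodel.integral_meanState k, ← integral_sub ((hL k).integrable (by norm_num))
        (hxs.integrable (by norm_num))]
      exact OTA.sq_integral_le ((hL k).sub hxs)
    have h2 := ge_of_tendsto' hlim h1
    have h3 := pow_eq_zero_iff two_ne_zero |>.1 (le_antisymm h2 (sq_nonneg _))
    linarith
  refine ⟨hmodel.memLp_state, xs, hxs, fun i => ?_, hmean,
    S.exists_isRatioBound hstep hdecay L hconn.1, fun C _ => ?_⟩
  · have hdev := hmodel.tendsto_deviation hstep hdecay.anti hconn
    -- The distance from `x_i` to the limit is split at the mean of the states, with `(a + b)² ≤ 2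
    -- a² + 2 b²`.
    have hbd := (hdev.const_mul 2).add (hlim.const_mul 2)
    rw [mul_zero, add_zero] at hbd
    refine squeeze_zero (fun k => integral_nonneg fun ω => sq_nonneg _) (fun k => ?_) hbd
    have i1 : Integrable (fun ω => ∑ i, (S.state γ h n k i ω - S.meanState γ h n k ω) ^ 2) P :=
      integrable_finsetSum _ fun i _ => ((hmodel.memLp_state k i).sub (hL k)).integrable_sq
    have i2 : Integrable (fun ω => (S.meanState γ h n k ω - xs ω) ^ 2) P :=
      ((hL k).sub hxs).integrable_sq
    unfold OTA.System.deviation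
    rw [← integral_const_mul, ← integral_const_mul,
      ← integral_add (i1.const_mul _) (i2.const_mul _)]
    refine integral_mono ((hmodel.memLp_state k i).sub hxs).integrable_sq
      ((i1.const_mul _).add (i2.const_mul _)) fun ω => ?_
    have h1 := Finset.single_le_sum
      (f := fun i => (S.state γ h n k i ω - S.meanState γ h n k ω) ^ 2)
      (fun i _ => sq_nonneg _) (Finset.mem_univ i)
    have h2 : (S.state γ h n k i ω - xs ω) ^ 2
        ≤ 2 * (S.state γ h n k i ω - S.meanState γ h n k ω) ^ 2
          + 2 * (S.meanState γ h n k ω - xs ω) ^ 2 := by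
      nlinarith [sq_nonneg ((S.state γ h n k i ω - S.meanState γ h n k ω)
        - (S.meanState γ h n k ω - xs ω))]
    change (S.state γ h n k i ω - xs ω) ^ 2 ≤ _
    linarith
  · rw [variance_eq_integral hxs.aemeasurable, hmean]
    exact hvar L hconn.1 C
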